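/- Let $\mathfrak g$ be a simple finite-dimensional complex Lie algebra, given by Chevalley generators $e_k,f_k$ ($k=1,\dots,r$), with simple coroots $\check\alpha_k=[e_k,f_k]$, and the Serre relations for a generalized Cartan matrix $(c_{k,l})$. Let $\tilde\alpha$ be its highest root, $e$ a generator of the root space $\mathfrak g_{\tilde\alpha}$, and $h$ the Coxeter number, so that $h-1$ is the height of $\tilde\alpha$. Let $\mathcal I$ be a set with a map $i\mapsto\bar i$ to $\{1,\dots,r\}$ all of whose fibres $\mathcal I_k$ are countably infinite. *Polydifferentials.* A polydifferential is a family $\zeta=(\zeta^X)_X$, indexed by the finite subsets $X\subset\mathcal I$, where $\zeta^X$ is a rational function of $(t_i)_{i\in X}$ (and of parameters) times $\prod_{i\in X}dt_i$, the $dt_i$ commuting with each other. For a dominant integral weight $\lambda$ let $V(\lambda)$ be the smallest space of polydifferentials with parameter $z$ that contains $1$ and is stable under the operators $$\tilde f_k=\sum_{i\in\mathcal I_k}dt_i\Big(\frac{\lambda(\check\alpha_k)}{t_i-z}-\sum_{j\ne i}\frac{c_{k,\bar j}}{t_i-t_j}\iota_{\partial/\partial t_j}\Big).$$ Then $V(\lambda)$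 carries a (unique) representation of $\mathfrak g$ in which $f_k$ acts as $\tilde f_k$ and $e_k$ acts by $(e_k\zeta)^X=-\operatorname{res}_{t_i=\infty}\zeta^{X\cup\{i\}}$ for $i\in\mathcal I_k\setminus X$. Let $n\ge 2$, let $\lambda_1,\dots,\lambda_n$ be dominant integral weights, and put $V(\boldsymbol\lambda)=V(\lambda_1)\otimes\cdots\otimes V(\lambda_n)$. Its element $\zeta_1\otimes\cdots\otimes\zeta_n$ is viewed, for given $(z_1,\dots,z_n)$, as the polydifferential $\zeta_1(z_1)\cdots\zeta_n(z_n)$. Let $U_n\subset\mathbb C^n$ be the space of $n$-tuples of pairwise distinct complex numbers with sum $0$, and let $$\mathcal E(\mathbf z)=\sum_{\nu=1}^n 1\otimes\cdots\otimes z_\nu e\otimes\cdots\otimes 1$$ with $z_\nu e$ acting on $V(\lambda_\nu)$; this is an endomorphism of $\mathcal O_{U_n}\otimes V(\boldsymbol\lambda)$. Let $\ell\ge1$ be an integer such that every $V(\lambda_\nu)$ is of level $\le\ell$, i.e. $e^{1+\ell}=0$ on $V(\lambda_\nu)$, and put $$\mathcal W_\ell(\boldsymbol\lambda)=\ker\big(\mathcal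 E^{1+\ell}\,|\,\mathcal O_{U_n}\otimes V(\boldsymbol\lambda)^{\mathfrak g}\big).$$ *Residues.* $\operatorname{res}_{(t_i\to t_j)}$ is the residue along $t_i=t_j$ in the variable $t_i$, with $t_j$ as a parameter. For a sequence $I=(i_N,\dots,i_1)$ in $\mathcal I$ without repetition let $\operatorname{res}_I=\operatorname{res}_{(t_{i_2}\to t_{i_1})}\cdots\operatorname{res}_{(t_{i_N}\to t_{i_{N-1}})}$ (the identity if $N=1$); on the resulting diagonal the common value of the coordinates $t_{i_1},\dots,t_{i_N}$ is denoted $t_{\{I\}}$. **Corollary.** Let $\zeta$ be a section of $\mathcal O_{U_n}\otimes V(\boldsymbol\lambda)^{\mathfrak g}$ over an open subset $U$ of $U_n$. Then $\zeta$ lies in $\mathcal W_\ell(\boldsymbol\lambda)$ if and only if for every $(1+\ell)$-tuple $(I_0,\dots,I_\ell)$ of sequences in $\mathcal I$, each of length $h-1$ and such that the concatenation $I_0I_1\cdots I_\ell$ is without repetition, $\operatorname{res}_{I_0}\operatorname{res}_{I_1}\cdots\operatorname{res}_{I_\ell}\zeta$ vanishes on the diagonal $t_{\{I_0\}}=t_{\{I_1\}}=\cdots=t_{\{I_\ell\}}$.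 That is: for every $\mathbf z\in U$ and every finite $X\subset\mathcal I$ containing all terms of $I_0,\dots,I_\ell$, the coefficient of $\operatorname{res}_{I_0}\cdots\operatorname{res}_{I_\ell}\zeta^X(\mathbf z)$ tends to $0$ at every point of this diagonal at which the common value of the $t_{\{I_k\}}$, the remaining $t_j$ ($j\in X$) and the $z_\nu$ are such that no $t$-value equals a $z_\nu$, no remaining $t_j$ equals the common value, and the remaining $t_j$ are pairwise distinct. -/

import Mathlib

open Filter Topology
open scoped TensorProduct

-- Associative algebras are viewed as Lie algebras with the commutator bracket.
attribute [local instance] LieRing.ofAssociativeRing LieAlgebra.ofAssociativeAlgebra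

noncomputable section

namespace WZW

/-! ### The Lie algebra of a generalized Cartan matrix -/

/-- Generalized Cartan matrices `(c_{k,l})`. -/
structure IsGCM {r : ℕ} (A : Matrix (Fin r) (Fin r) ℤ) : Prop where
  diag : ∀ k, A k k = 2
  nonpos : ∀ k l, k ≠ l → A k l ≤ 0
  zero_iff : ∀ k l, A k l = 0 ↔ A l k = 0

/-- The complex Lie algebra presented by the Chevalley generators `e_k, f_k` (and
`h_k = [e_k, f_k]`, the simple coroots) and the Serre relations. -/
abbrev LieAlg {r : ℕ} (A : Matrix (Fin r) (Fin r) ℤ) : Type := A.ToLieAlgebra ℂ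

section LieAlg

variable {r : ℕ} (A : Matrix (Fin r) (Fin r) ℤ)

/-- The class in the Lie algebra of one of the generators of its presentation. -/
def gen (x : CartanMatrix.Generators (Fin r)) : LieAlg A :=
  LieSubmodule.Quotient.mk (N := CartanMatrix.Relations.toIdeal ℂ A) (FreeLieAlgebra.of ℂ x)

/-- The generator `e_k`. -/
def genE (k : Fin r) : LieAlg A := gen A (.E k)

/-- The generator `f_k`. -/
def genF (k : Fin r) : LieAlg A := gen A (.F k)

/-- The simple coroot `[e_k, f_k]`. -/
def genH (k : Fin r) : LieAlg A := gen A (.H k)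

/-- The weight space of weight `∑_l α_l • (l-th simple root)`, where the `l`-th simple root takes
the value `A k l` on the `k`-th simple coroot. -/
def rootSpace (α : Fin r → ℤ) : Submodule ℂ (LieAlg A) where
  carrier := {x | ∀ k, ⁅genH A k, x⁆ = ((∑ l, A k l * α l : ℤ) : ℂ) • x}
  add_mem' := by
    intro x y hx hy k
    rw [lie_add, hx k, hy k, smul_add]
  zero_mem' := by
    intro k
    rw [lie_zero, smul_zero]
  smul_mem' := by
    intro c x hx k
    rw [lie_smul, hx k, smul_comm]

/-- Roots, written in coordinates with respect to the simple roots. -/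
def IsRoot (α : Fin r → ℤ) : Prop := α ≠ 0 ∧ rootSpace A α ≠ ⊥

/-- The highest root: the root `θ` such that `θ - α` is a nonnegative combination of simple roots
for every root `α`. -/
def IsHighestRoot (θ : Fin r → ℤ) : Prop := IsRoot A θ ∧ ∀ α, IsRoot A α → α ≤ θ

/-- The Coxeter number: one more than the largest height of a root, that is, than the number of
simple roots (with multiplicity) in the highest root. -/
def coxeterNumber : ℕ := 1 + sSup {N : ℕ | ∃ α, IsRoot A α ∧ ∑ k, α k = (N : ℤ)}

end LieAlg

/-! ### Polydifferentials in the variables `t_i`, depending on a parameter `z`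

A relative rational polydifferential `ω = ∑_X ω^X`, `X` running over the finite subsets of `I`, is
given by the coefficients of its components `ω^X = ω X t z ∏_{i ∈ X} dt_i`.  All polydifferentials
that occur have poles along `t_i = t_j`, `t_i = z` and `t_i = ∞` only, so that the coefficients are
functions on the complement of the first two kinds of divisors; they are extended by `0`. -/

/-- Families of coefficients: `ω X t z` is the coefficient of `∏_{i ∈ X} dt_i` at `(t, z)`. -/
abbrev PolyDiff (I : Type*) : Type _ := Finset I → (I → ℂ) → ℂ → ℂ

/-- The coordinates `t_i`, `i ∈ X`, are pairwise distinct and different from `z`. -/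
def IsConf {I : Type*} (X : Finset I) (t : I → ℂ) (z : ℂ) : Prop :=
  Set.InjOn t X ∧ ∀ i ∈ X, t i ≠ z

section Single

variable {r : ℕ} (A : Matrix (Fin r) (Fin r) ℤ) {I : Type*} [DecidableEq I] (π : I → Fin r)

/-- The polydifferential `1`. -/
def oneForm (I : Type*) [DecidableEq I] : PolyDiff I := fun X _ _ => if X = ∅ then 1 else 0

open Classical in
/-- The operator `f̃_k = ∑_{π i = k} Φ_i` attached to the weight `lam`, where `Φ_i` multiplies
`∏_{j ∈ Y} dt_j`, `i ∉ Y`, with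
`(lam(k-th coroot) / (t_i - z) - ∑_{j ∈ Y} A k (π j) / (t_i - t_j)) dt_i`. -/
def fTilde (lam : Fin r → ℕ) (k : Fin r) : PolyDiff I →ₗ[ℂ] PolyDiff I where
  toFun ω := fun X t z =>
    if IsConf X t z then
      ∑ i ∈ X.filter (fun i => π i = k),
        ((lam k : ℂ) / (t i - z) - ∑ j ∈ X.erase i, (A k (π j) : ℂ) / (t i - t j)) *
          ω (X.erase i) t z
    else 0
  map_add' := by
    intro ω η
    funext X t z
    by_cases h : IsConf X t z
    · simp [h, mul_add, Finset.sum_add_distrib]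
    · simp [h]
  map_smul' := by
    intro c ω
    funext X t z
    by_cases h : IsConf X t z
    · simp only [h, if_true, Pi.smul_apply, smul_eq_mul, RingHom.id_apply, Finset.mul_sum]
      exact Finset.sum_congr rfl fun i _ => by ring
    · simp [h]

/-- The space `V(lam)` of polydifferentials: the smallest subspace that contains `1` and is stable
under the operators `f̃_k`. -/
def V (lam : Fin r → ℕ) : Submodule ℂ (PolyDiff I) :=
  sInf {W | oneForm I ∈ W ∧ ∀ k, W ≤ W.comap (fTilde A π lam k)}

/-- `ρ` is the representation of the Lie algebra on `V(lam)` for which `f_k` acts as `f̃_k` and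
`e_k` acts by minus the residue at infinity: if `π i = k`, `i ∉ X`, then
`(e_k v)^X = - Res_{t_i = ∞} v^{X ∪ {i}}`.  Poles being logarithmic, that is the limit of `t_i`
times the coefficient for `t_i → ∞`.  As every fibre of `π` is infinite, this determines `e_k v`,
so that there is at most one such `ρ`. -/
structure IsAction (lam : Fin r → ℕ) (ρ : LieAlg A →ₗ⁅ℂ⁆ Module.End ℂ (V A π lam)) : Prop where
  f_act : ∀ (k : Fin r) (v : V A π lam),
    (ρ (genF A k) v : PolyDiff I) = fTilde A π lam k (v : PolyDiff I)
  e_act : ∀ (k : Fin r) (v : V A π lam) (i : I) (X : Finset I) (t : I → ℂ) (z : ℂ),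
    π i = k → i ∉ X → IsConf X t z →
      Tendsto (fun s : ℂ => s * (v : PolyDiff I) (insert i X) (Function.update t i s) z)
        (Bornology.cobounded ℂ) (𝓝 ((ρ (genE A k) v : PolyDiff I) X t z))

end Single

/-! ### Tensor products -/

section Tensor

variable {r : ℕ} (A : Matrix (Fin r) (Fin r) ℤ) {I : Type*} [DecidableEq I] (π : I → Fin r)
variable {n : ℕ} (lam : Fin n → Fin r → ℕ)

/-- `V(lam_1) ⊗ ⋯ ⊗ V(lam_n)`. -/
abbrev VT : Type _ := ⨂[ℂ] ν : Fin n, V A π (lam ν)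

/-- `1 ⊗ ⋯ ⊗ T ⊗ ⋯ ⊗ 1` with `T` in the factor `ν`. -/
def actAt (ν : Fin n) (T : Module.End ℂ (V A π (lam ν))) : Module.End ℂ (VT A π lam) :=
  PiTensorProduct.map (Function.update (fun _ => LinearMap.id) ν T)

variable (ρ : ∀ ν, LieAlg A →ₗ⁅ℂ⁆ Module.End ℂ (V A π (lam ν)))

/-- The invariants of the Lie algebra in the tensor product of the representations `ρ ν`. -/
def invariants : Submodule ℂ (VT A π lam) :=
  ⨅ x : LieAlg A, LinearMap.ker (∑ ν, actAt A π lam ν (ρ ν x))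

/-- The coefficient of `∏_{i ∈ X} dt_i` at `(t, z)` of the polydifferential with parameters
`z_1, …, z_n` given by an element of the tensor product: `v_1 ⊗ ⋯ ⊗ v_n` is sent to the
(commutative) product `v_1(z_1) ⋯ v_n(z_n)`, hence to the sum over all ways `c` to distribute `X`
over the `n` factors. -/
def coeff (X : Finset I) (z : Fin n → ℂ) (t : I → ℂ) : VT A π lam →ₗ[ℂ] ℂ :=
  ∑ c : X → Fin n, PiTensorProduct.lift
    ((MultilinearMap.mkPiAlgebra ℂ (Fin n) ℂ).compLinearMap fun ν =>
      { toFun := fun v : V A π (lam ν) =>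
          (v : PolyDiff I)
            ((Finset.univ.filter fun i : X => c i = ν).map (Function.Embedding.subtype _)) t (z ν)
        map_add' := fun _ _ => rfl
        map_smul' := fun _ _ => rfl })

end Tensor

/-! ### Iterated residues -/

section Residues

variable {I : Type*} [DecidableEq I]

/-- `Res_{t_i → t_j}` of a function with at most a simple pole along `t_i = t_j`; the result does
not depend on `t_i`. -/
def resTo (i j : I) (F : (I → ℂ) → ℂ) : (I → ℂ) → ℂ := fun t =>
  limUnder (𝓝[≠] (t j)) fun s : ℂ => (s - t j) * F (Function.update t i s)

/-- `Res_L = Res_{t_{i_2} → t_{i_1}} ⋯ Res_{t_{i_N} → t_{i_{N-1}}}` for `L = [i_N, …, i_1]`, the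
identity if `N = 1`.  On the diagonal the coordinate `t_L` is the one with index `i_1`. -/
def resSeq : List I → ((I → ℂ) → ℂ) → ((I → ℂ) → ℂ)
  | [], F => F
  | [_], F => F
  | i :: j :: L, F => resSeq (j :: L) (resTo i j F)

/-- `Res_{L_0} Res_{L_1} ⋯ Res_{L_ℓ}`. -/
def resIter (Ls : List (List I)) (F : (I → ℂ) → ℂ) : (I → ℂ) → ℂ := Ls.foldr resSeq F

/-- The coordinates `t_i`, `i ∈ X`, are pairwise distinct and different from `z_1, …, z_n`. -/
def IsConfN {n : ℕ} (X : Finset I) (z : Fin n → ℂ) (t : I → ℂ) : Prop :=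
  Set.InjOn t X ∧ ∀ i ∈ X, ∀ ν, t i ≠ z ν

/-- General points of the locus where the `t_i`, `i ∈ D`, coincide: these `t_i` have a common value
`a`, while the `t_i`, `i ∈ X \ D`, are pairwise distinct and different from `a`, and no `t_i`,
`i ∈ X`, equals some `z_ν`. -/
def IsDiagPoint {n : ℕ} (X D : Finset I) (z : Fin n → ℂ) (p : I → ℂ) : Prop :=
  ∃ a : ℂ, (∀ i ∈ D, p i = a) ∧ Set.InjOn p ↑(X \ D) ∧ (∀ i ∈ X \ D, p i ≠ a) ∧
    ∀ i ∈ X, ∀ ν, p i ≠ z ν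

/-- The function `F`, given outside the loci `t_i = t_j` and `t_i = z_ν` (`i, j ∈ X`), extends by
`0` to the locus where the `t_i`, `i ∈ D`, coincide. -/
def VanishesOnDiag {n : ℕ} (X D : Finset I) (z : Fin n → ℂ) (F : (I → ℂ) → ℂ) : Prop :=
  ∀ p, IsDiagPoint X D z p → Tendsto F (𝓝[{t | IsConfN X z t}] p) (𝓝 0)

end Residues

/-! ### Sections over open subsets of the configuration space -/

/-- The space of `n`-tuples of pairwise distinct complex numbers with sum zero. -/
def confSpace (n : ℕ) : Set (Fin n → ℂ) := {z | Function.Injective z ∧ ∑ ν, z ν = 0}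

/-- The holomorphic functions on `U`, i.e. those that are locally the restriction of a holomorphic
function of `n` variables. -/
def hol {n : ℕ} (U : Set (Fin n → ℂ)) : Subalgebra ℂ (U → ℂ) where
  carrier := {f | ∀ z : U, ∃ g : (Fin n → ℂ) → ℂ, AnalyticAt ℂ g z ∧ ∀ᶠ w : U in 𝓝 z, f w = g w}
  mul_mem' := by
    intro f₁ f₂ h₁ h₂ z
    obtain ⟨g₁, a₁, e₁⟩ := h₁ z
    obtain ⟨g₂, a₂, e₂⟩ := h₂ z
    exact ⟨g₁ * g₂, a₁.mul a₂, by filter_upwards [e₁, e₂] with w h h'; simp [h, h']⟩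
  add_mem' := by
    intro f₁ f₂ h₁ h₂ z
    obtain ⟨g₁, a₁, e₁⟩ := h₁ z
    obtain ⟨g₂, a₂, e₂⟩ := h₂ z
    exact ⟨g₁ + g₂, a₁.add a₂, by filter_upwards [e₁, e₂] with w h h'; simp [h, h']⟩
  algebraMap_mem' := by
    intro c z
    exact ⟨fun _ => c, analyticAt_const, Eventually.of_forall fun w => by simp⟩

/-- The coordinate function `z_ν` on `U`. -/
def coord {n : ℕ} (U : Set (Fin n → ℂ)) (ν : Fin n) : hol U :=
  ⟨fun z => (z : Fin n → ℂ) ν, fun _ =>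
    ⟨fun z => z ν, (ContinuousLinearMap.proj (R := ℂ) (φ := fun _ : Fin n => ℂ) ν).analyticAt _,
      Eventually.of_forall fun _ => rfl⟩⟩

/-- Evaluation of a section of `O_U ⊗ W` in a point of `U`. -/
def evalSec {n : ℕ} {U : Set (Fin n → ℂ)} {W : Type*} [AddCommMonoid W] [Module ℂ W] (z : U) :
    (hol U ⊗[ℂ] W) →ₗ[ℂ] W :=
  (TensorProduct.lid ℂ W).toLinearMap ∘ₗ
    LinearMap.rTensor W ((LinearMap.proj (R := ℂ) (φ := fun _ : U => ℂ) z) ∘ₗ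
      (hol U).val.toLinearMap)

section Bundle

variable {r : ℕ} (A : Matrix (Fin r) (Fin r) ℤ) {I : Type*} [DecidableEq I] (π : I → Fin r)
variable {n : ℕ} (lam : Fin n → Fin r → ℕ)
variable (ρ : ∀ ν, LieAlg A →ₗ⁅ℂ⁆ Module.End ℂ (V A π (lam ν)))

/-- The endomorphism `∑_ν 1 ⊗ ⋯ ⊗ z_ν e ⊗ ⋯ ⊗ 1` of `O_U ⊗ V(lam_1) ⊗ ⋯ ⊗ V(lam_n)`. -/
def opE (U : Set (Fin n → ℂ)) (e : LieAlg A) : Module.End ℂ (hol U ⊗[ℂ] VT A π lam) :=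
  ∑ ν, TensorProduct.map (LinearMap.mulLeft ℂ (coord U ν)) (actAt A π lam ν (ρ ν e))

/-- The sections over `U` of the WZW bundle of level `ℓ`: the kernel of the `(1 + ℓ)`-th power of
`opE` on `O_U ⊗ (V(lam_1) ⊗ ⋯ ⊗ V(lam_n))^𝔤`. -/
def wzw (U : Set (Fin n → ℂ)) (e : LieAlg A) (ℓ : ℕ) :
    Submodule ℂ (hol U ⊗[ℂ] invariants A π lam ρ) :=
  LinearMap.ker ((opE A π lam ρ U e ^ (1 + ℓ)) ∘ₗ
    LinearMap.lTensor (hol U) (invariants A π lam ρ).subtype)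

/-- For a section `ζ` of the invariants over `U` and `z ∈ U`: the coefficient of
`∏_{i ∈ X} dt_i` of the polydifferential `ζ(z)`, as a function of `t`. -/
def secCoeff {U : Set (Fin n → ℂ)} (ζ : hol U ⊗[ℂ] invariants A π lam ρ) (X : Finset I) (z : U) :
    (I → ℂ) → ℂ :=
  fun t => coeff A π lam X z t (evalSec z ζ : invariants A π lam ρ)

end Bundle

end WZW

end

noncomputable section

namespace WZW


/-! ### Correlators -/

section Corr

variable {g W ι I : Type*} [LieRing g] [LieAlgebra ℂ g] [AddCommGroup W] [Module ℂ W]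
  [Fintype ι] [DecidableEq I]

/-! The coefficients of a polydifferential in `VT A π lam` are correlators (`corr`) of the currents
`genE A (π i)` placed at the points t_i. As a function of t_i, a correlator has simple poles only.
At t_j the residue replaces the current of j by a bracket with that of i; at z_ν it lets the current
of i act on the ν-th factor (`coeff_eq_corr`).

Hence an iterated residue along a sequence of length h - 1 merges its currents into an iterated
bracket of h - 1 simple root vectors, which is a multiple of e (`seqLie_eq_smul_highest`). As e
commutes with all e_k, the merged current has no poles at the other points: it acts on the vector as
∑_ν (t - z_ν)⁻¹ e^(ν) (`resIter_corr`). In the limit on the diagonal, with common value a, the 1 + ℓ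
residues give a constant times the remaining correlator of the vector (∑_ν (a - z_ν)⁻¹ e^(ν))^(1+ℓ)
v (`tendsto_resIter`). The constant is nonzero for suitable sequences (`exists_seqLie_ne_zero`), and
a vector whose correlators all vanish is zero, because residues at the z_ν read off its matrix
coefficients (`eq_zero_of_corr`). So the residue condition says that this power kills the invariant
vector v.

It remains to compare with (∑ z_ν e^(ν))^(1+ℓ). Since v is invariant, z_ν may be replaced by w_ν =
z_ν - a (`siteSum_pow_sub`). Inverting the w_ν is a matter of sl₂ (`siteSum_pow_inv`). The double
commutator with ∑ f^(ν) takes ∑ w_ν e^(ν) to a multiple of ∑ w_ν f^(ν), so both have vanishing m-th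
power on v if the first one does. Moreover ∑ w_ν f^(ν) and ∑ w_ν⁻¹ e^(ν) belong to an sl₂-triple for
which v has weight zero, and on weight zero vectors the raising and the lowering operator have the
same order of nilpotency.

The representation on V(λ) is built from functions on words in the simple roots, the matrix
coefficients of products of the e_k. `wordForm` sends such a function to its correlators, and the
Ward identity `corr_ward` shows that it turns f_k into f̃_k and e_k into the residue at infinity. -/

/-- The correlator of the currents `x i` inserted at the points `t i`, `i ∈ L`, defined by its
partial fraction expansion in the variable of the first insertion. -/
def corr (act : ι → g →ₗ⁅ℂ⁆ Module.End ℂ W) (z : ι → ℂ) (v : W) (t : I → ℂ) :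
    List I → (I → g) → Module.Dual ℂ W → ℂ
  | [], _, φ => φ v
  | i :: L, x, φ =>
      ∑ j ∈ L.toFinset, (t i - t j)⁻¹ * corr act z v t L (Function.update x j ⁅x j, x i⁆) φ +
        ∑ ν, (t i - z ν)⁻¹ * corr act z v t L x (φ ∘ₗ act ν (x i))

variable {act : ι → g →ₗ⁅ℂ⁆ Module.End ℂ W} {z : ι → ℂ} {v : W} {t : I → ℂ}

lemma corr_congr {L : List I} {x y : I → g} {s : I → ℂ} (h : ∀ j ∈ L, x j = y j)
    (hs : ∀ j ∈ L, t j = s j) (φ : Module.Dual ℂ W) :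
    corr act z v t L x φ = corr act z v s L y φ := by
  induction L generalizing x y φ with
  | nil => rfl
  | cons i L ih =>
    simp only [corr]
    have hi := h i (by simp)
    have hL : ∀ j ∈ L, x j = y j := fun j hj => h j (by simp [hj])
    have hsL : ∀ j ∈ L, t j = s j := fun j hj => hs j (by simp [hj])
    congr 1
    · refine Finset.sum_congr rfl fun j hj => ?_
      rw [List.mem_toFinset] at hj
      rw [hs i (by simp), hsL j hj, hi, hL j hj]
      congr 1
      refine ih (fun k hk => ?_) hsL φ
      by_cases hkj : k = j
      · subst hkj; simp
      · simp [hkj, hL k hk]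
    · refine Finset.sum_congr rfl fun ν _ => ?_
      rw [hs i (by simp), hi, ih hL hsL]

lemma corr_update_of_notMem {L : List I} {x : I → g} {j : I} (hj : j ∉ L) (a : g)
    (φ : Module.Dual ℂ W) :
    corr act z v t L (Function.update x j a) φ = corr act z v t L x φ :=
  corr_congr (fun k hk => by
    rw [Function.update_of_ne (by rintro rfl; exact hj hk)]) (fun _ _ => rfl) φ

lemma corr_functional (L : List I) (x : I → g) (c : ℂ) (φ ψ : Module.Dual ℂ W) :
    corr act z v t L x (c • φ + ψ) = c * corr act z v t L x φ + corr act z v t L x ψ := by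
  induction L generalizing x φ ψ with
  | nil => simp [corr]
  | cons i L ih =>
    simp only [corr, LinearMap.add_comp, LinearMap.smul_comp, ih, mul_add, Finset.sum_add_distrib,
      Finset.mul_sum, mul_left_comm c]
    ring

lemma corr_vector (L : List I) (x : I → g) (c : ℂ) (u w : W) (φ : Module.Dual ℂ W) :
    corr act z (c • u + w) t L x φ = c * corr act z u t L x φ + corr act z w t L x φ := by
  induction L generalizing x φ with
  | nil => simp [corr]
  | cons i L ih =>
    simp only [corr, ih, mul_add, Finset.sum_add_distrib, Finset.mul_sum, mul_left_comm c]
    ring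

/-- The correlator as a linear function of the functional. -/
def corrDual (act : ι → g →ₗ⁅ℂ⁆ Module.End ℂ W) (z : ι → ℂ) (v : W) (t : I → ℂ) (L : List I)
    (x : I → g) : Module.Dual ℂ W →ₗ[ℂ] ℂ where
  toFun := corr act z v t L x
  map_add' φ ψ := by simpa using corr_functional (act := act) (z := z) (v := v) (t := t) L x 1 φ ψ
  map_smul' c φ := by
    -- At zero functionals and c = -1 the identity reads C = -C + C, so the value C at 0 vanishes.
    have h0 := corr_functional (act := act) (z := z) (v := v) (t := t) L x (-1) 0 0
    have h := corr_functional (act := act) (z := z) (v := v) (t := t) L x c φ 0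
    simp only [smul_zero, add_zero] at h0 h
    have h0' : corr act z v t L x 0 = 0 := by linear_combination h0
    simpa [h0'] using h

/-- The correlator as a linear function of the vector. -/
def corrVec (act : ι → g →ₗ⁅ℂ⁆ Module.End ℂ W) (z : ι → ℂ) (t : I → ℂ) (L : List I)
    (x : I → g) (φ : Module.Dual ℂ W) : W →ₗ[ℂ] ℂ where
  toFun v := corr act z v t L x φ
  map_add' u w := by simpa using corr_vector (act := act) (z := z) (t := t) L x 1 u w φ
  map_smul' c u := by
    have h0 := corr_vector (act := act) (z := z) (t := t) L x (-1) 0 0 φ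
    have h := corr_vector (act := act) (z := z) (t := t) L x c u 0 φ
    simp only [smul_zero, add_zero] at h0 h
    have h0' : corr act z 0 t L x φ = 0 := by linear_combination h0
    simpa [h0'] using h

lemma corrDual_apply (L : List I) (x : I → g) (φ : Module.Dual ℂ W) :
    corrDual act z v t L x φ = corr act z v t L x φ := rfl

lemma corrVec_apply (L : List I) (x : I → g) (φ : Module.Dual ℂ W) :
    corrVec act z t L x φ v = corr act z v t L x φ := rfl

lemma corr_cons_update_self {i : I} {L : List I} (hi : i ∉ L) (x : I → g) (d : g)
    (φ : Module.Dual ℂ W) :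
    corr act z v t (i :: L) (Function.update x i d) φ =
      ∑ k ∈ L.toFinset, (t i - t k)⁻¹ * corr act z v t L (Function.update x k ⁅x k, d⁆) φ +
        ∑ ν, (t i - z ν)⁻¹ * corr act z v t L x (φ ∘ₗ act ν d) := by
  simp only [corr, Function.update_self, corr_update_of_notMem hi]
  congr 1
  refine Finset.sum_congr rfl fun k hk => ?_
  have hki : k ≠ i := by rintro rfl; exact hi (List.mem_toFinset.1 hk)
  rw [Function.update_of_ne hki, Function.update_comm hki.symm, corr_update_of_notMem hi]

lemma corr_cons_update_of_ne {i j : I} {L : List I} (hji : j ≠ i) (x : I → g) (d : g)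
    (φ : Module.Dual ℂ W) :
    corr act z v t (i :: L) (Function.update x j d) φ =
      ∑ k ∈ L.toFinset, (t i - t k)⁻¹ *
        (if k = j then corr act z v t L (Function.update x j ⁅d, x i⁆) φ else
          corr act z v t L (Function.update (Function.update x k ⁅x k, x i⁆) j d) φ) +
        ∑ ν, (t i - z ν)⁻¹ * corr act z v t L (Function.update x j d) (φ ∘ₗ act ν (x i)) := by
  simp only [corr, Function.update_of_ne hji.symm]
  congr 1
  refine Finset.sum_congr rfl fun k _ => ?_
  split_ifs with hkj
  · subst hkj; rw [Function.update_self, Function.update_idem]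
  · rw [Function.update_of_ne hkj, Function.update_comm (Ne.symm hkj)]

/-- A repeated index would make the current enter several times, hence the condition `Nodup`. -/
lemma corr_update_linear {L : List I} (hL : L.Nodup) {j : I} (hj : j ∈ L) (x : I → g) (c : ℂ)
    (a b : g) (φ : Module.Dual ℂ W) :
    corr act z v t L (Function.update x j (c • a + b)) φ =
      c * corr act z v t L (Function.update x j a) φ +
        corr act z v t L (Function.update x j b) φ := by
  induction L generalizing x φ j a b with
  | nil => simp at hj
  | cons i L ih =>
    have hi := (List.nodup_cons.1 hL).1
    have hL' := (List.nodup_cons.1 hL).2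
    by_cases hji : j = i
    · subst hji
      simp only [corr_cons_update_self hi, map_add, map_smul, LinearMap.comp_add,
        LinearMap.comp_smul, corr_functional, lie_add, lie_smul, mul_add, Finset.mul_sum]
      rw [add_add_add_comm, ← Finset.sum_add_distrib, ← Finset.sum_add_distrib]
      congr 1
      · refine Finset.sum_congr rfl fun k hk => ?_
        rw [ih hL' (List.mem_toFinset.1 hk)]; ring
      · refine Finset.sum_congr rfl fun ν _ => ?_
        ring
    · have hjL : j ∈ L := by simpa [hji] using hj
      simp only [corr_cons_update_of_ne hji, ih hL' hjL, add_lie, smul_lie, mul_add,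
        Finset.mul_sum]
      rw [add_add_add_comm, ← Finset.sum_add_distrib, ← Finset.sum_add_distrib]
      congr 1
      · refine Finset.sum_congr rfl fun k hk => ?_
        split_ifs <;> ring
      · refine Finset.sum_congr rfl fun ν _ => ?_
        ring

/-- The correlator as a linear function of one of the currents. -/
def corrAt (act : ι → g →ₗ⁅ℂ⁆ Module.End ℂ W) (z : ι → ℂ) (v : W) (t : I → ℂ) {L : List I}
    (hL : L.Nodup) {j : I} (hj : j ∈ L) (x : I → g) (φ : Module.Dual ℂ W) : g →ₗ[ℂ] ℂ where
  toFun a := corr act z v t L (Function.update x j a) φ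
  map_add' a b := by
    simpa using corr_update_linear (act := act) (z := z) (v := v) (t := t) hL hj x 1 a b φ
  map_smul' c a := by
    have h0 := corr_update_linear (act := act) (z := z) (v := v) (t := t) hL hj x (-1) 0 0 φ
    have h := corr_update_linear (act := act) (z := z) (v := v) (t := t) hL hj x c a 0 φ
    simp only [smul_zero, add_zero] at h0 h
    have h0' : corr act z v t L (Function.update x j 0) φ = 0 := by linear_combination h0
    simpa [h0'] using h

lemma corrAt_apply {L : List I} (hL : L.Nodup) {j : I} (hj : j ∈ L) (x : I → g)
    (φ : Module.Dual ℂ W) (a : g) :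
    corrAt act z v t hL hj x φ a = corr act z v t L (Function.update x j a) φ := rfl

lemma corr_eq_zero {L : List I} (hL : L.Nodup) {j : I} (hj : j ∈ L) {x : I → g} (hx : x j = 0)
    (φ : Module.Dual ℂ W) : corr act z v t L x φ = 0 := by
  have h := corrAt_apply (act := act) (z := z) (v := v) (t := t) hL hj x φ 0
  rwa [map_zero, ← hx, Function.update_eq_self, eq_comm] at h

end Corr

/-! ### Symmetry of correlators, Ward identity, commuting currents, continuity -/

lemma sum_sum_sub_of_symm {κ : Type*} (s : Finset κ) [DecidableEq κ] (F G : κ → κ → ℂ)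
    (h : ∀ k ∈ s, ∀ l ∈ s, k ≠ l → F k l = G l k) :
    ∑ k ∈ s, ∑ l ∈ s, F k l - ∑ k ∈ s, ∑ l ∈ s, G k l = ∑ k ∈ s, (F k k - G k k) := by
  rw [Finset.sum_comm (f := G), ← Finset.sum_sub_distrib]
  refine Finset.sum_congr rfl fun k hk => ?_
  rw [← Finset.sum_sub_distrib]
  refine Finset.sum_eq_single_of_mem k hk fun l hl hlk => ?_
  rw [h k hk l hl (Ne.symm hlk), sub_self]


section Corr

variable {g W ι I : Type*} [LieRing g] [LieAlgebra ℂ g] [AddCommGroup W] [Module ℂ W]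
  [Fintype ι] [DecidableEq I]
variable {act : ι → g →ₗ⁅ℂ⁆ Module.End ℂ W} {z : ι → ℂ} {v : W} {t : I → ℂ}

/-- The operators of different sites commute. -/
def SitesCommute (act : ι → g →ₗ⁅ℂ⁆ Module.End ℂ W) : Prop :=
  ∀ μ ν, μ ≠ ν → ∀ a b, Commute (act μ a) (act ν b)

lemma lie_lie_right_comm {L : Type*} [LieRing L] (a b c : L) :
    ⁅⁅a, b⁆, c⁆ = ⁅⁅a, c⁆, b⁆ + ⁅a, ⁅b, c⁆⁆ := by
  rw [lie_lie a b c, ← lie_skew ⁅a, c⁆ b]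
  abel


omit [Fintype ι] in
lemma comp_act_lie (ν : ι) (a b : g) (φ : Module.Dual ℂ W) :
    φ ∘ₗ act ν ⁅a, b⁆ = (φ ∘ₗ act ν a) ∘ₗ act ν b - (φ ∘ₗ act ν b) ∘ₗ act ν a := by
  rw [LieHom.map_lie, LieRing.of_associative_ring_bracket, LinearMap.comp_sub]
  rfl

/-- Two steps of the recursion, sorted by where the currents of i and j end up: merged with each
other, both on currents of L, one on a current and one on a site, or both on sites. -/
lemma corr_cons_cons (i j : I) {L : List I} (hj : j ∉ L)
    (x : I → g) (φ : Module.Dual ℂ W) :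
    corr act z v t (i :: j :: L) x φ =
      (t i - t j)⁻¹ * (∑ k ∈ L.toFinset, (t j - t k)⁻¹ *
          corr act z v t L (Function.update x k ⁅x k, ⁅x j, x i⁆⁆) φ +
        ∑ ν, (t j - z ν)⁻¹ * corr act z v t L x (φ ∘ₗ act ν ⁅x j, x i⁆)) +
      ∑ k ∈ L.toFinset, ∑ l ∈ L.toFinset, (t i - t k)⁻¹ * (t j - t l)⁻¹ *
        corr act z v t L (Function.update (Function.update x k ⁅x k, x i⁆) l
          ⁅Function.update x k ⁅x k, x i⁆ l, x j⁆) φ +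
      ∑ k ∈ L.toFinset, ∑ ν, (t i - t k)⁻¹ * (t j - z ν)⁻¹ *
        corr act z v t L (Function.update x k ⁅x k, x i⁆) (φ ∘ₗ act ν (x j)) +
      ∑ k ∈ L.toFinset, ∑ ν, (t j - t k)⁻¹ * (t i - z ν)⁻¹ *
        corr act z v t L (Function.update x k ⁅x k, x j⁆) (φ ∘ₗ act ν (x i)) +
      ∑ ν, ∑ μ, (t i - z ν)⁻¹ * (t j - z μ)⁻¹ *
        corr act z v t L x ((φ ∘ₗ act ν (x i)) ∘ₗ act μ (x j)) := by
  have hjL : j ∉ L.toFinset := by simpa using hj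
  rw [corr, List.toFinset_cons, Finset.sum_insert hjL, corr_cons_update_self hj]
  have h1 : ∀ k ∈ L.toFinset,
      corr act z v t (j :: L) (Function.update x k ⁅x k, x i⁆) φ =
      ∑ l ∈ L.toFinset, (t j - t l)⁻¹ *
        corr act z v t L (Function.update (Function.update x k ⁅x k, x i⁆) l
          ⁅Function.update x k ⁅x k, x i⁆ l, x j⁆) φ +
      ∑ ν, (t j - z ν)⁻¹ *
        corr act z v t L (Function.update x k ⁅x k, x i⁆) (φ ∘ₗ act ν (x j)) := by
    intro k hk
    have hjk : j ≠ k := by rintro rfl; exact hjL hk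
    rw [corr, Function.update_of_ne hjk]
  rw [Finset.sum_congr (f := fun k => (t i - t k)⁻¹ *
    corr act z v t (j :: L) (Function.update x k ⁅x k, x i⁆) φ) rfl
    fun k hk => congrArg ((t i - t k)⁻¹ * ·) (h1 k hk)]
  simp only [corr, mul_add, Finset.sum_add_distrib, Finset.mul_sum, mul_assoc]
  rw [Finset.sum_comm (s := Finset.univ) (t := L.toFinset)]
  simp only [mul_left_comm]
  ring

/-- The two double sums differ from their mirror images only on the diagonal, where both currents
hit the same point t_k or the same z_ν. There the Jacobi identity (or the commutator of the action)
and the partial fractions 1/((t_i - t_k)(t_j - t_k)) = (1/(t_j - t_k) - 1/(t_i - t_k))/(t_i - t_j)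
turn the difference into the terms in which i and j merge. -/
lemma corr_swap (hact : SitesCommute act) {i j : I} {L : List I} (hL : (i :: j :: L).Nodup)
    (ht : ∀ k ∈ i :: j :: L, ∀ l ∈ i :: j :: L, t k = t l → k = l)
    (hz : ∀ k ∈ i :: j :: L, ∀ ν, t k ≠ z ν) (x : I → g) (φ : Module.Dual ℂ W) :
    corr act z v t (i :: j :: L) x φ = corr act z v t (j :: i :: L) x φ := by
  simp only [List.nodup_cons, List.mem_cons, not_or] at hL
  obtain ⟨⟨hij, hi⟩, hj, hL⟩ := hL
  have hiL : i ∉ L.toFinset := by simpa using hi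
  have hjL : j ∉ L.toFinset := by simpa using hj
  rw [corr_cons_cons i j hj, corr_cons_cons j i hi]
  have hB := sum_sum_sub_of_symm L.toFinset
    (fun k l => (t i - t k)⁻¹ * (t j - t l)⁻¹ *
        corr act z v t L (Function.update (Function.update x k ⁅x k, x i⁆) l
          ⁅Function.update x k ⁅x k, x i⁆ l, x j⁆) φ)
    (fun k l => (t j - t k)⁻¹ * (t i - t l)⁻¹ *
        corr act z v t L (Function.update (Function.update x k ⁅x k, x j⁆) l
          ⁅Function.update x k ⁅x k, x j⁆ l, x i⁆) φ)
    (by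
      intro k _ l _ hkl
      rw [Function.update_of_ne hkl.symm, Function.update_of_ne hkl, Function.update_comm hkl]
      ring)
  classical
  have hC := sum_sum_sub_of_symm Finset.univ
    (fun ν μ => (t i - z ν)⁻¹ * (t j - z μ)⁻¹ *
        corr act z v t L x ((φ ∘ₗ act ν (x i)) ∘ₗ act μ (x j)))
    (fun ν μ => (t j - z ν)⁻¹ * (t i - z μ)⁻¹ *
        corr act z v t L x ((φ ∘ₗ act ν (x j)) ∘ₗ act μ (x i)))
    (by
      intro ν _ μ _ hνμ
      have := hact ν μ hνμ (x i) (x j)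
      rw [LinearMap.comp_assoc, LinearMap.comp_assoc, ← Module.End.mul_eq_comp,
        ← Module.End.mul_eq_comp, this.eq]
      ring)
  have hB' : ∀ k ∈ L.toFinset,
      (t i - t k)⁻¹ * (t j - t k)⁻¹ *
        corr act z v t L (Function.update (Function.update x k ⁅x k, x i⁆) k
          ⁅Function.update x k ⁅x k, x i⁆ k, x j⁆) φ -
      (t j - t k)⁻¹ * (t i - t k)⁻¹ *
        corr act z v t L (Function.update (Function.update x k ⁅x k, x j⁆) k
          ⁅Function.update x k ⁅x k, x j⁆ k, x i⁆) φ =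
      - ((t i - t j)⁻¹ * ((t j - t k)⁻¹ *
          corr act z v t L (Function.update x k ⁅x k, ⁅x j, x i⁆⁆) φ)) +
      (t j - t i)⁻¹ * ((t i - t k)⁻¹ *
          corr act z v t L (Function.update x k ⁅x k, ⁅x i, x j⁆⁆) φ) := by
    intro k hk
    have hk' := List.mem_toFinset.1 hk
    simp only [Function.update_self, Function.update_idem, ← corrAt_apply hL hk']
    have h1 : ⁅⁅x k, x i⁆, x j⁆ = ⁅⁅x k, x j⁆, x i⁆ - ⁅x k, ⁅x j, x i⁆⁆ := by
      rw [lie_lie_right_comm (x k) (x i), ← lie_skew (x i) (x j), lie_neg, sub_eq_add_neg]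
    have h2 : ⁅x k, ⁅x i, x j⁆⁆ = - ⁅x k, ⁅x j, x i⁆⁆ := by
      rw [← lie_skew (x i) (x j), lie_neg]
    rw [h1, h2, map_sub, map_neg]
    have e1 : t i - t k ≠ 0 := fun h => hi (by
      rw [ht i (by simp) k (by simp [hk']) (sub_eq_zero.1 h)]; exact hk')
    have e2 : t j - t k ≠ 0 := fun h => hj (by
      rw [ht j (by simp) k (by simp [hk']) (sub_eq_zero.1 h)]; exact hk')
    have e3 : t i - t j ≠ 0 := fun h => hij (ht i (by simp) j (by simp) (sub_eq_zero.1 h))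
    have e4 : t j - t i ≠ 0 := fun h => e3 (by linear_combination -h)
    field_simp
    ring
  have hC' : ∀ ν ∈ Finset.univ,
      (t i - z ν)⁻¹ * (t j - z ν)⁻¹ *
        corr act z v t L x ((φ ∘ₗ act ν (x i)) ∘ₗ act ν (x j)) -
      (t j - z ν)⁻¹ * (t i - z ν)⁻¹ *
        corr act z v t L x ((φ ∘ₗ act ν (x j)) ∘ₗ act ν (x i)) =
      - ((t i - t j)⁻¹ * ((t j - z ν)⁻¹ * corr act z v t L x (φ ∘ₗ act ν ⁅x j, x i⁆))) +
      (t j - t i)⁻¹ * ((t i - z ν)⁻¹ * corr act z v t L x (φ ∘ₗ act ν ⁅x i, x j⁆)) := by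
    intro ν _
    simp only [comp_act_lie, ← corrDual_apply, map_sub]
    have e1 : t i - z ν ≠ 0 := sub_ne_zero.2 (hz i (by simp) ν)
    have e2 : t j - z ν ≠ 0 := sub_ne_zero.2 (hz j (by simp) ν)
    have e3 : t i - t j ≠ 0 := fun h => hij (ht i (by simp) j (by simp) (sub_eq_zero.1 h))
    have e4 : t j - t i ≠ 0 := fun h => e3 (by linear_combination -h)
    field_simp
    ring
  rw [Finset.sum_congr rfl hB', Finset.sum_add_distrib, Finset.sum_neg_distrib,
    ← Finset.mul_sum, ← Finset.mul_sum] at hB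
  rw [Finset.sum_congr rfl hC', Finset.sum_add_distrib, Finset.sum_neg_distrib,
    ← Finset.mul_sum, ← Finset.mul_sum] at hC
  linear_combination hB + hC

lemma corr_perm (hact : SitesCommute act) {L L' : List I} (h : L.Perm L') (hL : L.Nodup)
    (ht : ∀ k ∈ L, ∀ l ∈ L, t k = t l → k = l)
    (hz : ∀ k ∈ L, ∀ ν, t k ≠ z ν) (x : I → g) (φ : Module.Dual ℂ W) :
    corr act z v t L x φ = corr act z v t L' x φ := by
  induction h generalizing x φ with
  | nil => rfl
  | cons i h ih =>
    have ih' := ih (List.nodup_cons.1 hL).2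
      (fun k hk l hl => ht k (by simp [hk]) l (by simp [hl])) (fun k hk => hz k (by simp [hk]))
    simp only [corr, ih', List.toFinset_eq_of_perm _ _ h]
  | swap i j L => exact corr_swap hact hL ht hz x φ
  | trans h1 h2 ih1 ih2 =>
    rw [ih1 hL ht hz, ih2 (h1.nodup_iff.1 hL)
      (fun k hk l hl => ht k (h1.mem_iff.2 hk) l (h1.mem_iff.2 hl))
      (fun k hk => hz k (h1.mem_iff.2 hk))]

/-- The Ward identity for a constant current. -/
lemma corr_ward (hact : SitesCommute act) {L : List I} (hL : L.Nodup) (x : I → g) (y : g)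
    (φ : Module.Dual ℂ W) :
    corr act z ((∑ ν, act ν y) v) t L x φ =
      ∑ j ∈ L.toFinset, corr act z v t L (Function.update x j ⁅x j, y⁆) φ +
        corr act z v t L x (φ ∘ₗ ∑ ν, act ν y) := by
  induction L generalizing x φ with
  | nil => simp [corr]
  | cons i L ih =>
    obtain ⟨hi, hL⟩ := List.nodup_cons.1 hL
    have hiL : i ∉ L.toFinset := by simpa using hi
    rw [corr, List.toFinset_cons, Finset.sum_insert hiL, corr_cons_update_self hi]
    have h1 : ∀ j ∈ L.toFinset,
        corr act z v t (i :: L) (Function.update x j ⁅x j, y⁆) φ =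
        ∑ k ∈ L.toFinset, (t i - t k)⁻¹ *
          (if k = j then corr act z v t L (Function.update x j ⁅⁅x j, y⁆, x i⁆) φ else
            corr act z v t L (Function.update (Function.update x k ⁅x k, x i⁆) j ⁅x j, y⁆) φ) +
        ∑ ν, (t i - z ν)⁻¹ *
          corr act z v t L (Function.update x j ⁅x j, y⁆) (φ ∘ₗ act ν (x i)) := by
      intro j hj
      exact corr_cons_update_of_ne (by rintro rfl; exact hiL hj) _ _ _
    rw [Finset.sum_congr rfl h1]
    simp only [ih hL, corr]
    -- Of the total operator of y, only the summand at the site ν fails to commute with `act ν (x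
    -- i)`.
    have h2 : ∀ ν, φ ∘ₗ act ν ⁅x i, y⁆ = (φ ∘ₗ act ν (x i)) ∘ₗ (∑ μ, act μ y) -
        (φ ∘ₗ ∑ μ, act μ y) ∘ₗ act ν (x i) := by
      intro ν
      have : act ν ⁅x i, y⁆ = act ν (x i) * (∑ μ, act μ y) - (∑ μ, act μ y) * act ν (x i) := by
        rw [LieHom.map_lie, LieRing.of_associative_ring_bracket, Finset.mul_sum, Finset.sum_mul,
          ← Finset.sum_sub_distrib]
        refine (Finset.sum_eq_single_of_mem (f := fun μ => act ν (x i) * act μ y -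
          act μ y * act ν (x i)) ν (Finset.mem_univ _) fun μ _ hμ => ?_).symm
        rw [(hact ν μ hμ.symm (x i) y).eq, sub_self]
      rw [this, LinearMap.comp_sub]
      rfl
    -- For j = k the Jacobi identity interchanges the brackets with x i and y; all other terms
    -- agree.
    have h3 : ∀ k ∈ L.toFinset, ∑ j ∈ L.toFinset, corr act z v t L
          (Function.update (Function.update x k ⁅x k, x i⁆) j
            ⁅Function.update x k ⁅x k, x i⁆ j, y⁆) φ =
        corr act z v t L (Function.update x k ⁅x k, ⁅x i, y⁆⁆) φ +
        ∑ j ∈ L.toFinset, (if k = j then corr act z v t L (Function.update x j ⁅⁅x j, y⁆, x i⁆) φ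
          else corr act z v t L (Function.update (Function.update x k ⁅x k, x i⁆) j ⁅x j, y⁆) φ)
          := by
      intro k hk
      rw [← Finset.add_sum_erase _ _ hk, ← Finset.add_sum_erase _ _ hk, ← add_assoc, if_pos rfl]
      congr 1
      · simp only [Function.update_self, Function.update_idem,
          ← corrAt_apply hL (List.mem_toFinset.1 hk), ← map_add]
        congr 1
        rw [lie_lie_right_comm (x k) (x i) y, add_comm]
      · refine Finset.sum_congr rfl fun j hj => ?_
        have hjk := Finset.ne_of_mem_erase hj
        rw [if_neg hjk.symm, Function.update_of_ne hjk]
    simp only [mul_add, Finset.sum_add_distrib]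
    rw [Finset.sum_congr (s₁ := L.toFinset) (f := fun k => (t i - t k)⁻¹ * ∑ j ∈ L.toFinset,
      corr act z v t L (Function.update (Function.update x k ⁅x k, x i⁆) j
        ⁅Function.update x k ⁅x k, x i⁆ j, y⁆) φ) rfl
      fun k hk => congrArg ((t i - t k)⁻¹ * ·) (h3 k hk)]
    simp only [h2, ← corrDual_apply, map_sub, mul_sub, mul_add, Finset.sum_add_distrib,
      Finset.sum_sub_distrib, Finset.mul_sum]
    rw [Finset.sum_comm (s := Finset.univ) (t := L.toFinset),
      Finset.sum_comm (s := L.toFinset) (t := L.toFinset)]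
    ring

/-- Currents enter only through brackets and actions, so a compatible pair of maps transports
correlators. This compares actions of different Lie algebras on different spaces. -/
lemma corr_natural {g' W' : Type*} [LieRing g'] [LieAlgebra ℂ g'] [AddCommGroup W'] [Module ℂ W']
    {act' : ι → g' →ₗ⁅ℂ⁆ Module.End ℂ W'} (q : g →ₗ⁅ℂ⁆ g') (f : W →ₗ[ℂ] W')
    (h : ∀ ν a w, f (act ν a w) = act' ν (q a) (f w)) (L : List I) (x : I → g)
    (φ : Module.Dual ℂ W') :
    corr act' z (f v) t L (fun i => q (x i)) φ = corr act z v t L x (φ ∘ₗ f) := by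
  induction L generalizing x φ with
  | nil => rfl
  | cons i L ih =>
    simp only [corr]
    congr 1
    · refine Finset.sum_congr rfl fun k _ => ?_
      rw [← ih, ← LieHom.map_lie]
      congr 2
      funext l
      by_cases hl : l = k
      · subst hl; simp
      · simp [hl]
    · refine Finset.sum_congr rfl fun ν _ => ?_
      rw [ih]
      congr 2
      ext w
      simp [h]

/-- T commutes with brackets of the currents as well, so it passes through the whole recursion from
the functional to the vector. -/
lemma corr_comp_commute {T : Module.End ℂ W} {L : List I} (hL : L.Nodup) {x : I → g}
    (hT : ∀ j ∈ L, ∀ ν, Commute T (act ν (x j))) (φ : Module.Dual ℂ W) :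
    corr act z v t L x (φ ∘ₗ T) = corr act z (T v) t L x φ := by
  induction L generalizing x φ with
  | nil => rfl
  | cons i L ih =>
    obtain ⟨hi, hL⟩ := List.nodup_cons.1 hL
    simp only [corr]
    congr 1
    · refine Finset.sum_congr rfl fun k hk => ?_
      rw [ih hL]
      intro j hj ν
      by_cases hjk : j = k
      · subst hjk
        rw [Function.update_self, LieHom.map_lie, LieRing.of_associative_ring_bracket]
        have h1 := hT j (by simp [hj]) ν
        have h2 := hT i (by simp) ν
        exact (h1.mul_right h2).sub_right (h2.mul_right h1)
      · rw [Function.update_of_ne hjk]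
        exact hT j (by simp [hj]) ν
    · refine Finset.sum_congr rfl fun ν _ => ?_
      rw [← ih hL (fun j hj => hT j (by simp [hj])), LinearMap.comp_assoc, LinearMap.comp_assoc,
        ← Module.End.mul_eq_comp, ← Module.End.mul_eq_comp, (hT i (by simp) ν).eq]

/-- A current that commutes with all the others acts by a single operator. -/
lemma corr_cons_of_commute (hact : SitesCommute act) {i : I} {L : List I} (hL : L.Nodup)
    {x : I → g} (hx : ∀ j ∈ L, ⁅x j, x i⁆ = 0) (φ : Module.Dual ℂ W) :
    corr act z v t (i :: L) x φ =
      corr act z ((∑ ν, (t i - z ν)⁻¹ • act ν (x i)) v) t L x φ := by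
  have hcomm : ∀ j ∈ L, ∀ μ, Commute (∑ ν, (t i - z ν)⁻¹ • act ν (x i)) (act μ (x j)) := by
    intro j hj μ
    refine Commute.sum_left _ _ _ fun ν _ => Commute.smul_left ?_ _
    by_cases hμ : ν = μ
    · subst hμ
      have h := LieHom.map_lie (act ν) (x j) (x i)
      rw [hx j hj, map_zero, LieRing.of_associative_ring_bracket] at h
      exact (sub_eq_zero.1 h.symm).symm
    · exact hact ν μ hμ _ _
  rw [← corr_comp_commute hL hcomm, corr, Finset.sum_eq_zero, zero_add]
  · have h : φ ∘ₗ (∑ ν, (t i - z ν)⁻¹ • act ν (x i)) =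
        ∑ ν, (t i - z ν)⁻¹ • (φ ∘ₗ act ν (x i)) := by
      ext w
      simp
    rw [h, ← corrDual_apply]
    simp only [map_sum, map_smul, corrDual_apply, smul_eq_mul]
  · intro j hj
    have hj' := List.mem_toFinset.1 hj
    rw [hx j hj', corr_eq_zero hL hj' (by simp), mul_zero]

lemma continuousAt_corr {L : List I} (hL : L.Nodup) (x : I → g) (φ : Module.Dual ℂ W)
    (ht : ∀ k ∈ L, ∀ l ∈ L, t k = t l → k = l) (hz : ∀ k ∈ L, ∀ ν, t k ≠ z ν) :
    ContinuousAt (fun s => corr act z v s L x φ) t := by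
  induction L generalizing x φ with
  | nil => exact continuousAt_const
  | cons i L ih =>
    obtain ⟨hi, hL⟩ := List.nodup_cons.1 hL
    have ih' := fun x φ => ih hL x φ (fun k hk l hl => ht k (by simp [hk]) l (by simp [hl]))
      (fun k hk => hz k (by simp [hk]))
    simp only [corr]
    refine ContinuousAt.add (tendsto_finsetSum _ fun k hk => ?_) (tendsto_finsetSum _ fun ν _ => ?_)
    · have hk' := List.mem_toFinset.1 hk
      refine ContinuousAt.mul (ContinuousAt.inv₀ (by fun_prop) ?_) (ih' _ _)
      exact fun h => hi (by
        rw [ht i (by simp) k (by simp [hk']) (sub_eq_zero.1 h)]; exact hk')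
    · exact ContinuousAt.mul (ContinuousAt.inv₀ ((continuous_apply i).continuousAt.sub
        continuousAt_const) (sub_ne_zero.2 (hz i (by simp) ν))) (ih' _ _)

end Corr


/-! ### Serre relations from the other Chevalley relations -/

section Chevalley

variable {κ L : Type*} [DecidableEq κ] [LieRing L] [LieAlgebra ℂ L]

/-- The Chevalley relations without `⁅H, H⁆ = 0` and without the Serre relations. -/
structure IsChevalley (A : Matrix κ κ ℤ) (E F H : κ → L) : Prop where
  lie_e_f : ∀ i j, ⁅E i, F j⁆ = if i = j then H i else 0
  lie_h_e : ∀ i j, ⁅H i, E j⁆ = (A i j : ℂ) • E j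
  lie_h_f : ∀ i j, ⁅H i, F j⁆ = -((A i j : ℂ) • F j)

variable {A : Matrix κ κ ℤ} {E F H : κ → L}

lemma IsChevalley.symm (h : IsChevalley A E F H) : IsChevalley A F E (-H) where
  lie_e_f i j := by
    rw [← lie_skew, h.lie_e_f]
    by_cases hij : i = j
    · simp [hij]
    · simp [hij, Ne.symm hij]
  lie_h_e i j := by simp [h.lie_h_f]
  lie_h_f i j := by simp [h.lie_h_e]

lemma IsChevalley.lie_h_ad_pow (h : IsChevalley A E F H) (hA : ∀ i, A i i = 2) (i j : κ)
    (n : ℕ) : ⁅H i, (LieAlgebra.ad ℂ L (F i) ^ n) (F j)⁆ =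
      (-(A i j : ℂ) - 2 * n) • (LieAlgebra.ad ℂ L (F i) ^ n) (F j) := by
  induction n with
  | zero => simp [h.lie_h_f]
  | succ n ih =>
    rw [pow_succ', Module.End.mul_apply, LieAlgebra.ad_apply, leibniz_lie, ih, h.lie_h_f, hA]
    simp only [lie_smul, neg_lie, smul_lie]
    push_cast
    module

/-- The usual sl₂ coefficient; it vanishes for n = -A i j, which is the exponent in the Serre
relation. -/
lemma IsChevalley.lie_e_ad_pow (h : IsChevalley A E F H) (hA : ∀ i, A i i = 2) {i j : κ}
    (hij : i ≠ j) (n : ℕ) : ⁅E i, (LieAlgebra.ad ℂ L (F i) ^ (n + 1)) (F j)⁆ =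
      ((n + 1) * (-(A i j : ℂ) - n)) • (LieAlgebra.ad ℂ L (F i) ^ n) (F j) := by
  induction n with
  | zero =>
    rw [zero_add, pow_one, pow_zero, LieAlgebra.ad_apply, leibniz_lie, h.lie_e_f, h.lie_e_f,
      if_pos rfl, if_neg hij, h.lie_h_f]
    simp
  | succ n ih =>
    rw [pow_succ', Module.End.mul_apply, LieAlgebra.ad_apply, leibniz_lie, ih, h.lie_e_f,
      if_pos rfl, h.lie_h_ad_pow hA, lie_smul, ← LieAlgebra.ad_apply ℂ L (F i),
      ← Module.End.mul_apply, ← pow_succ']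
    push_cast
    module

/-- The Serre elements commute with the opposite Chevalley generators. -/
lemma IsChevalley.lie_e_serre (h : IsChevalley A E F H) (hA : ∀ i, A i i = 2)
    (hA' : ∀ i j, i ≠ j → A i j ≤ 0) (hA'' : ∀ i j, A i j = 0 → A j i = 0) (m i j : κ) :
    ⁅E m, (LieAlgebra.ad ℂ L (F i) ^ (-A i j).toNat) ⁅F i, F j⁆⁆ = 0 := by
  by_cases hij : i = j
  · subst hij; simp
  obtain ⟨n, hn⟩ := Int.exists_eq_neg_ofNat (hA' i j hij)
  have hn' : (-A i j).toNat = n := by simp [hn]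
  rw [hn', ← LieAlgebra.ad_apply ℂ L (F i), ← Module.End.mul_apply, ← pow_succ]
  by_cases hm : m = i
  · subst hm
    rw [h.lie_e_ad_pow hA hij, hn]
    simp
  · have hc : ∀ (k : ℕ) (y : L), ⁅E m, (LieAlgebra.ad ℂ L (F i) ^ k) y⁆ =
        (LieAlgebra.ad ℂ L (F i) ^ k) ⁅E m, y⁆ := by
      intro k y
      induction k with
      | zero => simp
      | succ k ih =>
        rw [pow_succ', Module.End.mul_apply, Module.End.mul_apply, LieAlgebra.ad_apply,
          leibniz_lie, ih, h.lie_e_f, if_neg hm, zero_lie, zero_add, LieAlgebra.ad_apply]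
    rw [hc, h.lie_e_f]
    -- For m = j the generator F j becomes H j, and ad (F i) takes that to A j i times F i. A
    -- further ad (F i) kills it; if there is none, then A i j = 0 and hence A j i = 0.
    split_ifs with hmj
    · subst hmj
      rw [pow_succ, Module.End.mul_apply, LieAlgebra.ad_apply, ← lie_skew, h.lie_h_f, neg_neg]
      rcases n with - | n
      · have : A m i = 0 := hA'' i m (by simpa using hn)
        simp [this]
      · rw [pow_succ, Module.End.mul_apply, LieAlgebra.ad_apply]
        simp
    · simp

end Chevalley

/-! ### The word model -/

section Words

variable {r : ℕ}

/-- Functions on words in the simple roots. -/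
abbrev WordFun (r : ℕ) : Type := List (Fin r) → ℂ

/-- Deletion of the first letter. -/
def wordE (k : Fin r) : Module.End ℂ (WordFun r) where
  toFun φ w := φ (k :: w)
  map_add' _ _ := rfl
  map_smul' _ _ := rfl

variable (A : Matrix (Fin r) (Fin r) ℤ) (lam : Fin r → ℕ)

/-- The value of the weight of a word on a simple coroot. -/
def wordWt (k : Fin r) (w : List (Fin r)) : ℂ := lam k - (w.map fun l => (A k l : ℂ)).sum

/-- The action of a simple coroot. -/
def wordH (k : Fin r) : Module.End ℂ (WordFun r) where
  toFun φ w := wordWt A lam k w * φ w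
  map_add' _ _ := by funext w; simp [mul_add]
  map_smul' c _ := by funext w; simp [mul_left_comm]

/-- Weighted insertion of a letter, evaluated at a word. -/
def wordFAux (k : Fin r) : List (Fin r) → WordFun r → ℂ
  | [], _ => 0
  | l :: w, φ => (if k = l then wordWt A lam k w * φ w else 0) + wordFAux k w (wordE l φ)

/-- Weighted insertion of a letter. -/
def wordF (k : Fin r) : Module.End ℂ (WordFun r) where
  toFun φ w := wordFAux A lam k w φ
  map_add' φ ψ := by
    funext w
    induction w generalizing φ ψ with
    | nil => simp [wordFAux]
    | cons l w ih =>
      simp only [Pi.add_apply] at ih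
      simp only [wordFAux, map_add, ih, Pi.add_apply]
      split_ifs <;> ring
  map_smul' c φ := by
    funext w
    induction w generalizing φ with
    | nil => simp [wordFAux]
    | cons l w ih =>
      simp only [Pi.smul_apply, smul_eq_mul, RingHom.id_apply] at ih
      simp only [wordFAux, map_smul, ih, Pi.smul_apply, smul_eq_mul, RingHom.id_apply]
      split_ifs <;> ring

lemma wordE_apply (k : Fin r) (φ : WordFun r) (w : List (Fin r)) : wordE k φ w = φ (k :: w) := rfl

lemma wordH_apply (k : Fin r) (φ : WordFun r) (w : List (Fin r)) :
    wordH A lam k φ w = wordWt A lam k w * φ w := rfl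

lemma wordF_nil (k : Fin r) (φ : WordFun r) : wordF A lam k φ [] = 0 := rfl

lemma wordF_cons (k l : Fin r) (φ : WordFun r) (w : List (Fin r)) :
    wordF A lam k φ (l :: w) =
      (if k = l then wordWt A lam k w * φ w else 0) + wordF A lam k (wordE l φ) w := rfl

lemma wordWt_cons (k l : Fin r) (w : List (Fin r)) :
    wordWt A lam k (l :: w) = wordWt A lam k w - A k l := by
  simp [wordWt]; ring

/-- A word function stands for w = k₁k₂⋯ ↦ ε(⋯ e_{k₂} e_{k₁} v). The recursion for `wordF` is the
one forced by e_l f_k = f_k e_l + δ h_k and ε ∘ f_k = 0, so the first relation is built in, and the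
relation between h and f follows by induction on the word. -/
lemma word_isChevalley : IsChevalley A (wordE (r := r)) (wordF A lam) (wordH A lam) where
  lie_e_f i j := by
    ext φ w
    rw [LieRing.of_associative_ring_bracket, LinearMap.sub_apply, Pi.sub_apply,
      Module.End.mul_apply, Module.End.mul_apply, wordE_apply, wordF_cons]
    by_cases h : j = i
    · subst h; simp [wordH_apply]
    · simp [h, Ne.symm h]
  lie_h_e i j := by
    ext φ w
    rw [LieRing.of_associative_ring_bracket, LinearMap.sub_apply, Pi.sub_apply,
      Module.End.mul_apply, Module.End.mul_apply, wordE_apply, wordH_apply, wordH_apply,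
      wordWt_cons, wordE_apply]
    simp only [LinearMap.smul_apply, Pi.smul_apply, wordE_apply, smul_eq_mul]
    ring
  lie_h_f i j := by
    ext φ w
    rw [LieRing.of_associative_ring_bracket, LinearMap.sub_apply, Pi.sub_apply,
      Module.End.mul_apply, Module.End.mul_apply]
    simp only [LinearMap.neg_apply, LinearMap.smul_apply, Pi.smul_apply, smul_eq_mul,
      Pi.neg_apply]
    induction w generalizing φ with
    | nil => simp [wordF_nil, wordH_apply]
    | cons l w ih =>
      have h : wordE l (wordH A lam i φ) =
          wordH A lam i (wordE l φ) - (A i l : ℂ) • wordE l φ := by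
        funext u
        simp only [wordE_apply, wordH_apply, wordWt_cons, Pi.sub_apply, Pi.smul_apply, smul_eq_mul]
        ring
      have ih' := ih (wordE l φ)
      rw [wordH_apply] at ih'
      rw [wordH_apply, wordF_cons, wordF_cons, h, map_sub, map_smul, wordWt_cons, wordH_apply]
      simp only [Pi.sub_apply, Pi.smul_apply, smul_eq_mul]
      split_ifs with hjl
      · subst hjl; linear_combination ih'
      · linear_combination ih'

/-- The word function of the vacuum. -/
def wordOne (r : ℕ) : WordFun r := fun w => if w = [] then 1 else 0

lemma wordE_one (k : Fin r) : wordE k (wordOne r) = 0 := by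
  funext w; simp [wordE_apply, wordOne]

lemma wordH_one (k : Fin r) : wordH A lam k (wordOne r) = (lam k : ℂ) • wordOne r := by
  funext w
  by_cases hw : w = []
  · simp [wordH_apply, wordOne, hw, wordWt]
  · simp [wordH_apply, wordOne, hw]

/-- The submodule generated by the vacuum. -/
def wordV : Submodule ℂ (WordFun r) :=
  sInf {W | wordOne r ∈ W ∧ ∀ k, W ≤ W.comap (wordF A lam k)}

lemma wordOne_mem : wordOne r ∈ wordV A lam := by
  simp only [wordV, Submodule.mem_sInf, Set.mem_ofPred_eq]
  exact fun W hW => hW.1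

lemma wordF_mem (k : Fin r) {φ : WordFun r} (h : φ ∈ wordV A lam) :
    wordF A lam k φ ∈ wordV A lam := by
  simp only [wordV, Submodule.mem_sInf, Set.mem_ofPred_eq] at h ⊢
  exact fun W hW => hW.2 k (h W hW)

lemma wordV_induction {W : Submodule ℂ (WordFun r)} (h1 : wordOne r ∈ W)
    (hF : ∀ k φ, φ ∈ wordV A lam → φ ∈ W → wordF A lam k φ ∈ W) : wordV A lam ≤ W := by
  have h : wordV A lam ≤ wordV A lam ⊓ W := by
    refine sInf_le ⟨⟨wordOne_mem A lam, h1⟩, fun k φ hφ => ?_⟩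
    exact ⟨wordF_mem A lam k hφ.1, hF k φ hφ.1 hφ.2⟩
  exact h.trans inf_le_right

lemma wordH_mem (k : Fin r) {φ : WordFun r} (h : φ ∈ wordV A lam) :
    wordH A lam k φ ∈ wordV A lam := by
  refine wordV_induction A lam (W := (wordV A lam).comap (wordH A lam k)) ?_ ?_ h
  · rw [Submodule.mem_comap, wordH_one]
    exact Submodule.smul_mem _ _ (wordOne_mem A lam)
  · intro l φ hφ hφ'
    have := congrArg (fun T => T φ) ((word_isChevalley A lam).lie_h_f k l)
    simp only [LieRing.of_associative_ring_bracket, LinearMap.sub_apply, Module.End.mul_apply,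
      sub_eq_iff_eq_add] at this
    rw [Submodule.mem_comap, this]
    exact add_mem (neg_mem (Submodule.smul_mem _ _ (wordF_mem A lam l hφ)))
      (wordF_mem A lam l hφ')

lemma wordE_mem (k : Fin r) {φ : WordFun r} (h : φ ∈ wordV A lam) :
    wordE k φ ∈ wordV A lam := by
  refine wordV_induction A lam (W := (wordV A lam).comap (wordE k)) ?_ ?_ h
  · rw [Submodule.mem_comap, wordE_one]
    exact zero_mem _
  · intro l φ hφ hφ'
    have := congrArg (fun T => T φ) ((word_isChevalley A lam).lie_e_f k l)
    simp only [LieRing.of_associative_ring_bracket, LinearMap.sub_apply, Module.End.mul_apply,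
      sub_eq_iff_eq_add] at this
    rw [Submodule.mem_comap, this]
    refine add_mem ?_ (wordF_mem A lam l hφ')
    split_ifs
    · exact wordH_mem A lam k hφ
    · exact zero_mem _

/-- The operators of the Chevalley generators on the module generated by the vacuum. -/
def wordGen : CartanMatrix.Generators (Fin r) → Module.End ℂ (wordV A lam)
  | .E k => (wordE k).restrict fun _ h => wordE_mem A lam k h
  | .F k => (wordF A lam k).restrict fun _ h => wordF_mem A lam k h
  | .H k => (wordH A lam k).restrict fun _ h => wordH_mem A lam k h

lemma wordGen_isChevalley : IsChevalley A (fun k => wordGen A lam (.E k))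
    (fun k => wordGen A lam (.F k)) (fun k => wordGen A lam (.H k)) where
  lie_e_f i j := by
    ext φ w
    have := congrFun (congrArg (fun T => T φ) ((word_isChevalley A lam).lie_e_f i j)) w
    split_ifs at this ⊢ <;> exact this
  lie_h_e i j := by
    ext φ w
    exact congrFun (congrArg (fun T => T φ) ((word_isChevalley A lam).lie_h_e i j)) w
  lie_h_f i j := by
    ext φ w
    exact congrFun (congrArg (fun T => T φ) ((word_isChevalley A lam).lie_h_f i j)) w

variable {A}

/-- The Serre element commutes with all deletions of letters and its values vanish at the empty
word. Deleting the letters of a word one by one reduces every value to one at the empty word. -/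
lemma wordGen_serre_f (hA : IsGCM A) (i j : Fin r) :
    (LieAlgebra.ad ℂ (Module.End ℂ (wordV A lam)) (wordGen A lam (.F i)) ^ (-A i j).toNat)
      ⁅wordGen A lam (.F i), wordGen A lam (.F j)⁆ = 0 := by
  set X := (LieAlgebra.ad ℂ (Module.End ℂ (wordV A lam)) (wordGen A lam (.F i)) ^ (-A i j).toNat)
      ⁅wordGen A lam (.F i), wordGen A lam (.F j)⁆ with hX
  have hcomm : ∀ m, Commute (wordGen A lam (.E m)) X := by
    intro m
    have := (wordGen_isChevalley A lam).lie_e_serre hA.diag hA.nonpos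
      (fun i j h => (hA.zero_iff i j).1 h) m i j
    rw [← hX, LieRing.of_associative_ring_bracket] at this
    exact sub_eq_zero.1 this
  have hbr : ∀ Y : Module.End ℂ (wordV A lam), (∀ φ, (Y φ : WordFun r) [] = 0) →
      ∀ φ, (⁅wordGen A lam (.F i), Y⁆ φ : WordFun r) [] = 0 := by
    intro Y hY φ
    change ((wordGen A lam (.F i) * Y - Y * wordGen A lam (.F i)) φ : WordFun r) [] = 0
    rw [LinearMap.sub_apply, Submodule.coe_sub, Pi.sub_apply, Module.End.mul_apply, Module.End.mul_apply, hY, sub_zero]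
    exact wordF_nil A lam i (Y φ : WordFun r)
  have hnil : ∀ n φ, ((LieAlgebra.ad ℂ (Module.End ℂ (wordV A lam)) (wordGen A lam (.F i)) ^ n)
      ⁅wordGen A lam (.F i), wordGen A lam (.F j)⁆ φ : WordFun r) [] = 0 := by
    intro n
    induction n with
    | zero => exact hbr _ fun φ => wordF_nil A lam j (φ : WordFun r)
    | succ n ih =>
      rw [pow_succ', Module.End.mul_apply, LieAlgebra.ad_apply]
      exact hbr _ ih
  ext φ w
  induction w generalizing φ with
  | nil => exact hnil _ φ
  | cons k w ih =>
    have h1 := congrArg (fun T => (T φ : WordFun r) w) (hcomm k).eq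
    exact h1.trans (ih _)

/-- Dual argument: the Serre element commutes with all insertions and kills the vacuum, from which
they generate the module. -/
lemma wordGen_serre_e (hA : IsGCM A) (i j : Fin r) :
    (LieAlgebra.ad ℂ (Module.End ℂ (wordV A lam)) (wordGen A lam (.E i)) ^ (-A i j).toNat)
      ⁅wordGen A lam (.E i), wordGen A lam (.E j)⁆ = 0 := by
  set X := (LieAlgebra.ad ℂ (Module.End ℂ (wordV A lam)) (wordGen A lam (.E i)) ^ (-A i j).toNat)
      ⁅wordGen A lam (.E i), wordGen A lam (.E j)⁆ with hX
  have hcomm : ∀ m, Commute (wordGen A lam (.F m)) X := by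
    intro m
    have := (wordGen_isChevalley A lam).symm.lie_e_serre hA.diag hA.nonpos
      (fun i j h => (hA.zero_iff i j).1 h) m i j
    rw [← hX, LieRing.of_associative_ring_bracket] at this
    exact sub_eq_zero.1 this
  have hE : ∀ k, wordGen A lam (.E k) ⟨wordOne r, wordOne_mem A lam⟩ = 0 := fun k =>
    Subtype.ext (wordE_one k)
  have hone : ∀ n, (LieAlgebra.ad ℂ (Module.End ℂ (wordV A lam)) (wordGen A lam (.E i)) ^ n)
      ⁅wordGen A lam (.E i), wordGen A lam (.E j)⁆ ⟨wordOne r, wordOne_mem A lam⟩ = 0 := by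
    intro n
    induction n with
    | zero => simp [hE]
    | succ n ih =>
      rw [pow_succ', Module.End.mul_apply, LieAlgebra.ad_apply, LieRing.of_associative_ring_bracket,
        LinearMap.sub_apply, Module.End.mul_apply, Module.End.mul_apply, ih, hE]
      simp
  have hle := wordV_induction A lam (W := (LinearMap.ker X).map (wordV A lam).subtype)
    ⟨_, hone _, rfl⟩ (by
      rintro k _ hφ ⟨φ, hφ', rfl⟩
      refine ⟨wordGen A lam (.F k) φ, ?_, rfl⟩
      have h1 := congrArg (fun T => T φ) (hcomm k).eq
      simp only [Module.End.mul_apply] at h1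
      rw [SetLike.mem_coe, LinearMap.mem_ker] at hφ' ⊢
      rw [← h1, hφ', map_zero])
  ext φ : 1
  obtain ⟨ψ, hψ, h⟩ := hle φ.2
  rw [← Subtype.ext (a1 := ψ) (a2 := φ) h]
  exact hψ

end Words


/-! ### The presentation of the Lie algebra -/

section Presentation

variable {r : ℕ} (A : Matrix (Fin r) (Fin r) ℤ)

/-- The projection of the free Lie algebra. -/
def mkHom : FreeLieAlgebra ℂ (CartanMatrix.Generators (Fin r)) →ₗ⁅ℂ⁆ LieAlg A where
  toFun x := LieSubmodule.Quotient.mk (N := CartanMatrix.Relations.toIdeal ℂ A) x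
  map_add' _ _ := rfl
  map_smul' _ _ := rfl
  map_lie' := by
    intro x y
    exact LieSubmodule.Quotient.mk_bracket (CartanMatrix.Relations.toIdeal ℂ A) x y

lemma freeLieSubalgebra_eq_top {Y : Type*} (K : LieSubalgebra ℂ (FreeLieAlgebra ℂ Y))
    (h : ∀ y, FreeLieAlgebra.of ℂ y ∈ K) : K = ⊤ := by
  have h : K.incl.comp (FreeLieAlgebra.lift ℂ fun y => (⟨_, h y⟩ : K)) = LieHom.id := by
    refine FreeLieAlgebra.hom_ext fun x => ?_
    rw [LieHom.comp_apply, FreeLieAlgebra.lift_of_apply]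
    rfl
  rw [eq_top_iff]
  intro x _
  have hx := congrArg (fun f => f x) h
  simp only [LieHom.comp_apply, LieHom.id_apply] at hx
  rw [← hx]
  exact Subtype.property _

lemma mkHom_of (x : CartanMatrix.Generators (Fin r)) :
    mkHom A (FreeLieAlgebra.of ℂ x) = gen A x := rfl

lemma mkHom_surjective : Function.Surjective (mkHom A) := Quot.mk_surjective

lemma mkHom_eq_zero {x : FreeLieAlgebra ℂ (CartanMatrix.Generators (Fin r))}
    (h : x ∈ CartanMatrix.Relations.toSet ℂ A) : mkHom A x = 0 :=
  (LieSubmodule.Quotient.mk_eq_zero' (N := CartanMatrix.Relations.toIdeal ℂ A)).2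
    (LieSubmodule.subset_lieSpan h)

lemma lie_genH_genH (i j : Fin r) : ⁅genH A i, genH A j⁆ = 0 := by
  have := mkHom_eq_zero A (x := CartanMatrix.Relations.HH ℂ (i, j))
    (by simp [CartanMatrix.Relations.toSet])
  simpa only [genE, genF, genH, CartanMatrix.Relations.HH, Function.uncurry, Function.comp, LieHom.map_lie,
    mkHom_of] using this

lemma gen_isChevalley : IsChevalley A (genE A) (genF A) (genH A) where
  lie_e_f i j := by
    have := mkHom_eq_zero A (x := CartanMatrix.Relations.EF ℂ (i, j))
      (by simp only [CartanMatrix.Relations.toSet, Set.mem_union, Set.mem_range_self, true_or,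
            or_true])
    simp only [CartanMatrix.Relations.EF, Function.uncurry] at this
    split_ifs at this ⊢ with h
    · subst h
      simpa only [genE, genF, genH, Function.comp, map_sub, LieHom.map_lie, mkHom_of,
        sub_eq_zero] using this
    · simpa only [genE, genF, genH, Function.comp, LieHom.map_lie, mkHom_of] using this
  lie_h_e i j := by
    have := mkHom_eq_zero A (x := CartanMatrix.Relations.HE ℂ A (i, j))
      (by simp only [CartanMatrix.Relations.toSet, Set.mem_union, Set.mem_range_self, true_or,
            or_true])
    simpa only [genE, genF, genH, CartanMatrix.Relations.HE, Function.uncurry, Function.comp, map_sub,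
      LieHom.map_lie, map_smul, mkHom_of, sub_eq_zero, ← Int.cast_smul_eq_zsmul ℂ] using this
  lie_h_f i j := by
    have := mkHom_eq_zero A (x := CartanMatrix.Relations.HF ℂ A (i, j))
      (by simp only [CartanMatrix.Relations.toSet, Set.mem_union, Set.mem_range_self, true_or,
            or_true])
    simpa only [genE, genF, genH, CartanMatrix.Relations.HF, Function.uncurry, Function.comp, map_add,
      LieHom.map_lie, map_smul, mkHom_of, add_eq_zero_iff_eq_neg,
      ← Int.cast_smul_eq_zsmul ℂ] using this

lemma lieSubalgebra_eq_top (K : LieSubalgebra ℂ (LieAlg A)) (hE : ∀ k, genE A k ∈ K)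
    (hF : ∀ k, genF A k ∈ K) : K = ⊤ := by
  have hH : ∀ k, genH A k ∈ K := by
    intro k
    have := (gen_isChevalley A).lie_e_f k k
    rw [if_pos rfl] at this
    rw [← this]
    exact K.lie_mem (hE k) (hF k)
  have hg : ∀ x, gen A x ∈ K := by
    rintro (k | k | k)
    exacts [hH k, hE k, hF k]
  have h := freeLieSubalgebra_eq_top (K.comap (mkHom A)) hg
  rw [eq_top_iff]
  intro y _
  obtain ⟨x, rfl⟩ := mkHom_surjective A y
  have hx : x ∈ K.comap (mkHom A) := h ▸ LieSubalgebra.mem_top x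
  exact hx

variable {A}

/-- The universal property of the presentation. -/
lemma exists_lieHom {L : Type*} [LieRing L] [LieAlgebra ℂ L]
    (y : CartanMatrix.Generators (Fin r) → L)
    (hy : IsChevalley A (fun k => y (.E k)) (fun k => y (.F k)) (fun k => y (.H k)))
    (hH : ∀ i j, ⁅y (.H i), y (.H j)⁆ = 0)
    (hE : ∀ i j, (LieAlgebra.ad ℂ L (y (.E i)) ^ (-A i j).toNat) ⁅y (.E i), y (.E j)⁆ = 0)
    (hF : ∀ i j, (LieAlgebra.ad ℂ L (y (.F i)) ^ (-A i j).toNat) ⁅y (.F i), y (.F j)⁆ = 0) :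
    ∃ f : LieAlg A →ₗ⁅ℂ⁆ L, ∀ x, f (gen A x) = y x := by
  set q := FreeLieAlgebra.lift ℂ y with hq
  have hqo : ∀ x, q (FreeLieAlgebra.of ℂ x) = y x := fun x => FreeLieAlgebra.lift_of_apply ..
  have had : ∀ (x u) (n : ℕ), q ((LieAlgebra.ad ℂ _ x ^ n) u) =
      (LieAlgebra.ad ℂ L (q x) ^ n) (q u) := by
    intro x u n
    induction n with
    | zero => rfl
    | succ n ih =>
      rw [pow_succ', pow_succ', Module.End.mul_apply, Module.End.mul_apply, LieAlgebra.ad_apply,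
        LieAlgebra.ad_apply, LieHom.map_lie, ih]
  have hker : CartanMatrix.Relations.toIdeal ℂ A ≤ q.ker := by
    refine LieSubmodule.lieSpan_le.2 ?_
    intro x hx
    rw [SetLike.mem_coe, LieHom.mem_ker]
    rcases hx with ((((⟨⟨i, j⟩, rfl⟩ | ⟨⟨i, j⟩, rfl⟩) | ⟨⟨i, j⟩, rfl⟩) | ⟨⟨i, j⟩, rfl⟩) |
      ⟨⟨i, j⟩, rfl⟩) | ⟨⟨i, j⟩, rfl⟩
    · simp only [CartanMatrix.Relations.HH, Function.uncurry, Function.comp, LieHom.map_lie, hqo,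
        hH]
    · have := hy.lie_e_f i j
      simp only [CartanMatrix.Relations.EF, Function.uncurry, Function.comp]
      split_ifs at this ⊢ with h
      · subst h; simp [hqo, this]
      · simp [hqo, this]
    · have := hy.lie_h_e i j
      simp [CartanMatrix.Relations.HE, hqo, this, Int.cast_smul_eq_zsmul]
    · have := hy.lie_h_f i j
      simp [CartanMatrix.Relations.HF, hqo, this, Int.cast_smul_eq_zsmul]
    · simp only [CartanMatrix.Relations.adE, Function.uncurry, Function.comp, had, LieHom.map_lie,
        hqo, hE]
    · simp only [CartanMatrix.Relations.adF, Function.uncurry, Function.comp, had, LieHom.map_lie,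
        hqo, hF]
  let f₀ : LieAlg A →ₗ[ℂ] L := Submodule.liftQ
    (CartanMatrix.Relations.toIdeal ℂ A).toSubmodule (q : _ →ₗ[ℂ] L)
    (fun x hx => LinearMap.mem_ker.2 (q.mem_ker.1 (hker hx)))
  have hf₀ : ∀ x, f₀ (mkHom A x) = q x := fun x => rfl
  refine ⟨{ f₀ with map_lie' := ?_ }, fun x => hqo x⟩
  intro u w
  obtain ⟨u, rfl⟩ := mkHom_surjective A u
  obtain ⟨w, rfl⟩ := mkHom_surjective A w
  change f₀ ⁅mkHom A u, mkHom A w⁆ = ⁅f₀ (mkHom A u), f₀ (mkHom A w)⁆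
  rw [← LieHom.map_lie, hf₀, hf₀, hf₀, LieHom.map_lie]

lemma exists_wordRep (hA : IsGCM A) (lam : Fin r → ℕ) :
    ∃ f : LieAlg A →ₗ⁅ℂ⁆ Module.End ℂ (wordV A lam), ∀ x, f (gen A x) = wordGen A lam x := by
  refine exists_lieHom _ (wordGen_isChevalley A lam) (fun i j => ?_)
    (fun i j => wordGen_serre_e lam hA i j) (fun i j => wordGen_serre_f lam hA i j)
  ext φ w
  change wordWt A lam i w * (wordWt A lam j w * (φ : WordFun r) w) -
    wordWt A lam j w * (wordWt A lam i w * (φ : WordFun r) w) = 0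
  ring

end Presentation


/-! ### From word functions to polydifferentials, and the representation on V(λ) -/

section WordForm

variable {g W ι I : Type*} [LieRing g] [LieAlgebra ℂ g] [AddCommGroup W] [Module ℂ W]
  [Fintype ι] [DecidableEq I]

/-- Brackets of operators that kill v kill v too, so the innermost step of the recursion gives zero.
-/
lemma corr_of_annihilate {act : ι → g →ₗ⁅ℂ⁆ Module.End ℂ W} {z : ι → ℂ} {v : W} {t : I → ℂ}
    {L : List I} {x : I → g} (hL : L ≠ []) (hx : ∀ j ∈ L, ∀ ν, act ν (x j) v = 0)
    (φ : Module.Dual ℂ W) : corr act z v t L x φ = 0 := by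
  induction L generalizing x φ with
  | nil => exact absurd rfl hL
  | cons i L ih =>
    rcases L with - | ⟨j, L⟩
    · simp [corr, hx i (by simp)]
    · rw [corr, Finset.sum_eq_zero, Finset.sum_eq_zero, add_zero]
      · intro ν _
        rw [ih (by simp) (fun k hk => hx k (List.mem_cons_of_mem _ hk)), mul_zero]
      · intro k hk
        have hk := List.mem_cons_of_mem i (List.mem_toFinset.1 hk)
        rw [ih (by simp), mul_zero]
        intro l hl ν
        by_cases hlk : l = k
        · subst hlk
          rw [Function.update_self, LieHom.map_lie, LieRing.of_associative_ring_bracket,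
            LinearMap.sub_apply, Module.End.mul_apply, Module.End.mul_apply, hx l hk,
            hx i (by simp)]
          simp
        · rw [Function.update_of_ne hlk]
          exact hx l (List.mem_cons_of_mem i hl) ν

end WordForm

section Words

variable {r : ℕ} {I : Type*} [DecidableEq I] (π : I → Fin r)

/-- Evaluation at the empty word. -/
def wordEps (r : ℕ) : Module.Dual ℂ (WordFun r) := LinearMap.proj []

/-- The tautological action of endomorphisms at a single site. -/
def endAct (W : Type*) [AddCommGroup W] [Module ℂ W] :
    Unit → Module.End ℂ W →ₗ⁅ℂ⁆ Module.End ℂ W := fun _ => LieHom.id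

lemma sitesCommute_unit {g W : Type*} [LieRing g] [LieAlgebra ℂ g] [AddCommGroup W] [Module ℂ W]
    (act : Unit → g →ₗ⁅ℂ⁆ Module.End ℂ W) : SitesCommute act :=
  fun μ ν h => absurd (Subsingleton.elim μ ν) h

/-- The correlator with values in polydifferentials. -/
def wordCorr (X : Finset I) (t : I → ℂ) (z : ℂ) (x : I → Module.End ℂ (WordFun r))
    (ε : Module.Dual ℂ (WordFun r)) (φ : WordFun r) : ℂ :=
  corr (endAct (WordFun r)) (fun _ => z) φ t X.toList x ε

/-- By symmetry of correlators the arbitrary enumeration `X.toList` may be replaced by one that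
starts with any given index. -/
lemma wordCorr_eq_cons {X : Finset I} {t : I → ℂ} {z : ℂ} (h : IsConf X t z) {i : I} (hi : i ∈ X)
    (x : I → Module.End ℂ (WordFun r)) (ε : Module.Dual ℂ (WordFun r)) (φ : WordFun r) :
    wordCorr X t z x ε φ =
      corr (endAct (WordFun r)) (fun _ => z) φ t (i :: (X.erase i).toList) x ε := by
  refine corr_perm (sitesCommute_unit _) ?_ X.nodup_toList ?_ ?_ x ε
  · nth_rewrite 1 [← Finset.insert_erase hi]
    exact Finset.toList_insert (Finset.notMem_erase i X)
  · intro k hk l hl hkl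
    exact h.1 (by simpa using hk) (by simpa using hl) hkl
  · intro k hk _
    exact h.2 k (by simpa using hk)

open Classical in
/-- The polydifferential of a word function. -/
def wordForm : WordFun r →ₗ[ℂ] PolyDiff I where
  toFun φ X t z := if IsConf X t z then
    wordCorr X t z (fun i => wordE (π i)) (wordEps r) φ else 0
  map_add' φ ψ := by
    funext X t z
    by_cases h : IsConf X t z
    · simp only [if_pos h, Pi.add_apply, wordCorr, ← corrVec_apply, map_add]
    · simp [h]
  map_smul' c φ := by
    funext X t z
    by_cases h : IsConf X t z
    · simp only [if_pos h, Pi.smul_apply, wordCorr, ← corrVec_apply, map_smul, RingHom.id_apply]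
    · simp [h]

lemma wordForm_of_isConf {X : Finset I} {t : I → ℂ} {z : ℂ} (h : IsConf X t z) (φ : WordFun r) :
    wordForm π φ X t z = wordCorr X t z (fun i => wordE (π i)) (wordEps r) φ := if_pos h

lemma wordForm_of_not_isConf {X : Finset I} {t : I → ℂ} {z : ℂ} (h : ¬ IsConf X t z)
    (φ : WordFun r) : wordForm π φ X t z = 0 := if_neg h

omit [DecidableEq I] in
lemma isConf_empty (t : I → ℂ) (z : ℂ) : IsConf ∅ t z := ⟨by simp, by simp⟩

lemma wordForm_empty (t : I → ℂ) (z : ℂ) (φ : WordFun r) : wordForm π φ ∅ t z = φ [] := by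
  rw [wordForm_of_isConf π (isConf_empty t z), wordCorr, Finset.toList_empty]
  rfl

lemma wordForm_one : wordForm π (wordOne r) = oneForm I := by
  funext X t z
  by_cases hX : X = ∅
  · subst hX; simp [wordForm_empty, wordOne, oneForm]
  · by_cases h : IsConf X t z
    · rw [wordForm_of_isConf π h, wordCorr, corr_of_annihilate (by simpa using hX), oneForm,
        if_neg hX]
      exact fun j _ _ => wordE_one (π j)
    · rw [wordForm_of_not_isConf π h, oneForm, if_neg hX]

variable (A : Matrix (Fin r) (Fin r) ℤ) (lam : Fin r → ℕ)

/-- This is the Ward identity for the constant current f_k. The boundary term vanishes by ε ∘ f_k =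
0, and [e_l, f_k] = δ h_k leaves the correlators with h_k at one t_i over k. Their expansion in t_i
is f̃_k: the pole at z comes from ε ∘ h_k = λ_k ε, and the poles at the t_j from the weights of the
e_{π j}. -/
lemma wordForm_wordF (k : Fin r) (φ : WordFun r) :
    wordForm π (wordF A lam k φ) = fTilde A π lam k (wordForm π φ) := by
  funext X t z
  by_cases h : IsConf X t z
  swap
  · rw [wordForm_of_not_isConf π h]
    exact (if_neg h).symm
  rw [wordForm_of_isConf π h, wordCorr]
  have hF : wordF A lam k φ = (∑ ν, endAct (WordFun r) ν (wordF A lam k)) φ := by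
    simp [endAct]
  have h0 : wordEps r ∘ₗ (∑ ν, endAct (WordFun r) ν (wordF A lam k)) = 0 := by
    ext ψ
    simp [endAct, wordEps, wordF_nil]
  rw [hF, corr_ward (sitesCommute_unit _) X.nodup_toList, h0, ← corrDual_apply, map_zero, add_zero,
    Finset.toList_toFinset]
  refine Eq.trans ?_ (if_pos h).symm
  rw [Finset.sum_filter]
  refine Finset.sum_congr rfl fun i hi => ?_
  have hi' : i ∈ X.toList := Finset.mem_toList.2 hi
  have hEF := (word_isChevalley A lam).lie_e_f (π i) k
  rw [hEF]
  split_ifs with hik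
  swap
  · rw [← corrAt_apply X.nodup_toList hi', map_zero]
  have hc := wordCorr_eq_cons h hi (Function.update (fun i => wordE (π i)) i (wordH A lam (π i)))
    (wordEps r) φ
  rw [wordCorr] at hc
  have hconf : IsConf (X.erase i) t z := ⟨h.1.mono (by simp), fun j hj =>
    h.2 j (Finset.mem_of_mem_erase hj)⟩
  rw [hc, corr_cons_update_self (by simp), wordForm_of_isConf π hconf, wordCorr,
    Finset.toList_toFinset, Fintype.sum_unique, hik]
  have hcl : ∀ j ∈ X.erase i, (t i - t j)⁻¹ * corr (endAct (WordFun r)) (fun _ => z) φ t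
      (X.erase i).toList (Function.update (fun i => wordE (π i)) j ⁅wordE (π j), wordH A lam k⁆)
        (wordEps r) = -((A k (π j) : ℂ) / (t i - t j)) *
      corr (endAct (WordFun r)) (fun _ => z) φ t (X.erase i).toList (fun i => wordE (π i))
        (wordEps r) := by
    intro j hj
    have hj' : j ∈ (X.erase i).toList := Finset.mem_toList.2 hj
    rw [← lie_skew, (word_isChevalley A lam).lie_h_e, ← corrAt_apply (X.erase i).nodup_toList hj',
      map_neg, map_smul, corrAt_apply, Function.update_eq_self, smul_eq_mul]
    ring
  have hH : wordEps r ∘ₗ endAct (WordFun r) default (wordH A lam k) = (lam k : ℂ) • wordEps r := by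
    ext ψ
    simp [endAct, wordEps, wordH_apply, wordWt]
  rw [Finset.sum_congr rfl hcl, hH, ← corrDual_apply, ← corrDual_apply, map_smul, smul_eq_mul,
    ← Finset.sum_mul, Finset.sum_neg_distrib]
  ring

lemma tendsto_mul_inv_sub (a : ℂ) :
    Tendsto (fun s : ℂ => s * (s - a)⁻¹) (Bornology.cobounded ℂ) (𝓝 1) := by
  have h1 : Tendsto (fun s : ℂ => (s - a)⁻¹) (Bornology.cobounded ℂ) (𝓝 0) := by
    have : Tendsto (fun s : ℂ => s - a) (Bornology.cobounded ℂ) (Bornology.cobounded ℂ) := by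
      simp [sub_eq_add_neg]
    exact tendsto_inv₀_cobounded.comp this
  have h2 : Tendsto (fun s : ℂ => 1 + a * (s - a)⁻¹) (Bornology.cobounded ℂ) (𝓝 1) := by
    simpa using (h1.const_mul a).const_add (1 : ℂ)
  refine h2.congr' ?_
  filter_upwards [Bornology.isBounded_def.1 (Bornology.isBounded_singleton (x := a))] with s hs
  have : s - a ≠ 0 := sub_ne_zero.2 hs
  field_simp
  ring

/-- In the partial fraction expansion in t_i every pole contributes its coefficient to the limit at
infinity. By the Ward identity the sum of these coefficients is the correlator of the vector `wordE
k φ`. -/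
lemma wordForm_wordE (k : Fin r) (φ : WordFun r) {i : I} {X : Finset I} {t : I → ℂ} {z : ℂ}
    (hik : π i = k) (hi : i ∉ X) (h : IsConf X t z) :
    Tendsto (fun s : ℂ => s * wordForm π φ (insert i X) (Function.update t i s) z)
        (Bornology.cobounded ℂ) (𝓝 (wordForm π (wordE k φ) X t z)) := by
  have hw := corr_ward (act := endAct (WordFun r)) (z := fun _ => z) (v := φ) (t := t)
    (sitesCommute_unit _) X.nodup_toList (fun i => wordE (π i)) (wordE k) (wordEps r)
  rw [Fintype.sum_unique, Finset.toList_toFinset] at hw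
  rw [wordForm_of_isConf π h, wordCorr]
  change corr _ _ (wordE k φ) _ _ _ _ = _ at hw
  rw [hw]
  have hlim : Tendsto (fun s : ℂ => ∑ j ∈ X, (s * (s - t j)⁻¹) *
      corr (endAct (WordFun r)) (fun _ => z) φ t X.toList
        (Function.update (fun i => wordE (π i)) j ⁅wordE (π j), wordE k⁆) (wordEps r) +
      (s * (s - z)⁻¹) * corr (endAct (WordFun r)) (fun _ => z) φ t X.toList
        (fun i => wordE (π i)) (wordEps r ∘ₗ endAct (WordFun r) default (wordE k)))
      (Bornology.cobounded ℂ) (𝓝 (∑ j ∈ X, 1 *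
      corr (endAct (WordFun r)) (fun _ => z) φ t X.toList
        (Function.update (fun i => wordE (π i)) j ⁅wordE (π j), wordE k⁆) (wordEps r) +
      1 * corr (endAct (WordFun r)) (fun _ => z) φ t X.toList
        (fun i => wordE (π i)) (wordEps r ∘ₗ endAct (WordFun r) default (wordE k)))) :=
    (tendsto_finsetSum _ fun j _ => (tendsto_mul_inv_sub (t j)).mul_const _).add
      ((tendsto_mul_inv_sub z).mul_const _)
  simp only [one_mul] at hlim
  refine hlim.congr' ?_
  have hfin : ((X.image t : Set ℂ) ∪ {z}).Finite := (Finset.finite_toSet _).union (by simp)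
  filter_upwards [Bornology.isBounded_def.1 hfin.isBounded] with s hs
  simp only [Set.mem_compl_iff, Set.mem_union, Finset.coe_image, Set.mem_image, Finset.mem_coe,
    Set.mem_singleton_iff, not_or, not_exists, not_and] at hs
  have hup : ∀ j ∈ X, Function.update t i s j = t j := fun j hj =>
    Function.update_of_ne (by rintro rfl; exact hi hj) _ _
  have hconf : IsConf (insert i X) (Function.update t i s) z := by
    refine ⟨?_, ?_⟩
    · rw [Finset.coe_insert, Set.injOn_insert (by simpa using hi)]
      refine ⟨fun a ha b hb hab => h.1 ha hb ?_, ?_⟩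
      · rwa [hup a ha, hup b hb] at hab
      · rintro ⟨j, hj, hjs⟩
        rw [Function.update_self, hup j hj] at hjs
        exact hs.1 j hj hjs
    · intro j hj
      rcases Finset.mem_insert.1 hj with rfl | hj
      · rw [Function.update_self]; exact hs.2
      · rw [hup j hj]; exact h.2 j hj
  rw [wordForm_of_isConf π hconf, wordCorr_eq_cons hconf (Finset.mem_insert_self i X),
    Finset.erase_insert hi, corr, Finset.toList_toFinset, Fintype.sum_unique, Function.update_self,
    mul_add, Finset.mul_sum, hik]
  congr 1
  · refine Finset.sum_congr rfl fun j hj => ?_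
    rw [hup j hj, mul_assoc]
    congr 2
    exact corr_congr (fun _ _ => rfl) (fun j hj => (hup j (by simpa using hj)).symm) _
  · rw [mul_assoc]
    congr 2
    exact corr_congr (fun _ _ => rfl) (fun j hj => (hup j (by simpa using hj)).symm) _

/-- The limit at infinity in an index over k outside X recovers the form of `wordE k φ`; such
indices exist because the fibres are infinite. So the form determines the values of φ letter by
letter. -/
lemma wordForm_injective (hπ : ∀ k, (π ⁻¹' {k}).Infinite) :
    Function.Injective (wordForm (r := r) π) := by
  rw [← LinearMap.ker_eq_bot, LinearMap.ker_eq_bot']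
  intro φ hφ
  funext w
  induction w generalizing φ with
  | nil => rw [← wordForm_empty π 0 0 φ, hφ]; rfl
  | cons k w ih =>
    refine ih (wordE k φ) ?_
    funext X t z
    by_cases h : IsConf X t z
    · obtain ⟨i, hi, hiX⟩ := (hπ k).exists_notMem_finset X
      have := wordForm_wordE π k φ hi hiX h
      rw [hφ] at this
      simp only [Pi.zero_apply, mul_zero] at this
      exact tendsto_nhds_unique this tendsto_const_nhds
    · exact wordForm_of_not_isConf π h _

lemma V_eq_map : V A π lam = (wordV A lam).map (wordForm π) := by
  apply le_antisymm
  · refine sInf_le ⟨⟨_, wordOne_mem A lam, wordForm_one π⟩, ?_⟩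
    rintro k _ ⟨φ, hφ, rfl⟩
    exact ⟨_, wordF_mem A lam k hφ, wordForm_wordF π A lam k φ⟩
  · refine le_sInf fun W hW => Submodule.map_le_iff_le_comap.2 ?_
    refine wordV_induction A lam ?_ fun k φ _ hφ => ?_
    · rw [Submodule.mem_comap, wordForm_one]
      exact hW.1
    · rw [Submodule.mem_comap, wordForm_wordF]
      exact hW.2 k hφ

/-- Evaluation of the component of degree zero. -/
def vacDual : Module.Dual ℂ (V A π lam) where
  toFun v := (v : PolyDiff I) ∅ 0 0
  map_add' _ _ := rfl
  map_smul' _ _ := rfl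

variable {A}

/-- The representation on `V(lam)`, its description by correlators, and its vacuum vector. -/
theorem exists_action (hA : IsGCM A) (hπ : ∀ k, (π ⁻¹' {k}).Infinite) :
    ∃ ρ : LieAlg A →ₗ⁅ℂ⁆ Module.End ℂ (V A π lam), IsAction A π lam ρ ∧
      (∀ (v : V A π lam) (X : Finset I) (t : I → ℂ) (z : ℂ), IsConf X t z →
        (v : PolyDiff I) X t z = corr (fun _ : Unit => ρ) (fun _ => z) v t X.toList
          (fun i => genE A (π i)) (vacDual π A lam)) ∧
      (∀ v, (∀ w : List (Fin r), vacDual π A lam ((w.map fun k => ρ (genE A k)).prod v) = 0) →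
        v = 0) ∧
      ∃ v ≠ 0, ∀ k, ρ (genH A k) v = (lam k : ℂ) • v := by
  obtain ⟨f, hf⟩ := exists_wordRep hA lam
  have hinj := wordForm_injective (r := r) π hπ
  let Θ : wordV A lam ≃ₗ[ℂ] V A π lam :=
    (Submodule.equivMapOfInjective (wordForm π) hinj (wordV A lam)).trans
      (LinearEquiv.ofEq _ _ (V_eq_map π A lam).symm)
  have hΘ : ∀ φ, (Θ φ : PolyDiff I) = wordForm π φ := fun φ => rfl
  let ρ : LieAlg A →ₗ⁅ℂ⁆ Module.End ℂ (V A π lam) := (Θ.lieConj : _ →ₗ⁅ℂ⁆ _).comp f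
  have hρ : ∀ x φ, ρ x (Θ φ) = Θ (f x φ) := by
    intro x φ
    change Θ (f x (Θ.symm (Θ φ))) = _
    rw [LinearEquiv.symm_apply_apply]
  have hvac : ∀ φ, vacDual π A lam (Θ φ) = (φ : WordFun r) [] := fun φ =>
    wordForm_empty π 0 0 φ
  refine ⟨ρ, ⟨?_, ?_⟩, ?_, ?_, Θ ⟨_, wordOne_mem A lam⟩, ?_, ?_⟩
  · intro k v
    obtain ⟨φ, rfl⟩ := Θ.surjective v
    rw [hρ, hΘ, hΘ, genF, hf, ← wordForm_wordF]
    rfl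
  · intro k v i X t z hik hi h
    obtain ⟨φ, rfl⟩ := Θ.surjective v
    rw [hρ, hΘ, hΘ, genE, hf]
    exact wordForm_wordE π k φ hik hi h
  · intro v X t z h
    obtain ⟨φ, rfl⟩ := Θ.surjective v
    -- The Serre relations have been checked on `wordV` only, not on all of `WordFun r`. The
    -- correlators in the two spaces are therefore both compared with one whose currents lie in the
    -- free Lie algebra.
    have h1 := corr_natural (act := fun _ : Unit => f.comp (mkHom A))
      (act' := fun _ : Unit => ρ) (z := fun _ => z) (t := t) (v := φ) (mkHom A)
      (Θ : wordV A lam →ₗ[ℂ] V A π lam) (fun _ a w => (hρ _ w).symm) X.toList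
      (fun i => FreeLieAlgebra.of ℂ (.E (π i))) (vacDual π A lam)
    let q : FreeLieAlgebra ℂ (CartanMatrix.Generators (Fin r)) →ₗ⁅ℂ⁆ Module.End ℂ (WordFun r) :=
      FreeLieAlgebra.lift ℂ fun x => match x with
          | .E k => wordE k
          | .F k => wordF A lam k
          | .H k => wordH A lam k
    have hqE : ∀ k, q (FreeLieAlgebra.of ℂ (.E k)) = wordE k := fun k =>
      FreeLieAlgebra.lift_of_apply ..
    have hq : ∀ a (w : wordV A lam),
        ((f (mkHom A a) w : wordV A lam) : WordFun r) = q a (w : WordFun r) := by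
      let K : LieSubalgebra ℂ (FreeLieAlgebra ℂ (CartanMatrix.Generators (Fin r))) :=
        { carrier := {a | ∀ w : wordV A lam,
            ((f (mkHom A a) w : wordV A lam) : WordFun r) = q a (w : WordFun r)}
          add_mem' := fun {a b} ha hb w => by
            simp only [map_add, LinearMap.add_apply, Submodule.coe_add, ha w, hb w]
          zero_mem' := fun w => by simp
          smul_mem' := fun c a ha w => by
            simp only [map_smul, LinearMap.smul_apply, Submodule.coe_smul, ha w]
          lie_mem' := fun {a b} ha hb w => by
            simp only [LieHom.map_lie, LieRing.of_associative_ring_bracket, LinearMap.sub_apply,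
              Module.End.mul_apply, Submodule.coe_sub, ha (f (mkHom A b) w),
              hb (f (mkHom A a) w), ha w, hb w] }
      have hK : K = ⊤ := freeLieSubalgebra_eq_top K (by
        rintro (k | k | k) w
        all_goals
          rw [mkHom_of, hf]
          simp only [q, FreeLieAlgebra.lift_of_apply]
          rfl)
      intro a
      have ha : a ∈ K := hK ▸ LieSubalgebra.mem_top a
      exact ha
    have h2 := corr_natural (act := fun _ : Unit => f.comp (mkHom A))
      (act' := endAct (WordFun r)) (z := fun _ => z) (t := t) (v := φ) q
      (wordV A lam).subtype (fun _ a w => hq a w) X.toList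
      (fun i => FreeLieAlgebra.of ℂ (.E (π i))) (wordEps r)
    rw [hΘ, wordForm_of_isConf π h, wordCorr]
    simp only [hqE] at h2
    refine h2.trans (Eq.trans ?_ h1.symm)
    congr 1
    ext ψ
    exact (hvac ψ).symm
  · intro v hv
    obtain ⟨φ, rfl⟩ := Θ.surjective v
    -- The rightmost factor of the product acts first and deletes the first letter, hence the
    -- reversal.
    have key : ∀ (w : List (Fin r)) (u : List (Fin r)) (φ : wordV A lam),
        (Θ.symm ((w.map fun k => ρ (genE A k)).prod (Θ φ)) : WordFun r) u =
          (φ : WordFun r) (w.reverse ++ u) := by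
      intro w
      induction w with
      | nil => intro u φ; simp
      | cons k w ih =>
        intro u φ
        obtain ⟨ψ, hψ⟩ := Θ.surjective ((w.map fun k => ρ (genE A k)).prod (Θ φ))
        have := ih (k :: u) φ
        rw [← hψ, LinearEquiv.symm_apply_apply] at this
        rw [List.map_cons, List.prod_cons, Module.End.mul_apply, ← hψ, hρ,
          LinearEquiv.symm_apply_apply, List.reverse_cons, List.append_assoc, List.singleton_append,
          ← this, genE, hf]
        rfl
    rw [map_eq_zero_iff _ Θ.injective]
    ext w
    have h1 := key w.reverse [] φ
    rw [List.reverse_reverse, List.append_nil, ← hvac, LinearEquiv.apply_symm_apply, hv] at h1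
    exact h1.symm
  · rw [Ne, map_eq_zero_iff _ Θ.injective]
    intro h
    have := congrFun (congrArg Subtype.val h) []
    simp [wordOne] at this
  · intro k
    rw [hρ, ← map_smul, genH, hf]
    congr 1
    exact Subtype.ext (wordH_one A lam k)

end Words


/-! ### Tensor products of representations -/

section Sites

variable {ι : Type*} [Fintype ι] [DecidableEq ι] {M : ι → Type*} [∀ ν, AddCommGroup (M ν)]
  [∀ ν, Module ℂ (M ν)]

/-- `1 ⊗ ⋯ ⊗ T ⊗ ⋯ ⊗ 1`. -/
def siteMap (ν : ι) (T : Module.End ℂ (M ν)) : Module.End ℂ (⨂[ℂ] ν, M ν) :=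
  PiTensorProduct.map (Function.update (fun _ => LinearMap.id) ν T)

omit [Fintype ι] in
lemma siteMap_tprod (ν : ι) (T : Module.End ℂ (M ν)) (m : ∀ ν, M ν) :
    siteMap ν T (PiTensorProduct.tprod ℂ m) =
      PiTensorProduct.tprod ℂ (Function.update m ν (T (m ν))) := by
  rw [siteMap, PiTensorProduct.map_tprod]
  congr 1
  funext μ
  by_cases h : μ = ν
  · subst h; simp
  · simp [h]

omit [Fintype ι] in
lemma siteMap_mul (ν : ι) (S T : Module.End ℂ (M ν)) :
    siteMap ν (S * T) = siteMap ν S * siteMap ν T := by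
  refine PiTensorProduct.ext ?_
  ext m
  simp [siteMap_tprod]

omit [Fintype ι] in
lemma siteMap_commute {μ ν : ι} (h : μ ≠ ν) (S : Module.End ℂ (M μ)) (T : Module.End ℂ (M ν)) :
    Commute (siteMap μ S) (siteMap ν T) := by
  refine PiTensorProduct.ext ?_
  ext m
  simp only [LinearMap.compMultilinearMap_apply, Module.End.mul_apply, siteMap_tprod,
    Function.update_of_ne h, Function.update_of_ne h.symm]
  rw [Function.update_comm h]

/-- The operator at a site as a linear function of the operator. -/
def siteLin (ν : ι) : Module.End ℂ (M ν) →ₗ[ℂ] Module.End ℂ (⨂[ℂ] ν, M ν) where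
  toFun := siteMap ν
  map_add' S T := PiTensorProduct.map_update_add _ _ S T
  map_smul' c T := PiTensorProduct.map_update_smul _ _ c T

omit [Fintype ι] in
lemma siteMap_pow (ν : ι) (T : Module.End ℂ (M ν)) (k : ℕ) :
    siteMap ν T ^ k = siteMap ν (T ^ k) := by
  induction k with
  | zero =>
    refine PiTensorProduct.ext ?_
    ext m
    simp [siteMap_tprod]
  | succ k ih => rw [pow_succ, ih, pow_succ, siteMap_mul]

variable {g : Type*} [LieRing g] [LieAlgebra ℂ g] (ρ : ∀ ν, g →ₗ⁅ℂ⁆ Module.End ℂ (M ν))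

/-- The action of a Lie algebra at a site. -/
def siteAct (ν : ι) : g →ₗ⁅ℂ⁆ Module.End ℂ (⨂[ℂ] ν, M ν) where
  toFun x := siteMap ν (ρ ν x)
  map_add' x y := by
    rw [map_add]
    exact map_add (siteLin ν) _ _
  map_smul' c x := by
    rw [map_smul]
    exact map_smul (siteLin ν) _ _
  map_lie' := by
    intro x y
    rw [LieHom.map_lie, LieRing.of_associative_ring_bracket, LieRing.of_associative_ring_bracket,
      ← siteMap_mul, ← siteMap_mul]
    exact map_sub (siteLin ν) _ _

omit [Fintype ι] in
lemma siteAct_apply (ν : ι) (x : g) : siteAct ρ ν x = siteMap ν (ρ ν x) := rfl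

omit [Fintype ι] in
lemma sitesCommute_siteAct : SitesCommute (siteAct ρ) :=
  fun _ _ h _ _ => siteMap_commute h _ _

/-- The tensor product of linear functionals. -/
def tensorDual (φ : ∀ ν, Module.Dual ℂ (M ν)) : Module.Dual ℂ (⨂[ℂ] ν, M ν) :=
  PiTensorProduct.lift ((MultilinearMap.mkPiAlgebra ℂ ι ℂ).compLinearMap φ)

omit [DecidableEq ι] in
lemma tensorDual_tprod (φ : ∀ ν, Module.Dual ℂ (M ν)) (m : ∀ ν, M ν) :
    tensorDual φ (PiTensorProduct.tprod ℂ m) = ∏ ν, φ ν (m ν) := by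
  simp [tensorDual]

lemma tensorDual_comp_siteMap (φ : ∀ ν, Module.Dual ℂ (M ν)) (ν : ι) (T : Module.End ℂ (M ν)) :
    tensorDual φ ∘ₗ siteMap ν T = tensorDual (Function.update φ ν (φ ν ∘ₗ T)) := by
  refine PiTensorProduct.ext ?_
  ext m
  simp only [LinearMap.compMultilinearMap_apply, LinearMap.comp_apply, siteMap_tprod,
    tensorDual_tprod]
  refine Finset.prod_congr rfl fun μ _ => ?_
  by_cases h : μ = ν
  · subst h; simp
  · simp [h]

/-! #### Separating functionals -/

-- If the values of S on the b_l did not fill ℂ^K, a nonzero functional on ℂ^K would vanish on them.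
-- Its coefficients would form a nontrivial combination of the b_l killed by S.
omit [Fintype ι] [DecidableEq ι] in
lemma exists_dual_of_separating {N K : Type*} [AddCommGroup N] [Module ℂ N] [Fintype K]
    [DecidableEq K] (S : Submodule ℂ (Module.Dual ℂ N)) (hS : ∀ m, (∀ φ ∈ S, φ m = 0) → m = 0)
    (b : K → N) (hb : LinearIndependent ℂ b) (k : K) :
    ∃ φ ∈ S, ∀ l, φ (b l) = if l = k then 1 else 0 := by
  let R : Module.Dual ℂ N →ₗ[ℂ] (K → ℂ) := LinearMap.pi fun l => Module.Dual.eval ℂ N (b l)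
  have hR : ∀ φ l, R φ l = φ (b l) := fun φ l => rfl
  have htop : S.map R = ⊤ := by
    by_contra h
    obtain ⟨f, hf, hf'⟩ := Submodule.exists_le_ker_of_lt_top _ (lt_top_iff_ne_top.2 h)
    apply hf
    have hsum : ∑ l, f (Pi.single l 1) • b l = 0 := by
      refine hS _ fun φ hφ => ?_
      have h1 : f (R φ) = 0 := hf' ⟨φ, hφ, rfl⟩
      rw [← h1]
      conv_rhs => rw [LinearMap.pi_apply_eq_sum_univ f (R φ)]
      simp only [map_sum, map_smul, smul_eq_mul, hR, mul_comm]
      refine Finset.sum_congr rfl fun l _ => ?_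
      congr 2
      funext j
      simp [Pi.single_apply, eq_comm]
    have h0 := Fintype.linearIndependent_iff.1 hb _ hsum
    refine LinearMap.pi_ext' fun l => ?_
    ext
    simpa using h0 l
  obtain ⟨φ, hφ, h⟩ : Pi.single k (1 : ℂ) ∈ S.map R := htop ▸ Submodule.mem_top
  refine ⟨φ, hφ, fun l => ?_⟩
  rw [← hR, h, Pi.single_apply]

/-- By multilinearity in φ the factors can be extended to the span one site at a time. -/
lemma tensorDual_eq_zero_of_span {S : ∀ ν, Set (Module.Dual ℂ (M ν))} {u : ⨂[ℂ] ν, M ν}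
    (h : ∀ φ : ∀ ν, Module.Dual ℂ (M ν), (∀ ν, φ ν ∈ S ν) → tensorDual φ u = 0)
    {φ : ∀ ν, Module.Dual ℂ (M ν)} (hφ : ∀ ν, φ ν ∈ Submodule.span ℂ (S ν)) :
    tensorDual φ u = 0 := by
  have hadd : ∀ (φ : ∀ ν, Module.Dual ℂ (M ν)) (ν : ι) (c : ℂ) (a b : Module.Dual ℂ (M ν)),
      tensorDual (Function.update φ ν (c • a + b)) = c • tensorDual (Function.update φ ν a) +
        tensorDual (Function.update φ ν b) := by
    intro φ ν c a b
    refine PiTensorProduct.ext ?_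
    ext m
    simp only [LinearMap.compMultilinearMap_apply, LinearMap.add_apply, LinearMap.smul_apply,
      tensorDual_tprod, smul_eq_mul, ← Finset.mul_prod_erase Finset.univ _ (Finset.mem_univ ν),
      Function.update_self]
    have : ∀ d : Module.Dual ℂ (M ν), ∏ μ ∈ Finset.univ.erase ν, Function.update φ ν d μ (m μ) =
        ∏ μ ∈ Finset.univ.erase ν, φ μ (m μ) := fun d =>
      Finset.prod_congr rfl fun μ hμ => by rw [Function.update_of_ne (Finset.ne_of_mem_erase hμ)]
    simp only [this]
    ring
  have key : ∀ (s : Finset ι) (φ : ∀ ν, Module.Dual ℂ (M ν)), (∀ ν ∉ s, φ ν ∈ S ν) →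
      (∀ ν ∈ s, φ ν ∈ Submodule.span ℂ (S ν)) → tensorDual φ u = 0 := by
    intro s
    induction s using Finset.induction_on with
    | empty => exact fun φ h1 _ => h φ fun ν => h1 ν (by simp)
    | insert ν s hν ih =>
      intro φ h1 h2
      have h3 : ∀ a ∈ Submodule.span ℂ (S ν), tensorDual (Function.update φ ν a) u = 0 := by
        intro a ha
        induction ha using Submodule.span_induction with
        | mem a ha =>
          refine ih _ (fun μ hμ => ?_) (fun μ hμ => ?_)
          · by_cases hμν : μ = ν
            · subst hμν; simpa using ha
            · rw [Function.update_of_ne hμν]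
              exact h1 μ (by simp [hμ, hμν])
          · rw [Function.update_of_ne (by rintro rfl; exact hν hμ)]
            exact h2 μ (by simp [hμ])
        | zero =>
          have := hadd φ ν (-1) 0 0
          simp only [smul_zero, add_zero, neg_smul, one_smul, neg_add_cancel] at this
          rw [this]; rfl
        | add a b _ _ ha hb =>
          have := hadd φ ν 1 a b
          simp only [one_smul] at this
          rw [this, LinearMap.add_apply, ha, hb, add_zero]
        | smul c a _ ha =>
          have h0 := hadd φ ν (-1) 0 0
          simp only [smul_zero, add_zero, neg_smul, one_smul, neg_add_cancel] at h0
          have := hadd φ ν c a 0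
          rw [add_zero, h0, add_zero] at this
          rw [this, LinearMap.smul_apply, ha, smul_zero]
      rw [← Function.update_eq_self ν φ]
      exact h3 _ (h2 ν (by simp))
  exact key Finset.univ φ (by simp) fun ν _ => hφ ν

/-- Only finitely many vectors of a product basis occur in u. Functionals in the spans that are dual
to them factor by factor isolate a single coefficient. -/
lemma eq_zero_of_tensorDual {S : ∀ ν, Set (Module.Dual ℂ (M ν))}
    (hS : ∀ ν m, (∀ φ ∈ S ν, φ m = 0) → m = 0) {u : ⨂[ℂ] ν, M ν}
    (h : ∀ φ : ∀ ν, Module.Dual ℂ (M ν), (∀ ν, φ ν ∈ S ν) → tensorDual φ u = 0) : u = 0 := by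
  classical
  let b := fun ν => Module.Basis.ofVectorSpace ℂ (M ν)
  let B := Basis.piTensorProduct b
  by_contra hu
  have hsupp : (B.repr u).support.Nonempty := by
    rw [Finsupp.support_nonempty_iff]
    simpa using hu
  obtain ⟨p₀, hp₀⟩ := hsupp
  let K := fun ν => (B.repr u).support.image fun p => p ν
  have hex : ∀ ν, ∃ φ ∈ Submodule.span ℂ (S ν), ∀ k ∈ K ν,
      φ (b ν k) = if k = p₀ ν then 1 else 0 := by
    intro ν
    obtain ⟨φ, hφ, hφ'⟩ := exists_dual_of_separating (Submodule.span ℂ (S ν))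
      (fun m hm => hS ν m fun φ hφ => hm φ (Submodule.subset_span hφ))
      (fun k : K ν => b ν k) ((b ν).linearIndependent.comp _ Subtype.val_injective)
      ⟨p₀ ν, Finset.mem_image_of_mem _ hp₀⟩
    refine ⟨φ, hφ, fun k hk => ?_⟩
    have := hφ' ⟨k, hk⟩
    simpa using this
  choose φ hφ hφ' using hex
  have h0 := tensorDual_eq_zero_of_span h hφ
  have h1 : u = ∑ p ∈ (B.repr u).support, B.repr u p • B p := (B.linearCombination_repr u).symm
  rw [h1, map_sum, Finset.sum_eq_single_of_mem p₀ hp₀] at h0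
  · rw [map_smul, Basis.piTensorProduct_apply, tensorDual_tprod, Finset.prod_eq_one, smul_eq_mul,
      mul_one] at h0
    · exact Finsupp.mem_support_iff.1 hp₀ h0
    · intro ν _
      rw [hφ' ν _ (Finset.mem_image_of_mem _ hp₀), if_pos rfl]
  · intro p hp hpp
    obtain ⟨ν, hν⟩ := Function.ne_iff.1 hpp
    rw [map_smul, Basis.piTensorProduct_apply, tensorDual_tprod,
      Finset.prod_eq_zero (Finset.mem_univ ν), smul_zero]
    rw [hφ' ν _ (Finset.mem_image_of_mem _ hp), if_neg hν]

/-- A tensor is determined by the matrix coefficients of words of operators. -/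
lemma eq_zero_of_words {κ : Type*} {T : ∀ ν, κ → Module.End ℂ (M ν)}
    {ε : ∀ ν, Module.Dual ℂ (M ν)}
    (hε : ∀ ν m, (∀ w : List κ, ε ν ((w.map (T ν)).prod m) = 0) → m = 0)
    {Q : Module.Dual ℂ (⨂[ℂ] ν, M ν) → Prop} {u : ⨂[ℂ] ν, M ν} (h1 : Q (tensorDual ε))
    (h2 : ∀ φ, Q φ → ∀ ν k, Q (φ ∘ₗ siteMap ν (T ν k))) (h3 : ∀ φ, Q φ → φ u = 0) : u = 0 := by
  have key : ∀ (N : ℕ) (w : ι → List κ), ∑ ν, (w ν).length = N →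
      Q (tensorDual fun ν => ε ν ∘ₗ ((w ν).map (T ν)).prod) := by
    intro N
    induction N with
    | zero =>
      intro w hw
      have hw' : ∀ ν, w ν = [] := by simpa using hw
      convert! h1 using 3 with ν
      ext m
      simp [hw']
    | succ N ih =>
      intro w hw
      obtain ⟨ν, hν⟩ : ∃ ν, w ν ≠ [] := by
        by_contra! hcon
        simp [hcon] at hw
      -- Precomposition adds an operator on the right, so it is the last letter that is split off.
      obtain ⟨w', k, hw'⟩ : ∃ w' k, w ν = w' ++ [k] := ⟨_, _, (List.dropLast_append_getLast hν).symm⟩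
      have hsum : ∑ μ, (Function.update w ν w' μ).length = N := by
        rw [← Finset.add_sum_erase _ _ (Finset.mem_univ ν)] at hw ⊢
        rw [Function.update_self, Finset.sum_congr rfl fun μ hμ => by
          rw [Function.update_of_ne (Finset.ne_of_mem_erase hμ)]]
        rw [hw', List.length_append] at hw
        simp only [List.length_singleton] at hw
        omega
      have := h2 _ (ih _ hsum) ν k
      rw [tensorDual_comp_siteMap] at this
      convert! this using 2
      funext μ
      by_cases hμ : μ = ν
      · subst hμ
        rw [Function.update_self, Function.update_self, hw', List.map_append, List.prod_append,
          LinearMap.comp_assoc]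
        simp [Module.End.mul_eq_comp]
      · rw [Function.update_of_ne hμ, Function.update_of_ne hμ]
  refine eq_zero_of_tensorDual
    (S := fun ν => {φ | ∃ w : List κ, φ = ε ν ∘ₗ (w.map (T ν)).prod}) ?_ ?_
  · exact fun ν m hm => hε ν m fun w => hm _ ⟨w, rfl⟩
  · intro φ hφ
    choose w hw using hφ
    rw [show φ = fun ν => ε ν ∘ₗ ((w ν).map (T ν)).prod from funext hw]
    exact h3 _ (key _ w rfl)

/-! #### Correlators of pure tensors -/

variable {I : Type*} [DecidableEq I]

/-- Sum over all ways to distribute a list over the sites. -/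
def splitSum : List I → ((ι → List I) → ℂ) → ℂ
  | [], F => F fun _ => []
  | i :: L, F => ∑ ν, splitSum L fun S => F (Function.update S ν (i :: S ν))

/-- Every way to distribute a list without repetition is given by a map from the indices to the
sites, so only these distributions need testing. -/
lemma splitSum_congr [Nonempty ι] {L : List I} (hL : L.Nodup) {F G : (ι → List I) → ℂ}
    (h : ∀ c : I → ι, F (fun ν => L.filter fun j => c j = ν) =
      G (fun ν => L.filter fun j => c j = ν)) : splitSum L F = splitSum L G := by
  induction L generalizing F G with
  | nil => exact h fun _ => Classical.arbitrary ι
  | cons i L ih =>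
    obtain ⟨hi, hL⟩ := List.nodup_cons.1 hL
    refine Finset.sum_congr rfl fun ν _ => ih hL fun c => ?_
    have hc : Function.update (fun μ => L.filter fun j => c j = μ) ν
        (i :: L.filter fun j => c j = ν) =
        fun μ => (i :: L).filter fun j => Function.update c i ν j = μ := by
      funext μ
      have hf : ∀ μ, (L.filter fun j => Function.update c i ν j = μ) =
          L.filter fun j => c j = μ := fun μ => List.filter_congr fun j hj => by
        rw [Function.update_of_ne (by rintro rfl; exact hi hj)]
      by_cases hμ : μ = ν
      · subst hμ
        rw [Function.update_self, List.filter_cons, hf]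
        simp
      · rw [Function.update_of_ne hμ, List.filter_cons, hf]
        simp [Ne.symm hμ]
    have := h (Function.update c i ν)
    rw [← hc] at this
    exact this

omit [DecidableEq I] in
lemma splitSum_sum {κ : Type*} (s : Finset κ) (L : List I) (F : κ → (ι → List I) → ℂ) :
    splitSum L (fun S => ∑ k ∈ s, F k S) = ∑ k ∈ s, splitSum L (F k) := by
  induction L generalizing F with
  | nil => rfl
  | cons i L ih => simp only [splitSum, ih]; rw [Finset.sum_comm]

omit [DecidableEq I] in
lemma splitSum_add (L : List I) (F G : (ι → List I) → ℂ) :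
    splitSum L (fun S => F S + G S) = splitSum L F + splitSum L G := by
  induction L generalizing F G with
  | nil => rfl
  | cons i L ih => simp only [splitSum, ih, Finset.sum_add_distrib]

omit [DecidableEq I] in
lemma splitSum_mul (L : List I) (c : ℂ) (F : (ι → List I) → ℂ) :
    splitSum L (fun S => c * F S) = c * splitSum L F := by
  induction L generalizing F with
  | nil => rfl
  | cons i L ih => simp only [splitSum, ih, Finset.mul_sum]

/-- Both sides obey the same recursion: a current put on the factor ν has poles at z_ν and at the
points assigned to that factor, and the sum over ν collects all poles. -/
lemma corr_tprod [Nonempty ι] {z : ι → ℂ} {t : I → ℂ} {L : List I} (hL : L.Nodup) (x : I → g)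
    (φ : ∀ ν, Module.Dual ℂ (M ν)) (m : ∀ ν, M ν) :
    corr (siteAct ρ) z (PiTensorProduct.tprod ℂ m) t L x (tensorDual φ) =
      splitSum L fun S => ∏ ν, corr (fun _ : Unit => ρ ν) (fun _ => z ν) (m ν) t (S ν) x (φ ν) := by
  induction L generalizing x φ with
  | nil => simp [corr, splitSum, tensorDual_tprod]
  | cons i L ih =>
    obtain ⟨hi, hL⟩ := List.nodup_cons.1 hL
    have hexp : ∀ ν (S : ι → List I), ∏ μ, corr (fun _ : Unit => ρ μ) (fun _ => z μ) (m μ) t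
        (Function.update S ν (i :: S ν) μ) x (φ μ) =
        (∑ j ∈ (S ν).toFinset, (t i - t j)⁻¹ * corr (fun _ : Unit => ρ ν) (fun _ => z ν) (m ν) t
          (S ν) (Function.update x j ⁅x j, x i⁆) (φ ν)) * ∏ μ ∈ Finset.univ.erase ν,
            corr (fun _ : Unit => ρ μ) (fun _ => z μ) (m μ) t (S μ) x (φ μ) +
        (t i - z ν)⁻¹ * ∏ μ, corr (fun _ : Unit => ρ μ) (fun _ => z μ) (m μ) t (S μ) x
          (Function.update φ ν (φ ν ∘ₗ ρ ν (x i)) μ) := by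
      intro ν S
      rw [← Finset.mul_prod_erase Finset.univ _ (Finset.mem_univ ν),
        ← Finset.mul_prod_erase Finset.univ (fun μ => corr (fun _ : Unit => ρ μ) (fun _ => z μ)
          (m μ) t (S μ) x (Function.update φ ν (φ ν ∘ₗ ρ ν (x i)) μ)) (Finset.mem_univ ν),
        Function.update_self, Function.update_self, corr, Fintype.sum_unique]
      rw [Finset.prod_congr rfl fun μ hμ => by
          rw [Function.update_of_ne (Finset.ne_of_mem_erase hμ)],
        Finset.prod_congr (s₁ := Finset.univ.erase ν) (f := fun μ => corr (fun _ : Unit => ρ μ)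
          (fun _ => z μ) (m μ) t (S μ) x (Function.update φ ν (φ ν ∘ₗ ρ ν (x i)) μ)) rfl
          fun μ hμ => by rw [Function.update_of_ne (Finset.ne_of_mem_erase hμ)]]
      ring
    have hsplit : ∀ c : I → ι, ∑ j ∈ L.toFinset, (t i - t j)⁻¹ * ∏ μ, corr (fun _ : Unit => ρ μ)
          (fun _ => z μ) (m μ) t (L.filter fun j => c j = μ) (Function.update x j ⁅x j, x i⁆)
          (φ μ) =
        ∑ ν, (∑ j ∈ (L.filter fun j => c j = ν).toFinset, (t i - t j)⁻¹ *
          corr (fun _ : Unit => ρ ν) (fun _ => z ν) (m ν) t (L.filter fun j => c j = ν)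
            (Function.update x j ⁅x j, x i⁆) (φ ν)) * ∏ μ ∈ Finset.univ.erase ν,
            corr (fun _ : Unit => ρ μ) (fun _ => z μ) (m μ) t (L.filter fun j => c j = μ) x
              (φ μ) := by
      intro c
      rw [← Finset.sum_fiberwise L.toFinset c]
      refine Finset.sum_congr rfl fun ν _ => ?_
      rw [Finset.sum_mul, List.toFinset_filter]
      refine Finset.sum_congr (by ext; simp) fun j hj => ?_
      rw [Finset.mem_filter] at hj
      rw [← Finset.mul_prod_erase Finset.univ _ (Finset.mem_univ ν), mul_assoc]
      congr 2
      refine Finset.prod_congr rfl fun μ hμ => ?_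
      refine corr_update_of_notMem ?_ _ _
      have := (Finset.ne_of_mem_erase hμ).symm
      simp [of_decide_eq_true hj.2, this]
    rw [corr, splitSum]
    simp only [hexp, splitSum_add, splitSum_mul, Finset.sum_add_distrib, ih hL, siteAct_apply,
      tensorDual_comp_siteMap]
    congr 1
    simp only [← splitSum_mul, ← splitSum_sum]
    exact splitSum_congr hL hsplit

lemma splitSum_toFinset {L : List I} (hL : L.Nodup) (F : (ι → Finset I) → ℂ) :
    splitSum L (fun S => F fun ν => (S ν).toFinset) =
      ∑ c : L.toFinset → ι, F fun ν => (Finset.univ.filter fun i => c i = ν).map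
        (Function.Embedding.subtype _) := by
  induction L generalizing F with
  | nil =>
    have : IsEmpty (([] : List I).toFinset) := ⟨fun i => by simpa using i.2⟩
    rw [splitSum, Fintype.sum_unique]
    congr 1
  | cons i L ih =>
    obtain ⟨hi, hL⟩ := List.nodup_cons.1 hL
    have hiL : i ∉ L.toFinset := by simpa using hi
    have hstep : ∀ ν, splitSum L (fun S => F fun μ =>
        (Function.update S ν (i :: S ν) μ).toFinset) =
        splitSum L (fun S => (fun R => F (Function.update R ν (insert i (R ν))))
          fun μ => (S μ).toFinset) := by
      intro ν
      congr 1
      funext S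
      congr 1
      funext μ
      by_cases hμ : μ = ν
      · subst hμ; simp
      · simp [hμ]
    rw [splitSum, Finset.sum_congr rfl fun ν _ => (hstep ν).trans
        (ih hL fun R => F (Function.update R ν (insert i (R ν)))),
      ← Fintype.sum_prod_type']
    have hmem : ∀ j : (i :: L).toFinset, (j : I) ≠ i → (j : I) ∈ L.toFinset := fun j hj => by
      simpa [hj] using j.2
    let eqv : (ι × (L.toFinset → ι)) ≃ ((i :: L).toFinset → ι) :=
      { toFun := fun p j => if h : (j : I) = i then p.1 else p.2 ⟨j, hmem j h⟩
        invFun := fun c => (c ⟨i, by simp⟩, fun j => c ⟨j, by simp⟩)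
        left_inv := fun p => by
          refine Prod.ext (by simp) (funext fun j => ?_)
          have : (j : I) ≠ i := by rintro h; exact hiL (h ▸ j.2)
          simp [this]
        right_inv := fun c => funext fun j => by
          by_cases h : (j : I) = i
          · have : j = ⟨i, by simp⟩ := Subtype.ext h
            subst this; simp
          · simp [h] }
    refine Fintype.sum_equiv eqv _ _ fun p => ?_
    congr 1
    funext μ
    ext j
    simp only [eqv, Equiv.coe_fn_mk, Finset.mem_map, Finset.mem_filter, Finset.mem_univ, true_and,
      Function.Embedding.subtype_apply, Subtype.exists, exists_and_right, exists_eq_right]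
    by_cases hji : j = i
    · subst hji
      by_cases hμ : μ = p.1
      · subst hμ; simp
      · simp [hμ, Ne.symm hμ, hi]
    · by_cases hμ : μ = p.1
      · subst hμ; simp [hji]
      · simp [hμ, hji]

end Sites

/-! ### Coefficients of tensors as correlators -/

section Coeff

variable {r : ℕ} {A : Matrix (Fin r) (Fin r) ℤ} {I : Type*} [DecidableEq I] (π : I → Fin r)
  {n : ℕ} (lam : Fin n → Fin r → ℕ)

/-- By linearity pure tensors suffice; there the sum over distributions that defines `coeff` is the
one in `corr_tprod`. -/
lemma coeff_eq_corr [NeZero n] {ρ : ∀ ν, LieAlg A →ₗ⁅ℂ⁆ Module.End ℂ (V A π (lam ν))}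
    (hρ : ∀ ν (v : V A π (lam ν)) (X : Finset I) (t : I → ℂ) (z : ℂ), IsConf X t z →
        (v : PolyDiff I) X t z = corr (fun _ : Unit => ρ ν) (fun _ => z) v t X.toList
          (fun i => genE A (π i)) (vacDual π A (lam ν)))
    {X : Finset I} {z : Fin n → ℂ} {t : I → ℂ} (h : IsConfN X z t) (v : VT A π lam) :
    coeff A π lam X z t v = corr (siteAct ρ) z v t X.toList (fun i => genE A (π i))
      (tensorDual fun ν => vacDual π A (lam ν)) := by
  have : coeff A π lam X z t = corrVec (siteAct ρ) z t X.toList (fun i => genE A (π i))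
      (tensorDual fun ν => vacDual π A (lam ν)) := by
    refine PiTensorProduct.ext ?_
    ext m
    simp only [LinearMap.compMultilinearMap_apply, corrVec_apply]
    rw [corr_tprod ρ X.nodup_toList, splitSum_congr (G := fun S => (fun R : Fin n → Finset I =>
      ∏ ν, (m ν : PolyDiff I) (R ν) t (z ν)) fun ν => (S ν).toFinset) X.nodup_toList]
    · rw [splitSum_toFinset X.nodup_toList (fun R => ∏ ν, (m ν : PolyDiff I) (R ν) t (z ν)),
        Finset.toList_toFinset, coeff, LinearMap.sum_apply]
      refine Finset.sum_congr rfl fun c _ => ?_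
      rw [PiTensorProduct.lift.tprod]
      simp
    · intro c
      refine Finset.prod_congr rfl fun ν _ => ?_
      have hnd : (X.toList.filter fun j => c j = ν).Nodup := X.nodup_toList.filter _
      have hsub : ∀ j ∈ (X.toList.filter fun j => c j = ν), j ∈ X := fun j hj => by
        simpa using (List.mem_filter.1 hj).1
      rw [hρ]
      · refine corr_perm (sitesCommute_unit _) ?_ hnd ?_ ?_ _ _
        · exact (List.toFinset_toList hnd).symm
        · exact fun k hk l hl hkl => h.1 (hsub k hk) (hsub l hl) hkl
        · exact fun k hk _ => h.2 k (hsub k hk) ν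
      · refine ⟨fun k hk l hl hkl => h.1 (hsub k ?_) (hsub l ?_) hkl, fun k hk => h.2 k (hsub k ?_) ν⟩
        · simpa using hk
        · simpa using hl
        · simpa using hk
  rw [this, corrVec_apply]

end Coeff



/-! ### Residues of correlators -/

section Residue

variable {g W I : Type*} [LieRing g] [LieAlgebra ℂ g] [AddCommGroup W] [Module ℂ W]
  [DecidableEq I] {n : ℕ} {act : Fin n → g →ₗ⁅ℂ⁆ Module.End ℂ W} {z : Fin n → ℂ}

lemma corr_toList (hact : SitesCommute act) {Y : Finset I} {t : I → ℂ} (h : IsConfN Y z t)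
    {L : List I} (hL : L.Nodup) (hY : L.toFinset = Y) (v : W) (x : I → g)
    (φ : Module.Dual ℂ W) : corr act z v t Y.toList x φ = corr act z v t L x φ := by
  subst hY
  refine corr_perm hact (List.toFinset_toList hL) (Finset.nodup_toList _) ?_ ?_ _ _
  · exact fun k hk l hl hkl => h.1 (by simpa using hk) (by simpa using hl) hkl
  · exact fun k hk ν => h.2 k (by simpa using hk) ν

omit [DecidableEq I] in
lemma IsConfN.mono {X Y : Finset I} {t : I → ℂ} (h : IsConfN X z t) (hYX : Y ⊆ X) :
    IsConfN Y z t :=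
  ⟨h.1.mono (by exact_mod_cast hYX), fun i hi => h.2 i (hYX hi)⟩

lemma IsConfN.eventually_update {X : Finset I} {t : I → ℂ} {i : I} (h : IsConfN (X.erase i) z t)
    (a : ℂ) : ∀ᶠ s in 𝓝[≠] a, IsConfN X z (Function.update t i s) := by
  have h1 : ∀ᶠ s in 𝓝[≠] a, ∀ b ∈ (X.image t ∪ Finset.univ.image z), s ≠ b := by
    rw [Filter.eventually_all_finset]
    intro b _
    by_cases hb : b = a
    · subst hb; exact self_mem_nhdsWithin
    · exact (continuousAt_id.eventually_ne (Ne.symm hb)).filter_mono nhdsWithin_le_nhds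
  filter_upwards [h1] with s hs
  have hs1 : ∀ k ∈ X, s ≠ t k := fun k hk => hs _ (by
    rw [Finset.mem_union]; exact Or.inl (Finset.mem_image_of_mem _ hk))
  have hs2 : ∀ ν, s ≠ z ν := fun ν => hs _ (by
    rw [Finset.mem_union]; exact Or.inr (Finset.mem_image_of_mem _ (Finset.mem_univ _)))
  refine ⟨fun k hk l hl hkl => ?_, fun k hk ν => ?_⟩
  · by_cases hki : k = i <;> by_cases hli : l = i
    · rw [hki, hli]
    · rw [hki, Function.update_self, Function.update_of_ne hli] at hkl
      exact absurd hkl (hs1 l hl)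
    · rw [hli, Function.update_self, Function.update_of_ne hki] at hkl
      exact absurd hkl.symm (hs1 k hk)
    · rw [Function.update_of_ne hki, Function.update_of_ne hli] at hkl
      exact h.1 (by simp [hki, Finset.mem_coe.1 hk]) (by simp [hli, Finset.mem_coe.1 hl]) hkl
  · by_cases hki : k = i
    · rw [hki, Function.update_self]; exact hs2 ν
    · rw [Function.update_of_ne hki]; exact h.2 k (by simp [hki, hk]) ν

lemma tendsto_mul_inv_self_sub (a : ℂ) (C : ℂ) :
    Tendsto (fun s : ℂ => (s - a) * ((s - a)⁻¹ * C)) (𝓝[≠] a) (𝓝 C) := by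
  refine (tendsto_const_nhds (x := C)).congr' ?_
  filter_upwards [self_mem_nhdsWithin] with s hs
  rw [← mul_assoc, mul_inv_cancel₀ (sub_ne_zero.2 hs), one_mul]

lemma tendsto_mul_inv_sub_of_ne {a b : ℂ} (h : a ≠ b) (C : ℂ) :
    Tendsto (fun s : ℂ => (s - a) * ((s - b)⁻¹ * C)) (𝓝[≠] a) (𝓝 0) := by
  have : ContinuousAt (fun s : ℂ => (s - a) * ((s - b)⁻¹ * C)) a := by
    have : a - b ≠ 0 := sub_ne_zero.2 h
    fun_prop (disch := assumption)
  have h2 := this.tendsto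
  simp only [sub_self, zero_mul] at h2
  exact h2.mono_left nhdsWithin_le_nhds

lemma corr_cons_update_point {i : I} {L : List I} (hi : i ∉ L) (v : W) (t : I → ℂ) (s : ℂ)
    (x : I → g) (φ : Module.Dual ℂ W) :
    corr act z v (Function.update t i s) (i :: L) x φ =
      ∑ j ∈ L.toFinset, (s - t j)⁻¹ * corr act z v t L (Function.update x j ⁅x j, x i⁆) φ +
        ∑ ν, (s - z ν)⁻¹ * corr act z v t L x (φ ∘ₗ act ν (x i)) := by
  have hne : ∀ j ∈ L, j ≠ i := fun j hj => by rintro rfl; exact hi hj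
  have hcongr : ∀ y ψ, corr act z v (Function.update t i s) L y ψ = corr act z v t L y ψ :=
    fun y ψ => corr_congr (fun _ _ => rfl) (fun j hj => Function.update_of_ne (hne j hj) _ _) ψ
  rw [corr]
  simp only [hcongr, Function.update_self]
  congr 1
  refine Finset.sum_congr rfl fun j hj => ?_
  rw [Function.update_of_ne (hne j (by simpa using hj))]

/-- The residue of a correlator along `t_i = t_j`. -/
lemma tendsto_corr_point {i j : I} {L : List I} (hi : i ∉ L) (hj : j ∈ L) {t : I → ℂ}
    (ht : ∀ k ∈ L, t k = t j → k = j) (hz : ∀ ν, t j ≠ z ν) (v : W) (x : I → g)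
    (φ : Module.Dual ℂ W) :
    Tendsto (fun s => (s - t j) * corr act z v (Function.update t i s) (i :: L) x φ)
      (𝓝[≠] (t j)) (𝓝 (corr act z v t L (Function.update x j ⁅x j, x i⁆) φ)) := by
  simp only [corr_cons_update_point hi, mul_add, Finset.mul_sum]
  rw [← add_zero (corr act z v t L (Function.update x j ⁅x j, x i⁆) φ)]
  refine Tendsto.add ?_ ?_
  · have : corr act z v t L (Function.update x j ⁅x j, x i⁆) φ =
        ∑ k ∈ L.toFinset, if k = j then corr act z v t L (Function.update x k ⁅x k, x i⁆) φ
          else 0 := by simp [hj]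
    rw [this]
    refine tendsto_finsetSum _ fun k hk => ?_
    split_ifs with h
    · subst h; exact tendsto_mul_inv_self_sub _ _
    · exact tendsto_mul_inv_sub_of_ne (fun h' => h (ht k (by simpa using hk) h'.symm)) _
  · rw [← Finset.sum_const_zero (s := Finset.univ (α := Fin n))]
    exact tendsto_finsetSum _ fun ν _ => tendsto_mul_inv_sub_of_ne (hz ν) _

/-- The residue of a correlator at the location of a site. -/
lemma tendsto_corr_site (hzinj : Function.Injective z) {i : I} {L : List I} (hi : i ∉ L) {t : I → ℂ}
    (hz : ∀ k ∈ L, ∀ ν, t k ≠ z ν) (μ : Fin n) (v : W) (x : I → g) (φ : Module.Dual ℂ W) :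
    Tendsto (fun s => (s - z μ) * corr act z v (Function.update t i s) (i :: L) x φ)
      (𝓝[≠] (z μ)) (𝓝 (corr act z v t L x (φ ∘ₗ act μ (x i)))) := by
  simp only [corr_cons_update_point hi, mul_add, Finset.mul_sum]
  rw [← zero_add (corr act z v t L x (φ ∘ₗ act μ (x i)))]
  refine Tendsto.add ?_ ?_
  · rw [← Finset.sum_const_zero (s := L.toFinset)]
    exact tendsto_finsetSum _ fun k hk =>
      tendsto_mul_inv_sub_of_ne (hz k (by simpa using hk) μ).symm _
  · have : corr act z v t L x (φ ∘ₗ act μ (x i)) =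
        ∑ ν, if ν = μ then corr act z v t L x (φ ∘ₗ act ν (x i)) else 0 := by simp
    rw [this]
    refine tendsto_finsetSum _ fun ν _ => ?_
    split_ifs with h
    · subst h; exact tendsto_mul_inv_self_sub _ _
    · exact tendsto_mul_inv_sub_of_ne (fun h' => h (hzinj h'.symm)) _

/-- The vector may depend on t, though not on t_i. This is needed after earlier residues, which have
turned the currents of other sequences into operators that depend on their surviving coordinates. -/
lemma resTo_corr (hact : SitesCommute act) {X Y : Finset I} (hYX : Y ⊆ X) {i j : I} (hi : i ∈ Y)
    (hj : j ∈ Y) (hij : i ≠ j) {F : (I → ℂ) → ℂ} {P : (I → ℂ) → W} {x : I → g}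
    {φ : Module.Dual ℂ W} (hF : ∀ t, IsConfN X z t → F t = corr act z (P t) t Y.toList x φ)
    (hP : ∀ t s, P (Function.update t i s) = P t) {t : I → ℂ} (ht : IsConfN X z t) :
    resTo i j F t =
      corr act z (P t) t (Y.erase i).toList (Function.update x j ⁅x j, x i⁆) φ := by
  have hiE : i ∉ (Y.erase i).toList := by simp
  refine Tendsto.limUnder_eq ((tendsto_corr_point (z := z) (i := i) (L := (Y.erase i).toList)
    hiE (by simp [hj, hij.symm]) ?_ ?_ (P t) x φ).congr' ?_)
  · intro k hk hkj
    rw [Finset.mem_toList, Finset.mem_erase] at hk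
    exact ht.1 (hYX hk.2) (hYX hj) hkj
  · exact ht.2 j (hYX hj)
  · filter_upwards [(ht.mono (X.erase_subset i)).eventually_update (t j)] with s hs
    rw [hF _ hs, hP, corr_toList hact (hs.mono hYX) (L := i :: (Y.erase i).toList)]
    · exact List.nodup_cons.2 ⟨hiE, Finset.nodup_toList _⟩
    · simp [Finset.insert_erase hi]

omit [DecidableEq I] in
lemma getLastD_mem {l : List I} (h : l ≠ []) (d : I) : l.getLastD d ∈ l := by
  rw [List.getLastD_eq_getLast?, List.getLast?_eq_some_getLast h]
  exact List.getLast_mem h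

/-- The iterated bracket of the currents along a list. -/
def seqLie (x : I → g) : List I → g
  | [] => 0
  | i :: L => L.foldl (fun a j => ⁅x j, a⁆) (x i)

/-- Each residue passes the accumulated bracket on to the next entry, so in the end it sits at the
last entry, whose coordinate survives. -/
lemma resSeq_corr (hact : SitesCommute act) {X : Finset I} {F : (I → ℂ) → ℂ} {P : (I → ℂ) → W}
    {φ : Module.Dual ℂ W} (d i : I) (l : List I) {Y : Finset I} (hYX : Y ⊆ X)
    (hnd : (i :: l).Nodup) (hlY : ∀ k ∈ i :: l, k ∈ Y) {x : I → g}
    (hF : ∀ t, IsConfN X z t → F t = corr act z (P t) t Y.toList x φ)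
    (hP : ∀ k ∈ i :: l, ∀ t s, P (Function.update t k s) = P t) {t : I → ℂ}
    (ht : IsConfN X z t) :
    resSeq (i :: l) F t = corr act z (P t) t
      ((i :: l).getLastD d :: (Y \ (i :: l).toFinset).toList)
      (Function.update x ((i :: l).getLastD d) (seqLie x (i :: l))) φ := by
  induction l generalizing i Y x F with
  | nil =>
    rw [resSeq, hF t ht, corr_toList hact (ht.mono hYX) (L := i :: (Y \ [i].toFinset).toList)]
    · simp [seqLie]
    · exact List.nodup_cons.2 ⟨by simp, Finset.nodup_toList _⟩
    · ext k
      have := hlY i (by simp)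
      simp only [List.toFinset_cons, List.toFinset_nil, insert_empty_eq, Finset.toList_toFinset,
        Finset.mem_insert, Finset.mem_sdiff, Finset.mem_singleton]
      by_cases hk : k = i <;> simp [hk, this]
  | cons j l ih =>
    have hij : i ≠ j := by rintro rfl; simp at hnd
    have hjl : j ∉ l := (List.nodup_cons.1 (List.nodup_cons.1 hnd).2).1
    have hil : i ∉ j :: l := (List.nodup_cons.1 hnd).1
    rw [resSeq, ih (Y := Y.erase i) (x := Function.update x j ⁅x j, x i⁆) j
      ((Y.erase_subset i).trans hYX) (List.nodup_cons.1 hnd).2 ?_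
      (fun t ht => resTo_corr hact hYX (hlY i (by simp)) (hlY j (by simp)) hij hF
        (hP i (by simp)) ht) (fun k hk => hP k (List.mem_cons_of_mem _ hk))]
    · have hlast : (i :: j :: l).getLastD d = (j :: l).getLastD d := by simp
      have hset : Y.erase i \ (j :: l).toFinset = Y \ (i :: j :: l).toFinset := by
        ext k; simp only [List.toFinset_cons, Finset.mem_sdiff, Finset.mem_erase, Finset.mem_insert]
        tauto
      have hseq : seqLie (Function.update x j ⁅x j, x i⁆) (j :: l) = seqLie x (i :: j :: l) := by
        rw [seqLie, seqLie, Function.update_self, List.foldl_cons]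
        refine List.foldl_ext _ _ _ fun a k hk => ?_
        rw [Function.update_of_ne (by rintro rfl; exact hjl hk)]
      rw [hlast, hset, hseq]
      refine corr_congr (fun k hk => ?_) (fun _ _ => rfl) _
      by_cases hkl : k = (j :: l).getLastD d
      · rw [← hkl, Function.update_self, Function.update_self]
      · rw [Function.update_of_ne hkl, Function.update_of_ne hkl, Function.update_of_ne]
        rintro rfl
        simp at hk
        exact hkl (by simpa using hk)
    · intro k hk
      rw [Finset.mem_erase]
      exact ⟨by rintro rfl; exact hil hk, hlY k (List.mem_cons_of_mem _ hk)⟩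

/-- The current `∑_ν a_ν / (s - z_ν)`. -/
def current (act : Fin n → g →ₗ⁅ℂ⁆ Module.End ℂ W) (z : Fin n → ℂ) (e : g) (s : ℂ) :
    Module.End ℂ W :=
  ∑ ν, (s - z ν)⁻¹ • act ν e

/-- Iterated residues of a correlator whose currents have iterated brackets proportional to a
current `e` that commutes with all of them. -/
lemma resIter_corr (hact : SitesCommute act) {X : Finset I} {F : (I → ℂ) → ℂ} {v : W}
    {φ : Module.Dual ℂ W} {x : I → g} {e : g} (he : ∀ k, ⁅x k, e⁆ = 0)
    (hF : ∀ t, IsConfN X z t → F t = corr act z v t X.toList x φ) (d : I) (c : List I → ℂ)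
    (Ls : List (List I)) (hne : ∀ l ∈ Ls, l ≠ []) (hnd : Ls.flatten.Nodup)
    (hX : Ls.flatten.toFinset ⊆ X) (hc : ∀ l ∈ Ls, seqLie x l = c l • e) {t : I → ℂ}
    (ht : IsConfN X z t) :
    resIter Ls F t = (Ls.map c).prod * corr act z
      ((Ls.map fun l => current act z e (t (l.getLastD d))).prod v) t
      (X \ Ls.flatten.toFinset).toList x φ := by
  induction Ls generalizing t with
  | nil => simp [resIter, hF t ht]
  | cons l Ls ih =>
    rw [List.flatten_cons, List.nodup_append] at hnd
    obtain ⟨hl, hLs, hdisj⟩ := hnd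
    have hX' : Ls.flatten.toFinset ⊆ X := fun k hk => hX (by
      rw [List.flatten_cons, List.toFinset_append]; exact Finset.mem_union_right _ hk)
    -- The sequences already treated contribute operators that depend only on the coordinates of
    -- their last entries, and these are not in l.
    let P : (I → ℂ) → W := fun t =>
      (Ls.map c).prod • (Ls.map fun l => current act z e (t (l.getLastD d))).prod v
    have hG : ∀ t, IsConfN X z t → resIter Ls F t =
        corr act z (P t) t (X \ Ls.flatten.toFinset).toList x φ := by
      intro t ht
      rw [ih (fun l hl => hne l (by simp [hl])) hLs hX' (fun l hl => hc l (by simp [hl])) ht]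
      exact (map_smul (corrVec act z t (X \ Ls.flatten.toFinset).toList x φ) _ _).symm
    have hP : ∀ k ∈ l, ∀ t s, P (Function.update t k s) = P t := by
      intro k hk t s
      simp only [P]
      congr 3
      refine List.map_congr_left fun l' hl' => ?_
      rw [Function.update_of_ne]
      rintro rfl
      exact hdisj _ hk _ (List.mem_flatten.2 ⟨l', hl', getLastD_mem (hne l' (by simp [hl'])) d⟩) rfl
    have hne' : l ≠ [] := hne l (by simp)
    have hlast := getLastD_mem hne' d
    obtain ⟨i, l, rfl⟩ := List.exists_cons_of_ne_nil hne'
    have hset : (X \ Ls.flatten.toFinset) \ (i :: l).toFinset =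
        X \ ((i :: l) :: Ls).flatten.toFinset := by
      ext k
      simp only [List.flatten_cons, List.toFinset_append, Finset.mem_sdiff, Finset.mem_union]
      tauto
    change resSeq (i :: l) (resIter Ls F) t = _
    rw [resSeq_corr hact d i l Finset.sdiff_subset hl ?_ hG hP ht, hset, hc _ (by simp)]
    · have hmem : (i :: l).getLastD d ∉ (X \ ((i :: l) :: Ls).flatten.toFinset).toList := by
        rw [Finset.mem_toList, Finset.mem_sdiff, not_and_not_right, List.mem_toFinset,
          List.flatten_cons]
        exact fun _ => List.mem_append_left _ hlast
      have hcur : (∑ ν, (t ((i :: l).getLastD d) - z ν)⁻¹ • act ν (c (i :: l) • e)) (P t) =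
          (((i :: l) :: Ls).map c).prod •
            (((i :: l) :: Ls).map fun l => current act z e (t (l.getLastD d))).prod v := by
        simp only [P, List.map_cons, List.prod_cons, map_smul, Module.End.mul_apply, current,
          LinearMap.sum_apply, LinearMap.smul_apply, smul_smul, Finset.smul_sum]
        exact Finset.sum_congr rfl fun ν _ => by congr 1; ring
      rw [corr_cons_of_commute hact (Finset.nodup_toList _),
        corr_update_of_notMem hmem, Function.update_self, hcur]
      · exact map_smul (corrVec act z t _ x φ) _ _
      · intro j hj
        rw [Function.update_self, Function.update_of_ne (by rintro rfl; exact hmem hj), lie_smul,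
          he, smul_zero]
    · intro k hk
      rw [Finset.mem_sdiff, List.mem_toFinset]
      refine ⟨hX ?_, fun h => hdisj k hk k h rfl⟩
      rw [List.mem_toFinset, List.flatten_cons]
      exact List.mem_append_left _ hk

lemma continuousAt_corr_current {Y : Finset I} {p : I → ℂ} (hY : IsConfN Y z p) {d : I}
    (v : W) (x : I → g) (φ : Module.Dual ℂ W) (e : g) (Ls : List (List I))
    (hp : ∀ l ∈ Ls, ∀ ν, p (l.getLastD d) ≠ z ν) :
    ContinuousAt (fun t => corr act z
      ((Ls.map fun l => current act z e (t (l.getLastD d))).prod v) t Y.toList x φ) p := by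
  -- T collects the factors already expanded; fixing it would break the induction on `Ls`.
  have key : ∀ T : Module.End ℂ W, ContinuousAt (fun t => corr act z
      (T ((Ls.map fun l => current act z e (t (l.getLastD d))).prod v)) t Y.toList x φ) p := by
    induction Ls with
    | nil =>
      intro T
      exact continuousAt_corr (Finset.nodup_toList _) x φ
        (fun k hk l hl => hY.1 (by simpa using hk) (by simpa using hl))
        (fun k hk => hY.2 k (by simpa using hk))
    | cons l Ls ih =>
      intro T
      have : ∀ t, corr act z (T (((l :: Ls).map fun l =>
          current act z e (t (l.getLastD d))).prod v)) t Y.toList x φ =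
          ∑ ν, (t (l.getLastD d) - z ν)⁻¹ * corr act z ((T * act ν e) ((Ls.map fun l =>
          current act z e (t (l.getLastD d))).prod v)) t Y.toList x φ := by
        intro t
        simp only [← corrVec_apply, List.map_cons, List.prod_cons, Module.End.mul_apply, current,
          LinearMap.sum_apply, LinearMap.smul_apply, map_sum, map_smul, smul_eq_mul]
      simp only [this]
      refine tendsto_finsetSum _ fun ν _ => Tendsto.mul ?_
        (ih (fun l hl => hp l (by simp [hl])) _)
      exact ((continuous_apply _).continuousAt.sub continuousAt_const).inv₀
        (sub_ne_zero.2 (hp l (by simp) ν))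
  exact key 1

-- The point p may lie on diagonals, but for small τ ≠ 0 the points p + τ d, with d injective and
-- integral, avoid all of them. This makes limits at p unique.
omit [DecidableEq I] in
lemma neBot_nhdsWithin_isConfN [Countable I] {X : Finset I} {p : I → ℂ}
    (hp : ∀ i ∈ X, ∀ ν, p i ≠ z ν) : (𝓝[{t | IsConfN X z t}] p).NeBot := by
  obtain ⟨d, hd⟩ := exists_injective_nat I
  let q : ℂ → I → ℂ := fun τ i => p i + τ * d i
  have hq : ∀ i, Tendsto (fun τ => q τ i) (𝓝[≠] 0) (𝓝 (p i)) := by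
    intro i
    have : Tendsto (fun τ : ℂ => p i + τ * d i) (𝓝 0) (𝓝 (p i + 0 * d i)) :=
      (Continuous.tendsto (by fun_prop) 0)
    simp only [zero_mul, add_zero] at this
    exact this.mono_left nhdsWithin_le_nhds
  have h1 : ∀ᶠ τ in 𝓝[≠] (0 : ℂ), ∀ i ∈ X, ∀ j ∈ X, q τ i = q τ j → i = j := by
    simp only [Filter.eventually_all_finset]
    intro i _ j _
    by_cases hpij : p i = p j
    · filter_upwards [self_mem_nhdsWithin] with τ hτ h
      simp only [q, hpij, add_right_inj] at h
      exact hd (by exact_mod_cast mul_left_cancel₀ hτ h)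
    · filter_upwards [((hq i).sub (hq j)).eventually_ne (sub_ne_zero.2 hpij)] with τ hτ h
      exact absurd (sub_eq_zero.2 h) hτ
  have h2 : ∀ᶠ τ in 𝓝[≠] (0 : ℂ), ∀ i ∈ X, ∀ ν, q τ i ≠ z ν := by
    simp only [Filter.eventually_all_finset, Filter.eventually_all]
    exact fun i hi ν => (hq i).eventually_ne (hp i hi ν)
  have h3 : Tendsto q (𝓝[≠] 0) (𝓝[{t | IsConfN X z t}] p) := by
    refine tendsto_nhdsWithin_iff.2 ⟨tendsto_pi_nhds.2 hq, ?_⟩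
    filter_upwards [h1, h2] with τ h h'
    exact ⟨fun i hi j hj => h i hi j hj, h'⟩
  exact h3.neBot

end Residue



/-! ### Powers of operators of an `sl₂`-triple -/

section Sl2

variable {W : Type*} [AddCommGroup W] [Module ℂ W] {E F H : Module.End ℂ W}

lemma sl2_pow_apply (hEF : E * F - F * E = H) (hHF : H * F - F * H = (-2 : ℂ) • F) {v : W} {μ : ℂ}
    (hv : H v = μ • v) (k : ℕ) :
    E ((F ^ (k + 1)) v) = (F ^ (k + 1)) (E v) + ((k + 1) * (μ - k) : ℂ) • (F ^ k) v := by
  have hEF' : ∀ u, E (F u) = F (E u) + H u := fun u => by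
    rw [← hEF]; simp
  have hHF' : ∀ u, H (F u) = F (H u) + (-2 : ℂ) • F u := fun u => by
    rw [← LinearMap.smul_apply, ← hHF]; simp
  have hH : ∀ k : ℕ, H ((F ^ k) v) = (μ - 2 * k) • (F ^ k) v := by
    intro k
    induction k with
    | zero => simp [hv]
    | succ k ih =>
      rw [pow_succ', Module.End.mul_apply, hHF', ih, map_smul, ← add_smul]
      congr 1; push_cast; ring
  induction k with
  | zero => simp [hEF', hv]
  | succ k ih =>
    have h1 : ∀ u, F ((F ^ k) u) = (F ^ (k + 1)) u := fun u => by
      rw [pow_succ', Module.End.mul_apply]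
    have h2 : ∀ u, F ((F ^ (k + 1)) u) = (F ^ (k + 1 + 1)) u := fun u => by
      rw [pow_succ' F (k + 1), Module.End.mul_apply]
    rw [← h2 v, hEF', ih, hH, map_add, map_smul, h1, h2, add_assoc, ← add_smul]
    congr 2
    push_cast; ring

/-- For negative weight μ the coefficient (k + 1)(μ - k) in `sl2_pow_apply` never vanishes, so
F^(k+1) u = 0 implies F^k u = 0, and one descends from the nilpotency of F. -/
lemma sl2_eq_zero_of_neg (hEF : E * F - F * E = H) (hHF : H * F - F * H = (-2 : ℂ) • F)
    (hF : IsNilpotent F) {u : W} {m : ℕ} (hu : H u = (-(m + 1 : ℂ)) • u) (hEu : E u = 0) :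
    u = 0 := by
  obtain ⟨N, hN⟩ := hF
  have key : ∀ k, (F ^ k) u = 0 → u = 0 := by
    intro k
    induction k with
    | zero => exact fun h => h
    | succ k ih =>
      intro h
      apply ih
      have h1 := sl2_pow_apply hEF hHF hu k
      rw [h, hEu, map_zero, map_zero, zero_add] at h1
      refine (smul_eq_zero.1 h1.symm).resolve_left (mul_ne_zero (by exact_mod_cast k.succ_ne_zero) ?_)
      have h2 : (-(m + 1 : ℂ)) - k = -((m + 1 + k : ℕ) : ℂ) := by push_cast; ring
      rw [h2, neg_ne_zero, Nat.cast_ne_zero]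
      omega
  exact key N (by rw [hN]; rfl)

/-- On a vector of weight zero, `E` and `F` have the same order of nilpotency. -/
lemma sl2_pow_eq_zero (hEF : E * F - F * E = H) (hHE : H * E - E * H = (2 : ℂ) • E)
    (hHF : H * F - F * H = (-2 : ℂ) • F) (hF : IsNilpotent F) {m : ℕ} {v : W} (hv : H v = 0)
    (hm : (E ^ m) v = 0) : (F ^ m) v = 0 := by
  induction m generalizing v with
  | zero => exact hm
  | succ m ih =>
    have hHE' : ∀ u, H (E u) = E (H u) + (2 : ℂ) • E u := fun u => by
      rw [← LinearMap.smul_apply, ← hHE]; simp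
    have hHF' : ∀ u, H (F u) = F (H u) + (-2 : ℂ) • F u := fun u => by
      rw [← LinearMap.smul_apply, ← hHF]; simp
    have hv0 : H v = (0 : ℂ) • v := by rw [hv, zero_smul]
    have hEv : H (E v) = (2 : ℂ) • E v := by rw [hHE', hv, map_zero, zero_add]
    -- On weight zero vectors of the irreducible representation of highest weight 2m, FE is the
    -- scalar (m + 1)m. Subtracting it removes that component, so the order of nilpotency under E
    -- drops and induction applies.
    have h1 : (F ^ m) (F (E v) - ((m + 1) * m : ℂ) • v) = 0 := by
      refine ih ?_ ?_
      · rw [map_sub, map_smul, hv, smul_zero, hHF', hEv, map_smul]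
        module
      · cases m with
        | zero => simpa using! congrArg F hm
        | succ k =>
          have h2 := sl2_pow_apply (E := F) (F := E) (H := -H) (by rw [← hEF]; abel)
            (by rw [neg_smul, ← hHE]; noncomm_ring) (v := E v) (μ := -2)
            (by rw [LinearMap.neg_apply, hEv, neg_smul]) k
          have h3 : (E ^ (k + 1)) (E v) = 0 := by
            rw [← Module.End.mul_apply, ← pow_succ]; exact hm
          have h4 : (E ^ k) (E v) = (E ^ (k + 1)) v := by
            rw [← Module.End.mul_apply, ← pow_succ]
          rw [h3, map_zero, h4] at h2
          rw [map_sub, map_smul, eq_neg_of_add_eq_zero_left h2.symm, ← neg_smul, ← sub_smul]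
          refine smul_eq_zero.2 (Or.inl ?_)
          push_cast; ring
    -- F^(m+1) v has weight -2(m + 1), and E sends it to the vector shown to vanish in `h1`.
    refine sl2_eq_zero_of_neg hEF hHF hF (m := 2 * m + 1) ?_ ?_
    · have : ∀ k : ℕ, H ((F ^ k) v) = (-2 * k : ℂ) • (F ^ k) v := by
        intro k
        induction k with
        | zero => simp [hv]
        | succ k ih =>
          rw [pow_succ', Module.End.mul_apply, hHF', ih, map_smul, ← add_smul]
          congr 1; push_cast; ring
      rw [this]
      congr 1; push_cast; ring
    · rw [sl2_pow_apply hEF hHF hv0, pow_succ, Module.End.mul_apply, ← map_smul, ← map_add]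
      convert h1 using 2
      module

/-- Leibniz rule along the chain E → E₁ → E₂ → 0 under ad F: three terms, with binomial
coefficients. -/
lemma pow_apply_leibniz {E₁ E₂ : Module.End ℂ W} (h1 : F * E - E * F = E₁)
    (h2 : F * E₁ - E₁ * F = E₂) (h3 : Commute F E₂) (n : ℕ) (u : W) :
    (F ^ (n + 2)) (E u) = E ((F ^ (n + 2)) u) + (n + 2 : ℂ) • E₁ ((F ^ (n + 1)) u) +
      ((n + 2) * (n + 1) / 2 : ℂ) • E₂ ((F ^ n) u) := by
  have h1' : ∀ u, F (E u) = E (F u) + E₁ u := fun u => by rw [← h1]; simp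
  have h2' : ∀ u, F (E₁ u) = E₁ (F u) + E₂ u := fun u => by rw [← h2]; simp
  have h3' : ∀ u, F (E₂ u) = E₂ (F u) := fun u => LinearMap.congr_fun h3.eq u
  induction n with
  | zero =>
    simp only [zero_add, pow_two, pow_one, pow_zero, Module.End.mul_apply, Module.End.one_apply,
      h1', h2', map_add]
    module
  | succ n ih =>
    rw [pow_succ' F (n + 2), Module.End.mul_apply, ih]
    simp only [map_add, map_smul, h1', h2', h3', ← Module.End.mul_apply F, ← pow_succ']
    push_cast
    module

/-- If `F` kills `v` and `ad F` kills `ad F (ad F E) = E₂`, then `F ^ (2 * m)` sends `E ^ m v` to a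
nonzero multiple of `E₂ ^ m v`. -/
lemma pow_apply_pow {E₁ E₂ : Module.End ℂ W} (h1 : F * E - E * F = E₁)
    (h2 : F * E₁ - E₁ * F = E₂) (h3 : Commute F E₂) {v : W} (hv : F v = 0) (m : ℕ) :
    (∃ c : ℂ, c ≠ 0 ∧ (F ^ (2 * m)) ((E ^ m) v) = c • (E₂ ^ m) v) ∧
      ∀ n, 2 * m < n → (F ^ n) ((E ^ m) v) = 0 := by
  induction m with
  | zero =>
    refine ⟨⟨1, one_ne_zero, by simp⟩, fun n hn => ?_⟩
    obtain ⟨n, rfl⟩ := Nat.exists_eq_add_of_lt hn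
    rw [pow_succ, pow_zero, Module.End.one_apply, Module.End.mul_apply, hv, map_zero]
  | succ m ih =>
    obtain ⟨⟨c, hc, ihc⟩, ih⟩ := ih
    have hsucc : (E ^ (m + 1)) v = E ((E ^ m) v) := by rw [pow_succ', Module.End.mul_apply]
    rw [hsucc]
    -- Only the E₂-term of the Leibniz rule survives; it contributes the binomial coefficient of 2m
    -- + 2 over 2.
    refine ⟨⟨((2 * m : ℕ) + 2) * ((2 * m : ℕ) + 1) / 2 * c, ?_, ?_⟩, fun n hn => ?_⟩
    · refine mul_ne_zero (div_ne_zero (mul_ne_zero ?_ ?_) two_ne_zero) hc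
      · exact_mod_cast (2 * m + 1).succ_ne_zero
      · exact_mod_cast (2 * m).succ_ne_zero
    · rw [show 2 * (m + 1) = 2 * m + 2 by ring, pow_apply_leibniz h1 h2 h3, ih _ (by omega),
        ih _ (by omega), ihc, map_zero, map_zero, smul_zero, zero_add, zero_add, map_smul,
        smul_smul, pow_succ', Module.End.mul_apply]
    · obtain ⟨n, rfl⟩ := Nat.exists_eq_add_of_lt hn
      rw [show 2 * (m + 1) + n + 1 = (2 * m + n + 1) + 2 by ring, pow_apply_leibniz h1 h2 h3,
        ih _ (by omega), ih _ (by omega), ih _ (by omega)]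
      simp

lemma pow_eq_zero_of_leibniz {E₁ E₂ : Module.End ℂ W} (h1 : F * E - E * F = E₁)
    (h2 : F * E₁ - E₁ * F = E₂) (h3 : Commute F E₂) {v : W} (hv : F v = 0) {m : ℕ}
    (hm : (E ^ m) v = 0) : (E₂ ^ m) v = 0 := by
  obtain ⟨⟨c, hc, h⟩, -⟩ := pow_apply_pow h1 h2 h3 hv m
  rw [hm, map_zero] at h
  exact (smul_eq_zero.1 h.symm).resolve_left hc

/-- The Leibniz argument inside the endomorphism algebra: D = ad F kills the vector 1, and its
double commutator with left multiplication by E is left multiplication by -2F. -/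
lemma sl2_f_pow_eq_zero (hEF : E * F - F * E = H) (hHF : H * F - F * H = (-2 : ℂ) • F) {m : ℕ}
    (hm : E ^ m = 0) : F ^ m = 0 := by
  let D : Module.End ℂ (Module.End ℂ W) := LinearMap.mulLeft ℂ F - LinearMap.mulRight ℂ F
  have hD : ∀ a, D * LinearMap.mulLeft ℂ a - LinearMap.mulLeft ℂ a * D =
      LinearMap.mulLeft ℂ (F * a - a * F) := by
    intro a
    ext b : 1
    simp only [D, LinearMap.sub_apply, Module.End.mul_apply, LinearMap.mulLeft_apply,
      LinearMap.mulRight_apply]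
    noncomm_ring
  have h1 : F * E - E * F = -H := by rw [← hEF]; abel
  have h2 : F * (-H) - (-H) * F = (-2 : ℂ) • F := by rw [← hHF]; noncomm_ring
  have h := pow_eq_zero_of_leibniz (F := D) (E := LinearMap.mulLeft ℂ E) (v := 1) (m := m) (hD E)
    (hD _) ?_ (by simp [D]) ?_
  · rw [h1, h2, LinearMap.pow_mulLeft, LinearMap.mulLeft_apply, mul_one, smul_pow] at h
    exact (smul_eq_zero.1 h).resolve_left (pow_ne_zero _ (by norm_num))
  · rw [h1, h2, commute_iff_eq, ← sub_eq_zero, hD]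
    simp
  · rw [LinearMap.pow_mulLeft, LinearMap.mulLeft_apply, hm, zero_mul]

end Sl2

/-! ### Weighted sums over the sites and the inversion of the weights -/

section SiteSum

variable {g W ι : Type*} [LieRing g] [LieAlgebra ℂ g] [AddCommGroup W] [Module ℂ W] [Fintype ι]
  {act : ι → g →ₗ⁅ℂ⁆ Module.End ℂ W}

/-- The operator `∑_ν w_ν x^{(ν)}`. -/
def siteSum (act : ι → g →ₗ⁅ℂ⁆ Module.End ℂ W) (w : ι → ℂ) (x : g) : Module.End ℂ W :=
  ∑ ν, w ν • act ν x

/-- Different sites commute, so only the diagonal terms of the double sum remain and the weights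
multiply. -/
lemma siteSum_commutator (hact : SitesCommute act) (w u : ι → ℂ) (x y : g) :
    siteSum act w x * siteSum act u y - siteSum act u y * siteSum act w x =
      siteSum act (w * u) ⁅x, y⁆ := by
  classical
  simp only [siteSum, Finset.sum_mul_sum]
  rw [Finset.sum_comm (γ := ι) (f := fun ν μ => (u ν • act ν y) * (w μ • act μ x)),
    ← Finset.sum_sub_distrib]
  refine Finset.sum_congr rfl fun ν _ => ?_
  rw [← Finset.sum_sub_distrib, Finset.sum_eq_single_of_mem ν (Finset.mem_univ ν)]
  · rw [smul_mul_smul_comm, smul_mul_smul_comm, Pi.mul_apply, LieHom.map_lie,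
      LieRing.of_associative_ring_bracket, smul_sub, mul_comm (u ν)]
  · intro μ _ hμ
    rw [smul_mul_smul_comm, smul_mul_smul_comm, (hact ν μ hμ.symm x y).eq, mul_comm (u μ), sub_self]

lemma siteSum_smul (w : ι → ℂ) (c : ℂ) (x : g) : siteSum act w (c • x) = c • siteSum act w x := by
  rw [siteSum, siteSum, Finset.smul_sum]
  exact Finset.sum_congr rfl fun ν _ => by rw [map_smul, smul_comm]

lemma siteSum_isNilpotent (hact : SitesCommute act) (w : ι → ℂ) {x : g}
    (hx : ∀ ν, IsNilpotent (act ν x)) : IsNilpotent (siteSum act w x) := by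
  refine Commute.isNilpotent_sum (fun ν _ => (hx ν).smul _) fun μ ν _ _ => ?_
  refine Commute.smul_left (Commute.smul_right ?_ _) _
  by_cases h : μ = ν
  · rw [h]; exact Commute.refl _
  · exact hact μ ν h x x

variable {e f h : g}

/-- The unweighted sum of f kills v, and its double commutator with ∑ w_ν e^(ν) is -2 ∑ w_ν f^(ν).
-/
lemma siteSum_pow_leibniz (hact : SitesCommute act) (hef : ⁅e, f⁆ = h)
    (hhf : ⁅h, f⁆ = (-2 : ℂ) • f) {v : W} (hfv : siteSum act 1 f v = 0) (w : ι → ℂ) {m : ℕ}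
    (hm : (siteSum act w e ^ m) v = 0) : (siteSum act w f ^ m) v = 0 := by
  have hfe : ⁅f, e⁆ = (-1 : ℂ) • h := by rw [← lie_skew, hef]; simp
  have hfh : ⁅f, h⁆ = (2 : ℂ) • f := by rw [← lie_skew, hhf]; simp
  have := pow_eq_zero_of_leibniz (siteSum_commutator hact 1 w f e)
    (siteSum_commutator hact 1 (1 * w) f ⁅f, e⁆) ?_ hfv hm
  · rw [hfe, lie_smul, hfh, siteSum_smul, siteSum_smul, smul_smul, smul_pow, one_mul, one_mul] at this
    exact (smul_eq_zero.1 this).resolve_left (pow_ne_zero _ (by norm_num))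
  · rw [commute_iff_eq, ← sub_eq_zero, siteSum_commutator hact, hfe, lie_smul, hfh]
    simp [siteSum]

/-- For vectors that are invariant under an `sl₂`-triple, the order of nilpotency of
`∑_ν w_ν e^{(ν)}` does not change if the `w_ν` are inverted. -/
lemma siteSum_pow_inv (hact : SitesCommute act) (hef : ⁅e, f⁆ = h) (hhe : ⁅h, e⁆ = (2 : ℂ) • e)
    (hhf : ⁅h, f⁆ = (-2 : ℂ) • f) (hnil : ∀ ν, IsNilpotent (act ν e)) {v : W}
    (hv : ∀ x ∈ ({e, f, h} : Set g), siteSum act 1 x v = 0) {w : ι → ℂ} (hw : ∀ ν, w ν ≠ 0)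
    {m : ℕ} (hm : (siteSum act w e ^ m) v = 0) : (siteSum act w⁻¹ e ^ m) v = 0 := by
  have hww : w * w⁻¹ = 1 := by ext ν; simp [hw ν]
  have hfe : ⁅f, e⁆ = -h := by rw [← lie_skew, hef]
  have hmap : ∀ ν x y, act ν x * act ν y - act ν y * act ν x = act ν ⁅x, y⁆ := fun ν x y => by
    rw [LieHom.map_lie, LieRing.of_associative_ring_bracket]
  have hnilf : ∀ ν, IsNilpotent (act ν f) := fun ν => by
    obtain ⟨N, hN⟩ := hnil ν
    refine ⟨N, sl2_f_pow_eq_zero (H := act ν h) ?_ ?_ hN⟩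
    · rw [hmap, hef]
    · rw [hmap, hhf, map_smul]
  have hf : (siteSum act w f ^ m) v = 0 := siteSum_pow_leibniz hact hef hhf (hv f (by simp)) w hm
  -- The triple has ∑ w_ν f^(ν) as raising and ∑ w_ν⁻¹ e^(ν) as lowering operator. The weights
  -- cancel in the commutator, so v has weight zero by invariance.
  refine sl2_pow_eq_zero (H := siteSum act 1 (-h)) ?_ ?_ ?_
    (siteSum_isNilpotent hact _ hnil) ?_ hf
  · rw [siteSum_commutator hact, hww, hfe]
  · rw [siteSum_commutator hact, one_mul, neg_lie, hhf, ← siteSum_smul]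
    simp
  · rw [siteSum_commutator hact, one_mul, neg_lie, hhe, ← siteSum_smul]
    simp
  · have := hv h (by simp)
    rw [← neg_one_smul ℂ h, siteSum_smul, LinearMap.smul_apply, this, smul_zero]

end SiteSum



/-! ### The highest root vector -/

section Words

variable {κ L : Type*} [DecidableEq κ] [LieRing L] [LieAlgebra ℂ L] {A : Matrix κ κ ℤ}
  {E F H : κ → L}

/-- Iterated brackets. -/
def adWord (E : κ → L) (w : List κ) (b : L) : L := w.foldr (fun k a => ⁅E k, a⁆) b

omit [LieAlgebra ℂ L] in
lemma seqLie_eq_adWord {I : Type*} (x : I → L) (i : I) (l : List I) :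
    seqLie x (i :: l) = adWord x l.reverse (x i) := by
  rw [adWord, List.foldr_reverse, seqLie]

lemma IsChevalley.lie_h_adWord (h : IsChevalley A E F H) {b : L} {μ : κ → ℂ}
    (hb : ∀ k, ⁅H k, b⁆ = μ k • b) (w : List κ) (k : κ) :
    ⁅H k, adWord E w b⁆ = (μ k + (w.map fun l => (A k l : ℂ)).sum) • adWord E w b := by
  induction w with
  | nil => simp [adWord, hb]
  | cons l w ih =>
    change ⁅H k, ⁅E l, adWord E w b⁆⁆ = _ • ⁅E l, adWord E w b⁆
    rw [leibniz_lie, h.lie_h_e, ih, smul_lie, lie_smul, ← add_smul, List.map_cons, List.sum_cons]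
    congr 1
    ring

/-- Moving F k past E l costs at most a coroot, which acts on a word by a scalar. Applied to
brackets of the e_k, and with the roles of e and f exchanged to the highest root vector. -/
lemma IsChevalley.lie_f_adWord_mem (h : IsChevalley A E F H) {b : L} {μ : κ → ℂ}
    (hb : ∀ k, ⁅H k, b⁆ = μ k • b) {S : Submodule ℂ L} (hS : ∀ w, adWord E w b ∈ S)
    (hSE : ∀ k, ∀ x ∈ S, ⁅E k, x⁆ ∈ S) (hFb : ∀ k, ⁅F k, b⁆ ∈ S) (k : κ) (w : List κ) :
    ⁅F k, adWord E w b⁆ ∈ S := by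
  induction w with
  | nil => exact hFb k
  | cons l w ih =>
    change ⁅F k, ⁅E l, adWord E w b⁆⁆ ∈ S
    rw [leibniz_lie, ← lie_skew (F k) (E l), h.lie_e_f, neg_lie]
    refine S.add_mem (S.neg_mem ?_) (hSE l _ ih)
    split_ifs with hlk
    · rw [h.lie_h_adWord hb]
      exact S.smul_mem _ (hS w)
    · rw [zero_lie]
      exact S.zero_mem

/-- The span of the coroots and the iterated brackets of the `E k`. -/
def wordSpan (E H : κ → L) : Submodule ℂ L :=
  Submodule.span ℂ (Set.range H ∪ {x | ∃ w i, x = adWord E w (E i)})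

omit [DecidableEq κ] in
lemma h_mem_wordSpan (k : κ) : H k ∈ wordSpan E H := Submodule.subset_span (Or.inl ⟨k, rfl⟩)

omit [DecidableEq κ] in
lemma adWord_mem_wordSpan (w : List κ) (i : κ) : adWord E w (E i) ∈ wordSpan E H :=
  Submodule.subset_span (Or.inr ⟨w, i, rfl⟩)

omit [DecidableEq κ] in
lemma wordSpan_neg : wordSpan E (-H) = wordSpan E H := by
  have : ∀ H : κ → L, wordSpan E (-H) ≤ wordSpan E H := by
    intro H
    refine Submodule.span_le.2 ?_
    rintro x (⟨k, rfl⟩ | ⟨w, i, rfl⟩)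
    · exact (wordSpan E H).neg_mem (h_mem_wordSpan k)
    · exact adWord_mem_wordSpan w i
  refine le_antisymm (this H) ?_
  simpa using! this (-H)

lemma IsChevalley.lie_e_mem_wordSpan (h : IsChevalley A E F H) (k : κ) {x : L}
    (hx : x ∈ wordSpan E H) : ⁅E k, x⁆ ∈ wordSpan E H := by
  have : wordSpan E H ≤ (wordSpan E H).comap (LieAlgebra.ad ℂ L (E k) : L →ₗ[ℂ] L) := by
    refine Submodule.span_le.2 ?_
    rintro x (⟨j, rfl⟩ | ⟨w, i, rfl⟩)
    · change ⁅E k, H j⁆ ∈ wordSpan E H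
      rw [← lie_skew, h.lie_h_e]
      exact Submodule.neg_mem _ (Submodule.smul_mem _ _ (adWord_mem_wordSpan [] k))
    · exact adWord_mem_wordSpan (k :: w) i
  exact this hx

lemma IsChevalley.lie_f_mem_wordSpan (h : IsChevalley A E F H) (k : κ) {x : L}
    (hx : x ∈ wordSpan E H) : ⁅F k, x⁆ ∈ wordSpan E H ⊔ wordSpan F H := by
  have : wordSpan E H ≤ (wordSpan E H ⊔ wordSpan F H).comap
      (LieAlgebra.ad ℂ L (F k) : L →ₗ[ℂ] L) := by
    refine Submodule.span_le.2 ?_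
    rintro x (⟨j, rfl⟩ | ⟨w, i, rfl⟩)
    · refine Submodule.mem_sup_right ?_
      change ⁅F k, H j⁆ ∈ wordSpan F H
      rw [← wordSpan_neg]
      exact h.symm.lie_e_mem_wordSpan k (wordSpan_neg (E := F) (H := H) ▸ h_mem_wordSpan j)
    · refine Submodule.mem_sup_left (h.lie_f_adWord_mem (μ := fun k => A k i)
        (fun k => h.lie_h_e k i) (fun w => adWord_mem_wordSpan w i)
        (fun k x hx => h.lie_e_mem_wordSpan k hx) (fun k => ?_) k w)
      rw [← lie_skew, h.lie_e_f]
      split_ifs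
      · exact Submodule.neg_mem _ (h_mem_wordSpan i)
      · simp
  exact this hx

/-- An eigenvector is a combination of those elements of a spanning set of eigenvectors that have
the same eigenvalue. -/
lemma mem_span_of_eigenvector {M : Type*} [AddCommGroup M] [Module ℂ M] {D : Module.End ℂ M}
    {B : Set M} (hB : ∀ b ∈ B, ∃ μ : ℂ, D b = μ • b) (hspan : Submodule.span ℂ B = ⊤) {v : M}
    {N : ℂ} (hv : D v = N • v) : v ∈ Submodule.span ℂ {b ∈ B | D b = N • b} := by
  have h1 : v ∈ Submodule.span ℂ {b ∈ B | D b = N • b} ⊔ ⨆ μ ≠ N, D.eigenspace μ := by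
    have : v ∈ Submodule.span ℂ B := hspan ▸ Submodule.mem_top
    refine (Submodule.span_le.2 ?_ : Submodule.span ℂ B ≤ _) this
    intro b hb
    obtain ⟨μ, hμ⟩ := hB b hb
    by_cases h : μ = N
    · subst h
      exact Submodule.mem_sup_left (Submodule.subset_span ⟨hb, hμ⟩)
    · exact Submodule.mem_sup_right (Submodule.mem_iSup_of_mem μ
        (Submodule.mem_iSup_of_mem h (Module.End.mem_eigenspace_iff.2 hμ)))
  obtain ⟨a, ha, b, hb, rfl⟩ := Submodule.mem_sup.1 h1
  have ha' : a ∈ D.eigenspace N := by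
    refine (Submodule.span_le.2 ?_ : Submodule.span ℂ {b ∈ B | D b = N • b} ≤ _) ha
    exact fun b hb => Module.End.mem_eigenspace_iff.2 hb.2
  have hb' : b ∈ D.eigenspace N := by
    have := Submodule.sub_mem _ (Module.End.mem_eigenspace_iff.2 hv) ha'
    rwa [add_sub_cancel_left] at this
  have h0 := (D.eigenspaces_iSupIndep N).le_bot ⟨hb', hb⟩
  rw [Submodule.mem_bot] at h0
  rwa [h0, add_zero]

end Words

/-! ### Height grading and the root space of the highest root -/

section HighestRoot

variable {r : ℕ} {A : Matrix (Fin r) (Fin r) ℤ}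

lemma lie_mem_of_gen {S : Submodule ℂ (LieAlg A)} (hE : ∀ k, ∀ x ∈ S, ⁅genE A k, x⁆ ∈ S)
    (hF : ∀ k, ∀ x ∈ S, ⁅genF A k, x⁆ ∈ S) (y : LieAlg A) {x : LieAlg A} (hx : x ∈ S) :
    ⁅y, x⁆ ∈ S := by
  let K : LieSubalgebra ℂ (LieAlg A) :=
    { carrier := {y | ∀ x ∈ S, ⁅y, x⁆ ∈ S}
      add_mem' := fun ha hb x hx => by rw [add_lie]; exact S.add_mem (ha x hx) (hb x hx)
      zero_mem' := fun x _ => by rw [zero_lie]; exact S.zero_mem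
      smul_mem' := fun c a ha x hx => by rw [smul_lie]; exact S.smul_mem c (ha x hx)
      lie_mem' := fun ha hb x hx => by
        rw [lie_lie]; exact S.sub_mem (ha _ (hb x hx)) (hb _ (ha x hx)) }
  have hy : y ∈ K := lieSubalgebra_eq_top A K hE hF ▸ LieSubalgebra.mem_top y
  exact hy x hx

lemma eq_top_of_gen [LieAlgebra.IsSimple ℂ (LieAlg A)] {S : Submodule ℂ (LieAlg A)}
    (hE : ∀ k, ∀ x ∈ S, ⁅genE A k, x⁆ ∈ S) (hF : ∀ k, ∀ x ∈ S, ⁅genF A k, x⁆ ∈ S)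
    {x : LieAlg A} (hx : x ∈ S) (hx0 : x ≠ 0) : S = ⊤ := by
  let J : LieIdeal ℂ (LieAlg A) := { S with lie_mem := fun {y x} hx => lie_mem_of_gen hE hF y hx }
  have hJ : J.toSubmodule = S := rfl
  rcases LieAlgebra.IsSimple.eq_bot_or_eq_top J with h | h
  · exact absurd ((LieSubmodule.mem_bot x).1 (h ▸ (show x ∈ J from hx))) hx0
  · rw [← hJ, h, LieSubmodule.top_toSubmodule]

lemma eq_zero_of_lie_gen [LieAlgebra.IsSimple ℂ (LieAlg A)] {x : LieAlg A}
    (hE : ∀ k, ⁅genE A k, x⁆ = 0) (hF : ∀ k, ⁅genF A k, x⁆ = 0) : x = 0 := by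
  have hS : ∀ y : LieAlg A, ⁅y, x⁆ = 0 := by
    let K : LieSubalgebra ℂ (LieAlg A) :=
      { carrier := {y | ⁅y, x⁆ = 0}
        add_mem' := fun {a b} ha hb => by
          change ⁅a + b, x⁆ = 0
          rw [add_lie, show ⁅a, x⁆ = 0 from ha, show ⁅b, x⁆ = 0 from hb, add_zero]
        zero_mem' := zero_lie x
        smul_mem' := fun c a ha => by
          change ⁅c • a, x⁆ = 0
          rw [smul_lie, show ⁅a, x⁆ = 0 from ha, smul_zero]
        lie_mem' := fun {a b} ha hb => by
          change ⁅⁅a, b⁆, x⁆ = 0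
          rw [lie_lie, show ⁅a, x⁆ = 0 from ha, show ⁅b, x⁆ = 0 from hb, lie_zero, lie_zero,
            sub_zero] }
    intro y
    have hy : y ∈ K := lieSubalgebra_eq_top A K hE hF ▸ LieSubalgebra.mem_top y
    exact hy
  have : x ∈ LieAlgebra.center ℂ (LieAlg A) := fun y => hS y
  rwa [LieAlgebra.center_eq_bot, LieSubmodule.mem_bot] at this

/-- The triangular decomposition, as a statement on spanning sets only. -/
lemma wordSpan_sup_eq_top : wordSpan (genE A) (genH A) ⊔ wordSpan (genF A) (genH A) = ⊤ := by
  have h := gen_isChevalley A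
  set S := wordSpan (genE A) (genH A) ⊔ wordSpan (genF A) (genH A)
  have hE : ∀ k, ∀ x ∈ S, ⁅genE A k, x⁆ ∈ S := by
    intro k x hx
    obtain ⟨a, ha, b, hb, rfl⟩ := Submodule.mem_sup.1 hx
    rw [lie_add]
    refine S.add_mem (Submodule.mem_sup_left (h.lie_e_mem_wordSpan k ha)) ?_
    have := h.symm.lie_f_mem_wordSpan k (wordSpan_neg (E := genF A) (H := genH A) ▸ hb)
    rwa [wordSpan_neg, wordSpan_neg, sup_comm] at this
  have hF : ∀ k, ∀ x ∈ S, ⁅genF A k, x⁆ ∈ S := by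
    intro k x hx
    obtain ⟨a, ha, b, hb, rfl⟩ := Submodule.mem_sup.1 hx
    rw [lie_add]
    refine S.add_mem (h.lie_f_mem_wordSpan k ha) (Submodule.mem_sup_right ?_)
    have := h.symm.lie_e_mem_wordSpan k (wordSpan_neg (E := genF A) (H := genH A) ▸ hb)
    rwa [wordSpan_neg] at this
  let K : LieSubalgebra ℂ (LieAlg A) :=
    { S with lie_mem' := fun {y x} _ hx => lie_mem_of_gen hE hF y hx }
  have hK : K = ⊤ := lieSubalgebra_eq_top A K
    (fun k => Submodule.mem_sup_left (adWord_mem_wordSpan [] k))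
    (fun k => Submodule.mem_sup_right (adWord_mem_wordSpan [] k))
  rw [eq_top_iff]
  intro x _
  exact (hK ▸ LieSubalgebra.mem_top x : x ∈ K)

section

variable [LieAlgebra.IsSimple ℂ (LieAlg A)] (hlin : LinearIndependent ℂ (genH A))
include hlin

/-- A left null vector of the matrix gives a combination of coroots that commutes with all
generators. It is central, hence zero, against independence. -/
lemma det_cast_ne_zero : (A.map (Int.cast : ℤ → ℂ)).det ≠ 0 := by
  intro h
  obtain ⟨v, hv, hv'⟩ := Matrix.exists_vecMul_eq_zero_iff.2 h
  have h1 : ∀ l, ∑ k, v k * (A k l : ℂ) = 0 := fun l => by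
    simpa [Matrix.vecMul, dotProduct] using congrFun hv' l
  have h2 : ∑ k, v k • genH A k = 0 := by
    refine eq_zero_of_lie_gen (fun l => ?_) (fun l => ?_)
    · rw [← lie_skew, sum_lie]
      simp only [smul_lie, (gen_isChevalley A).lie_h_e, smul_smul, ← Finset.sum_smul, h1, zero_smul,
        neg_zero]
    · rw [← lie_skew, sum_lie]
      simp only [smul_lie, (gen_isChevalley A).lie_h_f, smul_neg, smul_smul,
        Finset.sum_neg_distrib, ← Finset.sum_smul, h1, zero_smul, neg_zero]
  exact hv (funext fun k => Fintype.linearIndependent_iff.1 hlin v h2 k)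

/-- With d = ∑ c_k h_k one has [d, e_l] = e_l, so ad d has the heights as eigenvalues. -/
lemma exists_grading : ∃ c : Fin r → ℂ, ∀ l, ∑ k, c k * (A k l : ℂ) = 1 := by
  have h := det_cast_ne_zero hlin
  refine ⟨Matrix.vecMul 1 (A.map (Int.cast : ℤ → ℂ))⁻¹, fun l => ?_⟩
  have : Matrix.vecMul (Matrix.vecMul 1 (A.map (Int.cast : ℤ → ℂ))⁻¹) (A.map (Int.cast : ℤ → ℂ)) =
      1 := by
    rw [Matrix.vecMul_vecMul, Matrix.nonsing_inv_mul _ (isUnit_iff_ne_zero.2 h), Matrix.vecMul_one]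
  simpa [Matrix.vecMul, dotProduct] using congrFun this l

end

lemma lie_mem_rootSpace {α β : Fin r → ℤ} {x y : LieAlg A} (hx : x ∈ rootSpace A α)
    (hy : y ∈ rootSpace A β) : ⁅x, y⁆ ∈ rootSpace A (α + β) := by
  intro k
  rw [leibniz_lie, hx k, hy k, smul_lie, lie_smul, ← add_smul, ← Int.cast_add,
    ← Finset.sum_add_distrib]
  simp only [Pi.add_apply, mul_add]

lemma genE_mem_rootSpace (k : Fin r) : genE A k ∈ rootSpace A (Pi.single k 1) := by
  intro j
  rw [(gen_isChevalley A).lie_h_e]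
  simp [Pi.single_apply]

/-- The number of occurrences of the simple roots in a word. -/
def wordRoot (w : List (Fin r)) : Fin r → ℤ := (w.map fun k => Pi.single k (1 : ℤ)).sum

lemma sum_wordRoot (w : List (Fin r)) : ∑ k, wordRoot w k = w.length := by
  induction w with
  | nil => simp [wordRoot]
  | cons l w ih =>
    simp only [wordRoot, List.map_cons, List.sum_cons, Pi.add_apply, Finset.sum_add_distrib] at ih ⊢
    rw [ih]
    simp [add_comm]

lemma adWord_mem_rootSpace (w : List (Fin r)) (i : Fin r) :
    adWord (genE A) w (genE A i) ∈ rootSpace A (wordRoot (i :: w)) := by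
  induction w with
  | nil => simpa [adWord, wordRoot] using genE_mem_rootSpace i
  | cons l w ih =>
    have := lie_mem_rootSpace (genE_mem_rootSpace (A := A) l) ih
    have h : Pi.single l 1 + wordRoot (i :: w) = wordRoot (i :: l :: w) := by
      simp only [wordRoot, List.map_cons, List.sum_cons]
      abel
    rwa [h] at this

section

variable (hlin : LinearIndependent ℂ (genH A)) {θ : Fin r → ℤ} (hθ : IsHighestRoot A θ)
include hlin

lemma genE_ne_zero (k : Fin r) : genE A k ≠ 0 := by
  intro h
  have h1 := (gen_isChevalley A).lie_e_f k k
  rw [h, zero_lie, if_pos rfl] at h1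
  exact hlin.ne_zero k h1.symm

include hθ

lemma single_le_highest (k : Fin r) : Pi.single k 1 ≤ θ :=
  hθ.2 _ ⟨by simp, fun h => genE_ne_zero hlin k ((Submodule.eq_bot_iff _).1 h _
    (genE_mem_rootSpace k))⟩

lemma highest_pos (k : Fin r) : 1 ≤ θ k := by simpa using single_le_highest hlin hθ k k

lemma coxeterNumber_eq : ((coxeterNumber A - 1 : ℕ) : ℤ) = ∑ k, θ k := by
  have h0 : 0 ≤ ∑ k, θ k := Finset.sum_nonneg fun k _ => by have := highest_pos hlin hθ k; omega
  obtain ⟨N, hN⟩ := Int.eq_ofNat_of_zero_le h0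
  have h1 : IsGreatest {N : ℕ | ∃ α, IsRoot A α ∧ ∑ k, α k = (N : ℤ)} N := by
    refine ⟨⟨θ, hθ.1, hN⟩, ?_⟩
    rintro M ⟨α, hα, hM⟩
    have := Finset.sum_le_sum fun k (_ : k ∈ Finset.univ) => hθ.2 α hα k
    rw [hM, hN] at this
    exact_mod_cast this
  rw [coxeterNumber, h1.csSup_eq, hN, Nat.add_sub_cancel_left]

lemma coxeterNumber_pos : 0 < coxeterNumber A - 1 := by
  have h : ∃ k, θ k ≠ 0 := Function.ne_iff.1 hθ.1.1
  obtain ⟨k, -⟩ := h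
  have := Finset.single_le_sum (f := θ)
    (fun k _ => by have := highest_pos hlin hθ k; omega) (Finset.mem_univ k)
  have h1 := highest_pos hlin hθ k
  have h2 := coxeterNumber_eq hlin hθ
  omega

variable {e : LieAlg A} (he : e ∈ rootSpace A θ)
include he

/-- Otherwise the sum of θ and a simple root would be a root. -/
lemma lie_genE_highest (k : Fin r) : ⁅genE A k, e⁆ = 0 := by
  by_contra hne
  have hmem := lie_mem_rootSpace (genE_mem_rootSpace (A := A) k) he
  have hk := highest_pos hlin hθ k
  have h1 := hθ.2 (Pi.single k 1 + θ) ⟨fun h => ?_, fun h => ?_⟩ k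
  · simp at h1
  · have := congrFun h k
    simp only [Pi.add_apply, Pi.single_eq_same, Pi.zero_apply] at this
    omega
  · exact hne ((Submodule.eq_bot_iff _).1 h _ hmem)

variable [LieAlgebra.IsSimple ℂ (LieAlg A)]

/-- Since all e_k kill e, the iterated brackets of the f_k with e span an ideal, hence everything.
Of these only e itself has the height of θ. -/
lemma highest_unique (he0 : e ≠ 0) {x : LieAlg A} (hx : x ∈ rootSpace A θ) :
    ∃ c : ℂ, x = c • e := by
  obtain ⟨c, hc⟩ := exists_grading hlin
  have h := gen_isChevalley A
  let d : LieAlg A := ∑ k, c k • genH A k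
  let B : Set (LieAlg A) := Set.range fun w => adWord (genF A) w e
  have hd : ∀ α : Fin r → ℤ, ∀ x ∈ rootSpace A α, ⁅d, x⁆ = ((∑ l, α l : ℤ) : ℂ) • x := by
    intro α x hx
    rw [sum_lie]
    simp only [smul_lie, hx _, smul_smul, ← Finset.sum_smul]
    congr 1
    push_cast
    simp only [Finset.mul_sum, ← mul_assoc]
    rw [Finset.sum_comm]
    simp only [← Finset.sum_mul, hc, one_mul]
  have hdF : ∀ k, ⁅d, genF A k⁆ = -genF A k := by
    intro k
    rw [sum_lie]
    simp only [smul_lie, h.lie_h_f, smul_neg, smul_smul, Finset.sum_neg_distrib,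
      ← Finset.sum_smul, hc, one_smul]
  have hB : ∀ w, ⁅d, adWord (genF A) w e⁆ =
      (((∑ l, θ l : ℤ) : ℂ) - w.length) • adWord (genF A) w e := by
    intro w
    induction w with
    | nil => simpa [adWord] using hd θ e he
    | cons k w ih =>
      change ⁅d, ⁅genF A k, adWord (genF A) w e⁆⁆ = _ • ⁅genF A k, adWord (genF A) w e⁆
      rw [leibniz_lie, hdF, ih, neg_lie, lie_smul, List.length_cons]
      push_cast
      module
  have heH : ∀ k, ⁅(-genH A) k, e⁆ = (-((∑ l, A k l * θ l : ℤ) : ℂ)) • e := fun k => by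
    rw [Pi.neg_apply, neg_lie, he k, neg_smul]
  have htop : Submodule.span ℂ B = ⊤ := by
    have hF : ∀ k, ∀ x ∈ Submodule.span ℂ B, ⁅genF A k, x⁆ ∈ Submodule.span ℂ B := by
      intro k x hx
      have : Submodule.span ℂ B ≤ (Submodule.span ℂ B).comap
          (LieAlgebra.ad ℂ (LieAlg A) (genF A k) : LieAlg A →ₗ[ℂ] LieAlg A) := by
        refine Submodule.span_le.2 ?_
        rintro _ ⟨w, rfl⟩
        exact Submodule.subset_span ⟨k :: w, rfl⟩
      exact this hx
    refine eq_top_of_gen ?_ hF (Submodule.subset_span ⟨[], rfl⟩) he0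
    intro k x hx
    have : Submodule.span ℂ B ≤ (Submodule.span ℂ B).comap
        (LieAlgebra.ad ℂ (LieAlg A) (genE A k) : LieAlg A →ₗ[ℂ] LieAlg A) := by
      refine Submodule.span_le.2 ?_
      rintro _ ⟨w, rfl⟩
      refine h.symm.lie_f_adWord_mem (S := Submodule.span ℂ B) heH
        (fun w => Submodule.subset_span ⟨w, rfl⟩) hF (fun k => ?_) k w
      rw [lie_genE_highest hlin hθ he]
      exact Submodule.zero_mem _
    exact this hx
  have hmem := mem_span_of_eigenvector
    (D := (LieAlgebra.ad ℂ (LieAlg A) d : LieAlg A →ₗ[ℂ] LieAlg A)) (B := B)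
    (by rintro _ ⟨w, rfl⟩; exact ⟨_, hB w⟩) htop (hd θ x hx)
  have hsub : {b ∈ B | (LieAlgebra.ad ℂ (LieAlg A) d) b = ((∑ l, θ l : ℤ) : ℂ) • b} ⊆
      (Submodule.span ℂ {e} : Set (LieAlg A)) := by
    rintro _ ⟨⟨w, rfl⟩, hw⟩
    rcases w with _ | ⟨k, w⟩
    · exact Submodule.mem_span_singleton_self e
    · have h1 : ⁅d, adWord (genF A) (k :: w) e⁆ = _ := hw
      rw [hB, ← sub_eq_zero, ← sub_smul] at h1
      rcases smul_eq_zero.1 h1 with h2 | h2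
      · rw [sub_sub_cancel_left, neg_eq_zero, Nat.cast_eq_zero] at h2
        simp at h2
      · change adWord (genF A) (k :: w) e ∈ Submodule.span ℂ {e}
        rw [h2]
        exact Submodule.zero_mem _
  obtain ⟨c, hc⟩ := Submodule.mem_span_singleton.1 (Submodule.span_le.2 hsub hmem)
  exact ⟨c, hc.symm⟩

/-- If the bracket is nonzero, its root is ≤ θ and has the same height as θ, so it is θ. -/
lemma seqLie_eq_smul_highest (he0 : e ≠ 0) {w : List (Fin r)}
    (hw : w.length = coxeterNumber A - 1) : ∃ c : ℂ, seqLie (genE A) w = c • e := by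
  rcases w with _ | ⟨i, w⟩
  · exact ⟨0, by simp [seqLie]⟩
  by_cases h0 : seqLie (genE A) (i :: w) = 0
  · exact ⟨0, by rw [h0, zero_smul]⟩
  rw [seqLie_eq_adWord] at h0 ⊢
  refine highest_unique hlin hθ he he0 ?_
  have hmem := adWord_mem_rootSpace (A := A) w.reverse i
  have hsum : ∑ k, wordRoot (i :: w.reverse) k = ∑ k, θ k := by
    rw [sum_wordRoot, ← coxeterNumber_eq hlin hθ, ← hw]
    simp
  have hroot : IsRoot A (wordRoot (i :: w.reverse)) := by
    refine ⟨fun h => ?_, fun h => h0 ((Submodule.eq_bot_iff _).1 h _ hmem)⟩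
    have := sum_wordRoot (i :: w.reverse)
    rw [h] at this
    simp at this
    omega
  have hle := hθ.2 _ hroot
  have : wordRoot (i :: w.reverse) = θ := funext fun k =>
    (Finset.sum_eq_sum_iff_of_le fun k _ => hle k).1 hsum k (Finset.mem_univ k)
  rwa [this] at hmem

/-- By the grading, e is a combination of those spanning brackets whose height is the positive
number h - 1. These are brackets of h - 1 of the e_k, and they cannot all vanish. -/
lemma exists_seqLie_ne_zero (he0 : e ≠ 0) :
    ∃ w : List (Fin r), w.length = coxeterNumber A - 1 ∧ seqLie (genE A) w ≠ 0 := by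
  by_contra! hcon
  apply he0
  obtain ⟨c, hc⟩ := exists_grading hlin
  have h := gen_isChevalley A
  let d : LieAlg A := ∑ k, c k • genH A k
  have hN := coxeterNumber_eq hlin hθ
  have hNpos := coxeterNumber_pos hlin hθ
  set N := coxeterNumber A - 1
  have hde : ⁅d, e⁆ = (N : ℂ) • e := by
    rw [sum_lie]
    simp only [smul_lie, he _, smul_smul, ← Finset.sum_smul]
    congr 1
    rw [← Int.cast_natCast (R := ℂ) N, hN]
    push_cast
    simp only [Finset.mul_sum, ← mul_assoc]
    rw [Finset.sum_comm]
    simp only [← Finset.sum_mul, hc, one_mul]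
  have hdE : ∀ k, ⁅d, genE A k⁆ = (1 : ℂ) • genE A k := by
    intro k
    rw [sum_lie]
    simp only [smul_lie, h.lie_h_e, smul_smul, ← Finset.sum_smul, hc]
  have hdF : ∀ k, ⁅d, genF A k⁆ = (-1 : ℂ) • genF A k := by
    intro k
    rw [sum_lie]
    simp only [smul_lie, h.lie_h_f, smul_neg, smul_smul, Finset.sum_neg_distrib,
      ← Finset.sum_smul, hc, neg_smul]
  have hdH : ∀ k, ⁅d, genH A k⁆ = 0 := by
    intro k
    rw [sum_lie]
    simp [lie_genH_genH]
  have hword : ∀ (G : Fin r → LieAlg A) (s : ℂ), (∀ k, ⁅d, G k⁆ = s • G k) →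
      ∀ w i, ⁅d, adWord G w (G i)⁆ = (s * ((w.length : ℂ) + 1)) • adWord G w (G i) := by
    intro G s hG w i
    induction w with
    | nil => simpa [adWord] using hG i
    | cons k w ih =>
      change ⁅d, ⁅G k, adWord G w (G i)⁆⁆ = _ • ⁅G k, adWord G w (G i)⁆
      rw [leibniz_lie, hG, ih, smul_lie, lie_smul, List.length_cons]
      push_cast
      module
  let B : Set (LieAlg A) := (Set.range (genH A) ∪ {x | ∃ w i, x = adWord (genE A) w (genE A i)}) ∪
    (Set.range (genH A) ∪ {x | ∃ w i, x = adWord (genF A) w (genF A i)})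
  have htop : Submodule.span ℂ B = ⊤ := by
    rw [Submodule.span_union]
    exact wordSpan_sup_eq_top
  have hmem := mem_span_of_eigenvector
    (D := (LieAlgebra.ad ℂ (LieAlg A) d : LieAlg A →ₗ[ℂ] LieAlg A)) (B := B) ?_ htop hde
  · refine (Submodule.mem_bot ℂ).1 (Submodule.span_le.2 ?_ hmem)
    have hNC : (N : ℂ) ≠ 0 := Nat.cast_ne_zero.2 hNpos.ne'
    have hH : ∀ k, (N : ℂ) • genH A k = ⁅d, genH A k⁆ → genH A k = 0 := by
      intro k hk
      rw [hdH] at hk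
      exact (smul_eq_zero.1 hk).resolve_left hNC
    rintro b ⟨(⟨k, rfl⟩ | ⟨w, i, rfl⟩) | (⟨k, rfl⟩ | ⟨w, i, rfl⟩), hb⟩
    · exact hH k hb.symm
    · have h1 := (hword _ 1 hdE w i).symm.trans hb
      rw [← sub_eq_zero, ← sub_smul] at h1
      rcases smul_eq_zero.1 h1 with h2 | h2
      · have h3 : w.length + 1 = N := by
          rw [one_mul, sub_eq_zero] at h2
          exact_mod_cast h2
        have h4 := hcon (i :: w.reverse) (by simpa using h3)
        rwa [seqLie_eq_adWord, List.reverse_reverse] at h4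
      · exact h2
    · exact hH k hb.symm
    · have h1 := (hword _ (-1) hdF w i).symm.trans hb
      rw [← sub_eq_zero, ← sub_smul] at h1
      refine (smul_eq_zero.1 h1).resolve_left fun h2 => ?_
      have h3 : ((w.length + 1 + N : ℕ) : ℂ) = 0 := by
        push_cast
        linear_combination -h2
      rw [Nat.cast_eq_zero] at h3
      omega
  · rintro b ((⟨k, rfl⟩ | ⟨w, i, rfl⟩) | (⟨k, rfl⟩ | ⟨w, i, rfl⟩))
    · exact ⟨0, (hdH k).trans (zero_smul _ _).symm⟩
    · exact ⟨_, hword _ 1 hdE w i⟩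
    · exact ⟨0, (hdH k).trans (zero_smul _ _).symm⟩
    · exact ⟨_, hword _ (-1) hdF w i⟩

end

end HighestRoot



/-! ### The `sl₂`-triple of the highest root -/

section Triple

variable {r : ℕ} {A : Matrix (Fin r) (Fin r) ℤ}

/-- The Cartan subalgebra spanned by the simple coroots. -/
def cartan (A : Matrix (Fin r) (Fin r) ℤ) : LieSubalgebra ℂ (LieAlg A) :=
  LieSubalgebra.lieSpan ℂ (LieAlg A) (Set.range (genH A))

variable [LieAlgebra.IsSimple ℂ (LieAlg A)]

/-- The Chevalley generators as a basis in the sense of Mathlib. -/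
def chevalleyBasis (hA : IsGCM A) (hlin : LinearIndependent ℂ (genH A)) :
    LieAlgebra.Basis (Fin r) (cartan A) where
  -- `LieAlgebra.Basis` has the opposite index convention, [h i, e j] = A j i • e j.
  A := A.transpose
  h := genH A
  e := genE A
  f := genF A
  cartan_eq_lieSpan := rfl
  span_ef := lieSubalgebra_eq_top A _
    (fun k => LieSubalgebra.subset_lieSpan (Or.inl ⟨k, rfl⟩))
    (fun k => LieSubalgebra.subset_lieSpan (Or.inr ⟨k, rfl⟩))
  linInd := hlin
  nondegen := by
    rw [Matrix.nondegenerate_iff_det_ne_zero, Matrix.det_transpose]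
    intro h
    refine det_cast_ne_zero hlin ?_
    have := congrArg (Int.cast : ℤ → ℂ) h
    rw [Int.cast_det] at this
    simpa using this
  sl2 k :=
    { h_ne_zero := hlin.ne_zero k
      lie_e_f := by rw [(gen_isChevalley A).lie_e_f, if_pos rfl]
      lie_h_e_nsmul := by
        rw [(gen_isChevalley A).lie_h_e, hA.diag, ← Nat.cast_smul_eq_nsmul ℂ]; simp
      lie_h_f_nsmul := by
        rw [(gen_isChevalley A).lie_h_f, hA.diag, ← Nat.cast_smul_eq_nsmul ℂ]; simp }
  lie_h_h := lie_genH_genH A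
  lie_h_e i j := by
    rw [(gen_isChevalley A).lie_h_e, Int.cast_smul_eq_zsmul, Matrix.transpose_apply]
  lie_h_f i j := by
    rw [(gen_isChevalley A).lie_h_f, Int.cast_smul_eq_zsmul, Matrix.transpose_apply, neg_smul]
  lie_e_f_ne i j h := by rw [(gen_isChevalley A).lie_e_f, if_neg h]

variable [FiniteDimensional ℂ (LieAlg A)]

/-- The coroots span a Cartan subalgebra and e lies in a root space for it, so there is an
sl₂-triple for this root. By `highest_unique` its raising element is a multiple of e, and the scalar
can be moved to f. -/
lemma exists_sl2_highest (hA : IsGCM A) (hlin : LinearIndependent ℂ (genH A)) {θ : Fin r → ℤ}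
    (hθ : IsHighestRoot A θ) {e : LieAlg A} (he : e ∈ rootSpace A θ) (he0 : e ≠ 0) :
    ∃ f h : LieAlg A, ⁅e, f⁆ = h ∧ ⁅h, e⁆ = (2 : ℂ) • e ∧ ⁅h, f⁆ = (-2 : ℂ) • f := by
  let b := chevalleyBasis hA hlin
  have hab : IsLieAbelian (cartan A) := b.isLieAbelian_cartan
  have hcar : (cartan A).IsCartanSubalgebra := b.isCartanSubalgebra
  have hmem : ∀ k, genH A k ∈ cartan A := fun k => LieSubalgebra.subset_lieSpan ⟨k, rfl⟩
  have hχ : ∀ x : cartan A, ∃ c : ℂ, ⁅x, e⁆ = c • e := by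
    rintro ⟨x, hx⟩
    change ∃ c : ℂ, ⁅x, e⁆ = c • e
    have hx' : x ∈ Submodule.span ℂ (Set.range b.h) := b.coe_cartan_eq_span ▸ hx
    induction hx' using Submodule.span_induction with
    | mem x hxk =>
      obtain ⟨k, rfl⟩ := hxk
      exact ⟨_, he k⟩
    | zero => exact ⟨0, by simp⟩
    | add x y hx' hy' ihx ihy =>
      obtain ⟨c, hc⟩ := ihx (b.coe_cartan_eq_span ▸ hx' : x ∈ (cartan A).toSubmodule)
      obtain ⟨c', hc'⟩ := ihy (b.coe_cartan_eq_span ▸ hy' : y ∈ (cartan A).toSubmodule)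
      exact ⟨c + c', by rw [add_lie, hc, hc', add_smul]⟩
    | smul a x hx' ihx =>
      obtain ⟨c, hc⟩ := ihx (b.coe_cartan_eq_span ▸ hx' : x ∈ (cartan A).toSubmodule)
      exact ⟨a * c, by rw [smul_lie, hc, smul_smul]⟩
  choose χ hχ using hχ
  have hmemχ : e ∈ LieAlgebra.rootSpace (cartan A) χ := by
    rw [LieModule.mem_genWeightSpace]
    intro x
    refine ⟨1, ?_⟩
    simp [hχ]
  let α : LieModule.Weight ℂ (cartan A) (LieAlg A) :=
    ⟨χ, fun h => he0 ((LieSubmodule.mem_bot e).1 (by rw [← h]; exact hmemχ))⟩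
  have hαk : ∀ k, χ ⟨genH A k, hmem k⟩ = ((∑ l, A k l * θ l : ℤ) : ℂ) := by
    intro k
    have h1 : ⁅genH A k, e⁆ = χ ⟨genH A k, hmem k⟩ • e := hχ ⟨genH A k, hmem k⟩
    rw [he k] at h1
    exact (smul_left_injective ℂ he0 h1).symm
  have hα : α.IsNonZero := by
    intro h
    obtain ⟨c, hc⟩ := exists_grading hlin
    have h0 : ∀ k, ((∑ l, A k l * θ l : ℤ) : ℂ) = 0 := fun k => by
      rw [← hαk k]
      exact congrFun h ⟨genH A k, hmem k⟩
    have h1 : ((∑ l, θ l : ℤ) : ℂ) = 0 := by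
      have : ∑ k, c k * ((∑ l, A k l * θ l : ℤ) : ℂ) = 0 := by
        simp only [h0, mul_zero, Finset.sum_const_zero]
      rw [← this]
      push_cast
      simp only [Finset.mul_sum, ← mul_assoc]
      rw [Finset.sum_comm]
      simp only [← Finset.sum_mul, hc, one_mul]
    rw [← coxeterNumber_eq hlin hθ, Int.cast_natCast, Nat.cast_eq_zero] at h1
    exact (coxeterNumber_pos hlin hθ).ne' h1
  obtain ⟨h, e', f, ht, he', -⟩ := LieAlgebra.IsKilling.exists_isSl2Triple_of_weight_isNonZero hα
  obtain ⟨c, rfl⟩ : ∃ c : ℂ, e' = c • e := by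
    refine highest_unique hlin hθ he he0 fun k => ?_
    have h1 := LieAlgebra.IsKilling.lie_eq_smul_of_mem_rootSpace he' ⟨genH A k, hmem k⟩
    rw [← hαk k]
    exact h1
  have hc : c ≠ 0 := by
    rintro rfl
    exact ht.e_ne_zero (zero_smul _ _)
  refine ⟨c • f, h, ?_, ?_, ?_⟩
  · rw [lie_smul, ← smul_lie, ht.lie_e_f]
  · have := ht.lie_h_e_nsmul
    rw [lie_smul, smul_comm] at this
    rw [smul_right_injective _ hc this, ← Nat.cast_smul_eq_nsmul ℂ]
    simp
  · rw [lie_smul, ht.lie_h_f_nsmul, ← Nat.cast_smul_eq_nsmul ℂ]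
    module

end Triple



/-! ### Residues on the diagonal -/

section Diagonal

variable {g W I : Type*} [LieRing g] [LieAlgebra ℂ g] [AddCommGroup W] [Module ℂ W]
  [DecidableEq I] {n : ℕ} {act : Fin n → g →ₗ⁅ℂ⁆ Module.End ℂ W} {z : Fin n → ℂ}

/-- The limit of an iterated residue on the diagonal. -/
lemma tendsto_resIter (hact : SitesCommute act) {X : Finset I} {F : (I → ℂ) → ℂ} {v : W}
    {φ : Module.Dual ℂ W} {x : I → g} {e : g} (he : ∀ k, ⁅x k, e⁆ = 0)
    (hF : ∀ t, IsConfN X z t → F t = corr act z v t X.toList x φ) (d : I) (c : List I → ℂ)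
    (Ls : List (List I)) (hne : ∀ l ∈ Ls, l ≠ []) (hnd : Ls.flatten.Nodup)
    (hX : Ls.flatten.toFinset ⊆ X) (hc : ∀ l ∈ Ls, seqLie x l = c l • e) {p : I → ℂ} {a : ℂ}
    (hpa : ∀ i ∈ Ls.flatten.toFinset, p i = a) (haz : ∀ ν, a ≠ z ν)
    (hp : IsConfN (X \ Ls.flatten.toFinset) z p) :
    Tendsto (resIter Ls F) (𝓝[{t | IsConfN X z t}] p) (𝓝 ((Ls.map c).prod *
      corr act z ((current act z e a ^ Ls.length) v) p (X \ Ls.flatten.toFinset).toList x φ)) := by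
  have hlast : ∀ l ∈ Ls, p (l.getLastD d) = a := fun l hl => hpa _ (by
    rw [List.mem_toFinset, List.mem_flatten]
    exact ⟨l, hl, getLastD_mem (hne l hl) d⟩)
  have h1 := (continuousAt_corr_current (act := act) hp (d := d) v x φ e Ls
    (fun l hl ν => by rw [hlast l hl]; exact haz ν)).tendsto.mono_left
    (nhdsWithin_le_nhds (s := {t | IsConfN X z t}))
  have h2 : (Ls.map fun l => current act z e (p (l.getLastD d))).prod =
      current act z e a ^ Ls.length := by
    rw [List.map_congr_left (g := fun _ => current act z e a) fun l hl => by rw [hlast l hl],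
      List.map_const', List.prod_replicate]
  rw [h2] at h1
  refine (h1.const_mul _).congr' ?_
  filter_upwards [self_mem_nhdsWithin] with t ht
  exact (resIter_corr hact he hF d c Ls hne hnd hX hc ht).symm

lemma current_eq (e : g) (a : ℂ) :
    current act z e a = (-1 : ℂ) • siteSum act (fun ν => z ν - a)⁻¹ e := by
  rw [current, siteSum, Finset.smul_sum]
  refine Finset.sum_congr rfl fun ν _ => ?_
  rw [smul_smul]
  congr 1
  rw [Pi.inv_apply, ← neg_sub a, inv_neg]
  ring

/-- The shift by a changes the operator by a multiple of the total action of e, which kills v and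
commutes with the rest. -/
lemma siteSum_pow_sub (hact : SitesCommute act) {e : g} {v : W} (hv : siteSum act 1 e v = 0) (a : ℂ)
    (m : ℕ) : (siteSum act (fun ν => z ν - a) e ^ m) v = (siteSum act z e ^ m) v := by
  have h1 : siteSum act (fun ν => z ν - a) e = siteSum act z e - a • siteSum act 1 e := by
    simp only [siteSum, Finset.smul_sum, ← Finset.sum_sub_distrib, sub_smul, Pi.one_apply, one_smul]
  have h2 : Commute (siteSum act 1 e) (siteSum act z e) := by
    rw [commute_iff_eq, ← sub_eq_zero, siteSum_commutator hact, lie_self]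
    simp [siteSum]
  induction m with
  | zero => rfl
  | succ m ih =>
    have h3 : siteSum act 1 e ((siteSum act z e ^ m) v) = 0 := by
      rw [← Module.End.mul_apply, (h2.pow_right m).eq, Module.End.mul_apply, hv, map_zero]
    rw [pow_succ', pow_succ', Module.End.mul_apply, Module.End.mul_apply, ih, h1,
      LinearMap.sub_apply, LinearMap.smul_apply, h3, smul_zero, sub_zero]

/-- Up to sign the current at a has the weights (z_ν - a)⁻¹. These are inverted by
`siteSum_pow_inv`, and the shift is removed by `siteSum_pow_sub`. -/
lemma current_pow_eq_zero_iff (hact : SitesCommute act) {e f h : g} (hef : ⁅e, f⁆ = h)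
    (hhe : ⁅h, e⁆ = (2 : ℂ) • e) (hhf : ⁅h, f⁆ = (-2 : ℂ) • f)
    (hnil : ∀ ν, IsNilpotent (act ν e)) {v : W} (hv : ∀ x, siteSum act 1 x v = 0) {a : ℂ}
    (ha : ∀ ν, a ≠ z ν) (m : ℕ) :
    (current act z e a ^ m) v = 0 ↔ (siteSum act z e ^ m) v = 0 := by
  have hw : ∀ ν, (fun ν => z ν - a) ν ≠ 0 := fun ν => sub_ne_zero.2 (ha ν).symm
  rw [current_eq, smul_pow, LinearMap.smul_apply, smul_eq_zero_iff_right
    (pow_ne_zero _ (by norm_num)), ← siteSum_pow_sub (z := z) hact (hv e) a m]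
  constructor
  · intro h0
    have := siteSum_pow_inv hact hef hhe hhf hnil (fun x _ => hv x)
      (w := (fun ν => z ν - a)⁻¹) (fun ν => inv_ne_zero (hw ν)) h0
    rwa [inv_inv] at this
  · exact fun h0 => siteSum_pow_inv hact hef hhe hhf hnil (fun x _ => hv x) hw h0

/-- A vector is zero if its correlators vanish off a finite set of indices. -/
lemma eq_zero_of_corr {r : ℕ} {M : Fin n → Type*} [∀ ν, AddCommGroup (M ν)]
    [∀ ν, Module ℂ (M ν)] {ρ : ∀ ν, g →ₗ⁅ℂ⁆ Module.End ℂ (M ν)} {E : Fin r → g} {π : I → Fin r}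
    (hπ : ∀ k, (π ⁻¹' {k}).Infinite) {ε : ∀ ν, Module.Dual ℂ (M ν)}
    (hε : ∀ ν m, (∀ w : List (Fin r), ε ν ((w.map fun k => ρ ν (E k)).prod m) = 0) → m = 0)
    (hz : Function.Injective z) {a : ℂ} (ha : ∀ ν, a ≠ z ν) {D : Finset I} {u : ⨂[ℂ] ν, M ν}
    (h : ∀ (Y : Finset I), Disjoint Y D → ∀ t, IsConfN Y z t → (∀ i ∈ Y, t i ≠ a) →
      corr (siteAct ρ) z u t Y.toList (fun i => E (π i)) (tensorDual ε) = 0) : u = 0 := by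
  refine eq_zero_of_words (T := fun ν k => ρ ν (E k)) hε
    (Q := fun φ => ∀ (Y : Finset I), Disjoint Y D → ∀ t, IsConfN Y z t → (∀ i ∈ Y, t i ≠ a) →
      corr (siteAct ρ) z u t Y.toList (fun i => E (π i)) φ = 0) h ?_ ?_
  · intro φ hφ ν k Y hY t ht hta
    -- The correlators with a fresh index i over k vanish, hence so does their residue at z_ν, which
    -- is the correlator with φ precomposed with e_k at the site ν.
    obtain ⟨i, hik, hi⟩ := (hπ k).exists_notMem_finset (Y ∪ D)
    rw [Finset.mem_union, not_or] at hi
    have hik' : π i = k := hik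
    have h1 := tendsto_corr_site (act := siteAct ρ) hz (i := i) (L := Y.toList)
      (by simpa using hi.1) (fun k hk => ht.2 k (by simpa using hk)) ν u (fun i => E (π i)) φ
    have h2 : ∀ᶠ s in 𝓝[≠] (z ν), (s - z ν) * corr (siteAct ρ) z u (Function.update t i s)
        (i :: Y.toList) (fun i => E (π i)) φ = 0 := by
      have hne : ∀ᶠ s in 𝓝[≠] (z ν), s ≠ a :=
        (continuousAt_id.eventually_ne (ha ν).symm).filter_mono nhdsWithin_le_nhds
      have hconf : IsConfN ((insert i Y).erase i) z t := by rwa [Finset.erase_insert hi.1]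
      filter_upwards [hne, hconf.eventually_update (z ν)] with s hs hs'
      rw [← corr_toList (sitesCommute_siteAct ρ) hs'
        (List.nodup_cons.2 ⟨by simpa using hi.1, Y.nodup_toList⟩) (by simp), hφ _ _ _ hs', mul_zero]
      · intro j hj
        by_cases hji : j = i
        · rwa [hji, Function.update_self]
        · rw [Function.update_of_ne hji]
          exact hta j (Finset.mem_of_mem_insert_of_ne hj hji)
      · rw [Finset.disjoint_insert_left]
        exact ⟨hi.2, hY⟩
    have h3 := tendsto_nhds_unique (h1.congr' h2) tendsto_const_nhds
    rwa [hik', siteAct_apply] at h3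
  · intro φ hφ
    have := hφ ∅ (Finset.disjoint_empty_left D) 0 ⟨by simp, by simp⟩ (by simp)
    rwa [Finset.toList_empty] at this

omit [LieAlgebra ℂ g] [DecidableEq I] in
lemma seqLie_comp {r : ℕ} (E : Fin r → g) (π : I → Fin r) (l : List I) :
    seqLie (fun i => E (π i)) l = seqLie E (l.map π) := by
  cases l with
  | nil => rfl
  | cons i l => rw [seqLie, List.map_cons, seqLie, List.foldl_map]

lemma exists_lift {r : ℕ} {π : I → Fin r} (hπ : ∀ k, (π ⁻¹' {k}).Infinite) (S : Finset I)
    (w : List (Fin r)) : ∃ l : List I, l.map π = w ∧ l.Nodup ∧ ∀ i ∈ l, i ∉ S := by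
  induction w with
  | nil => exact ⟨[], by simp⟩
  | cons k w ih =>
    obtain ⟨l, hl, hnd, hS⟩ := ih
    obtain ⟨i, hik, hi⟩ := (hπ k).exists_notMem_finset (S ∪ l.toFinset)
    rw [Finset.mem_union, not_or, List.mem_toFinset] at hi
    refine ⟨i :: l, by rw [List.map_cons, hl]; congr 1, List.nodup_cons.2 ⟨hi.2, hnd⟩, ?_⟩
    intro j hj
    rcases List.mem_cons.1 hj with rfl | hj
    exacts [hi.1, hS j hj]

lemma exists_lifts {r : ℕ} {π : I → Fin r} (hπ : ∀ k, (π ⁻¹' {k}).Infinite)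
    (w : List (Fin r)) (m : ℕ) :
    ∃ Is : Fin m → List I, (∀ k, (Is k).map π = w) ∧ (List.ofFn Is).flatten.Nodup := by
  induction m with
  | zero => exact ⟨fun k => [], fun k => k.elim0, by simp⟩
  | succ m ih =>
    obtain ⟨Is, h1, h2⟩ := ih
    obtain ⟨l, hl, hnd, hS⟩ := exists_lift hπ (List.ofFn Is).flatten.toFinset w
    refine ⟨Fin.cons l Is, Fin.cases hl h1, ?_⟩
    rw [List.ofFn_succ, List.flatten_cons, List.nodup_append]
    simp only [Fin.cons_zero, Fin.cons_succ]
    refine ⟨hnd, h2, ?_⟩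
    rintro i hi _ hj rfl
    exact hS i hi (List.mem_toFinset.2 hj)

end Diagonal

/-! ### Sections -/

section Sections

/-- A basis of W turns the tensor into a finitely supported family in M, to which separation applies
entry by entry. -/
lemma eq_zero_of_rTensor {M W κ κ' : Type*} [AddCommGroup M] [Module ℂ M] [AddCommMonoid W]
    [Module ℂ W] (b : Module.Basis κ' ℂ W) {f : κ → Module.Dual ℂ M} (hf : ∀ m, (∀ k, f k m = 0) → m = 0) {ζ : M ⊗[ℂ] W}
    (h : ∀ k, TensorProduct.lid ℂ W (LinearMap.rTensor W (f k) ζ) = 0) : ζ = 0 := by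
  classical
  let Φ := TensorProduct.equivFinsuppOfBasisRight (M := M) b
  have hΦ : ∀ k i, f k ∘ₗ Finsupp.lapply i ∘ₗ Φ.toLinearMap =
      b.coord i ∘ₗ (TensorProduct.lid ℂ W).toLinearMap ∘ₗ LinearMap.rTensor W (f k) := by
    intro k i
    ext m w
    simp [Φ, mul_comm]
  refine Φ.injective ?_
  rw [map_zero]
  ext i
  refine hf _ fun k => ?_
  have h1 := LinearMap.congr_fun (hΦ k i) ζ
  simp only [LinearMap.comp_apply, LinearEquiv.coe_coe, h k, map_zero] at h1
  exact h1

variable {n : ℕ} {U : Set (Fin n → ℂ)} {W : Type*} [AddCommMonoid W] [Module ℂ W]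

lemma evalSec_tmul (z : U) (f : hol U) (w : W) : evalSec z (f ⊗ₜ[ℂ] w) = (f : U → ℂ) z • w := by
  simp [evalSec]

lemma eq_zero_of_evalSec {κ : Type*} (b : Module.Basis κ ℂ W) {ζ : hol U ⊗[ℂ] W}
    (h : ∀ z : U, evalSec z ζ = 0) : ζ = 0 := by
  refine eq_zero_of_rTensor b (f := fun z : U => (LinearMap.proj (R := ℂ) (φ := fun _ : U => ℂ) z) ∘ₗ
      (hol U).val.toLinearMap) (fun m hm => Subtype.ext (funext hm)) h

lemma evalSec_lTensor {W' : Type*} [AddCommMonoid W'] [Module ℂ W'] (T : W →ₗ[ℂ] W') (z : U)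
    (ζ : hol U ⊗[ℂ] W) : evalSec z (LinearMap.lTensor (hol U) T ζ) = T (evalSec z ζ) := by
  induction ζ using TensorProduct.induction_on with
  | zero => simp only [map_zero]
  | tmul f w => rw [LinearMap.lTensor_tmul, evalSec_tmul, evalSec_tmul, map_smul]
  | add x y hx hy => simp only [map_add, hx, hy]

variable {r : ℕ} {A : Matrix (Fin r) (Fin r) ℤ} {I : Type*} [DecidableEq I] {π : I → Fin r}
  {lam : Fin n → Fin r → ℕ} {ρ : ∀ ν, LieAlg A →ₗ⁅ℂ⁆ Module.End ℂ (V A π (lam ν))}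

lemma evalSec_opE (z : U) (e : LieAlg A) (ζ : hol U ⊗[ℂ] VT A π lam) :
    evalSec z (opE A π lam ρ U e ζ) =
      siteSum (siteAct ρ) (z : Fin n → ℂ) e (evalSec z ζ) := by
  induction ζ using TensorProduct.induction_on with
  | zero => simp only [map_zero]
  | tmul f w =>
    rw [opE, LinearMap.sum_apply, map_sum, evalSec_tmul, siteSum, LinearMap.sum_apply]
    refine Finset.sum_congr rfl fun ν _ => ?_
    rw [TensorProduct.map_tmul, evalSec_tmul, LinearMap.smul_apply, map_smul, smul_smul]
    rfl
  | add x y hx hy => simp only [map_add, hx, hy]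

/-- A section vanishes as soon as all its values do, so membership can be tested at each z. -/
lemma mem_wzw_iff (e : LieAlg A) (ℓ : ℕ) (ζ : hol U ⊗[ℂ] invariants A π lam ρ) :
    ζ ∈ wzw A π lam ρ U e ℓ ↔ ∀ z : U, (siteSum (siteAct ρ) (z : Fin n → ℂ) e ^ (1 + ℓ))
      (evalSec z ζ : invariants A π lam ρ) = 0 := by
  have hpow : ∀ (m : ℕ) (z : U) (η : hol U ⊗[ℂ] VT A π lam), evalSec z ((opE A π lam ρ U e ^ m) η) =
      (siteSum (siteAct ρ) (z : Fin n → ℂ) e ^ m) (evalSec z η) := by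
    intro m z η
    induction m with
    | zero => rfl
    | succ m ih => rw [pow_succ', pow_succ', Module.End.mul_apply, Module.End.mul_apply,
        evalSec_opE, ih]
  have heval : ∀ z : U, evalSec z ((opE A π lam ρ U e ^ (1 + ℓ))
      (LinearMap.lTensor (hol U) (invariants A π lam ρ).subtype ζ)) =
      (siteSum (siteAct ρ) (z : Fin n → ℂ) e ^ (1 + ℓ))
        (evalSec z ζ : invariants A π lam ρ) := by
    intro z
    rw [hpow, evalSec_lTensor]
    rfl
  rw [wzw, LinearMap.mem_ker, LinearMap.comp_apply]
  constructor
  · intro h z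
    rw [← heval, h, map_zero]
  · exact fun h => eq_zero_of_evalSec (Module.Basis.ofVectorSpace ℂ (VT A π lam))
      fun z => (heval z).trans (h z)

lemma siteSum_invariants {v : VT A π lam} (hv : v ∈ invariants A π lam ρ) (x : LieAlg A) :
    siteSum (siteAct ρ) 1 x v = 0 := by
  have := (Submodule.mem_iInf _).1 hv x
  rw [LinearMap.mem_ker] at this
  rw [← this, siteSum]
  simp only [Pi.one_apply, one_smul]
  rfl

end Sections

/-! ### The criterion at a fixed z -/

section Main

variable {r : ℕ} {A : Matrix (Fin r) (Fin r) ℤ}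

/-- On the vacuum of the module of the j-th fundamental weight a combination of coroots acts by its
j-th coefficient. -/
lemma linearIndependent_genH (hA : IsGCM A) {I : Type*} [DecidableEq I] {π : I → Fin r}
    (hπ : ∀ k, (π ⁻¹' {k}).Infinite) : LinearIndependent ℂ (genH A) := by
  rw [Fintype.linearIndependent_iff]
  intro c hc j
  obtain ⟨ρ, -, -, -, v, hv, hρ⟩ := exists_action π (Pi.single j 1) hA hπ
  have h1 : ρ (∑ k, c k • genH A k) v = 0 := by rw [hc, map_zero, LinearMap.zero_apply]
  simp only [map_sum, map_smul, LinearMap.sum_apply, LinearMap.smul_apply, hρ, smul_smul,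
    ← Finset.sum_smul, Pi.single_apply, Nat.cast_ite, Nat.cast_one, Nat.cast_zero, mul_ite,
    mul_one, mul_zero, Finset.sum_ite_eq', Finset.mem_univ, if_true] at h1
  exact (smul_eq_zero.1 h1).resolve_right hv

variable [LieAlgebra.IsSimple ℂ (LieAlg A)] [FiniteDimensional ℂ (LieAlg A)]
  {I : Type*} [DecidableEq I] [Countable I] {π : I → Fin r} {n : ℕ} [NeZero n]
  {lam : Fin n → Fin r → ℕ} {ρ : ∀ ν, LieAlg A →ₗ⁅ℂ⁆ Module.End ℂ (V A π (lam ν))}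

/-- An invariant vector is killed by the power of the operator if and only if the iterated residues
of its polydifferential vanish on the diagonals. -/
lemma siteSum_pow_eq_zero_iff (hA : IsGCM A) (hπ : ∀ k, (π ⁻¹' {k}).Infinite)
    (hρ : ∀ ν (v : V A π (lam ν)) (X : Finset I) (t : I → ℂ) (z : ℂ), IsConf X t z →
      (v : PolyDiff I) X t z = corr (fun _ : Unit => ρ ν) (fun _ => z) v t X.toList
        (fun i => genE A (π i)) (vacDual π A (lam ν)))
    (hsep : ∀ ν v, (∀ w : List (Fin r), vacDual π A (lam ν)
      ((w.map fun k => ρ ν (genE A k)).prod v) = 0) → v = 0)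
    {θ : Fin r → ℤ} (hθ : IsHighestRoot A θ) {e : LieAlg A} (he : e ∈ rootSpace A θ) (he0 : e ≠ 0)
    {ℓ : ℕ} (hℓ : ∀ ν, ρ ν e ^ (1 + ℓ) = 0) {z : Fin n → ℂ} (hz : Function.Injective z)
    {v : VT A π lam} (hv : v ∈ invariants A π lam ρ) :
    (siteSum (siteAct ρ) z e ^ (1 + ℓ)) v = 0 ↔
      ∀ Is : Fin (1 + ℓ) → List I, (∀ k, (Is k).length = coxeterNumber A - 1) →
        (List.ofFn Is).flatten.Nodup → ∀ X : Finset I, (List.ofFn Is).flatten.toFinset ⊆ X →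
        VanishesOnDiag X (List.ofFn Is).flatten.toFinset z
          (resIter (List.ofFn Is) fun t => coeff A π lam X z t v) := by
  have hlin := linearIndependent_genH hA hπ
  obtain ⟨f, h, hef, hhe, hhf⟩ := exists_sl2_highest hA hlin hθ he he0
  have hact := sitesCommute_siteAct ρ
  have hnil : ∀ ν, IsNilpotent (siteAct ρ ν e) := by
    intro ν
    refine ⟨1 + ℓ, ?_⟩
    rw [siteAct_apply, siteMap_pow, hℓ]
    exact map_zero (siteLin ν)
  have hcurrent := fun (a : ℂ) (ha : ∀ ν, a ≠ z ν) => current_pow_eq_zero_iff (v := v) hact hef hhe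
    hhf hnil (siteSum_invariants hv) ha (1 + ℓ)
  have hc : ∀ l : List I, ∃ c : ℂ, l.length = coxeterNumber A - 1 →
      seqLie (fun i => genE A (π i)) l = c • e := by
    intro l
    by_cases hl : l.length = coxeterNumber A - 1
    · obtain ⟨c, hc⟩ := seqLie_eq_smul_highest hlin hθ he he0 (w := l.map π) (by simpa using hl)
      exact ⟨c, fun _ => by rw [seqLie_comp, hc]⟩
    · exact ⟨0, fun h => absurd h hl⟩
  choose c hc using hc
  have hpos := coxeterNumber_pos hlin hθ
  have hlim : ∀ Is : Fin (1 + ℓ) → List I, (∀ k, (Is k).length = coxeterNumber A - 1) →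
      (List.ofFn Is).flatten.Nodup → ∀ X : Finset I, (List.ofFn Is).flatten.toFinset ⊆ X →
      ∀ (p : I → ℂ) (a : ℂ), (∀ i ∈ (List.ofFn Is).flatten.toFinset, p i = a) → (∀ ν, a ≠ z ν) →
      IsConfN (X \ (List.ofFn Is).flatten.toFinset) z p →
      Tendsto (resIter (List.ofFn Is) fun t => coeff A π lam X z t v) (𝓝[{t | IsConfN X z t}] p)
        (𝓝 (((List.ofFn Is).map c).prod * corr (siteAct ρ) z
          ((current (siteAct ρ) z e a ^ (1 + ℓ)) v) p
          (X \ (List.ofFn Is).flatten.toFinset).toList (fun i => genE A (π i))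
            (tensorDual fun ν => vacDual π A (lam ν)))) := by
    intro Is hlen hnd X hX p a hpa haz hp
    have hlen' : ∀ l ∈ List.ofFn Is, l.length = coxeterNumber A - 1 := by
      intro l hl
      obtain ⟨k, rfl⟩ := List.mem_ofFn.1 hl
      exact hlen k
    have hne : ∀ l ∈ List.ofFn Is, l ≠ [] := by
      rintro l hl rfl
      have := hlen' _ hl
      simp only [List.length_nil] at this
      omega
    -- A default value for `getLastD`, never taken since the sequences are nonempty.
    have d : I := (Is ⟨0, by omega⟩).head (hne _ (List.mem_ofFn.2 ⟨_, rfl⟩))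
    have := tendsto_resIter hact (fun i => lie_genE_highest hlin hθ he (π i))
      (fun t ht => coeff_eq_corr π lam hρ ht v) d c (List.ofFn Is) hne hnd hX
      (fun l hl => hc l (hlen' l hl)) hpa haz hp
    rwa [List.length_ofFn] at this
  constructor
  · intro h0 Is hlen hnd X hX p hp
    obtain ⟨a, hpa, hinj, hpne, hpz⟩ := hp
    have haz : ∀ ν, a ≠ z ν := by
      have hne : Is ⟨0, by omega⟩ ≠ [] := by
        intro h
        have := hlen ⟨0, by omega⟩
        rw [h, List.length_nil] at this
        omega
      have hmem : (Is ⟨0, by omega⟩).head hne ∈ (List.ofFn Is).flatten.toFinset := by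
        rw [List.mem_toFinset, List.mem_flatten]
        exact ⟨_, List.mem_ofFn.2 ⟨_, rfl⟩, List.head_mem hne⟩
      intro ν
      rw [← hpa _ hmem]
      exact hpz _ (hX hmem) ν
    have := hlim Is hlen hnd X hX p a hpa haz
      ⟨hinj, fun i hi => hpz i (Finset.mem_sdiff.1 hi).1⟩
    rwa [(hcurrent a haz).2 h0, ← corrVec_apply, map_zero, mul_zero] at this
  · intro hvan
    obtain ⟨w, hw, hw0⟩ := exists_seqLie_ne_zero hlin hθ he he0
    -- All 1 + ℓ sequences are disjoint lifts of one word whose bracket is nonzero, so every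
    -- constant c is nonzero.
    obtain ⟨Is, hIs, hnd⟩ := exists_lifts hπ w (1 + ℓ)
    have hlen : ∀ k, (Is k).length = coxeterNumber A - 1 := fun k => by
      rw [← hw, ← hIs k, List.length_map]
    obtain ⟨a, ha⟩ := (Set.finite_range z).exists_notMem
    have haz : ∀ ν, a ≠ z ν := fun ν h => ha ⟨ν, h.symm⟩
    rw [← hcurrent a haz]
    refine eq_zero_of_corr hπ hsep hz haz (D := (List.ofFn Is).flatten.toFinset) ?_
    intro Y hY t ht hta
    set D := (List.ofFn Is).flatten.toFinset with hD
    -- The test point on the diagonal: common value a, the other coordinates those of t.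
    let p : I → ℂ := fun i => if i ∈ D then a else t i
    have hpD : ∀ i ∈ D, p i = a := fun i hi => if_pos hi
    have hpY : ∀ i ∈ Y, p i = t i := fun i hi => if_neg (Finset.disjoint_left.1 hY hi)
    have hsd : (D ∪ Y) \ D = Y := by
      rw [Finset.union_sdiff_left, hY.sdiff_eq_left]
    have hpY' : IsConfN Y z p := by
      refine ⟨fun i hi j hj hij => ?_, fun i hi ν => ?_⟩
      · rw [hpY i hi, hpY j hj] at hij
        exact ht.1 hi hj hij
      · rw [hpY i hi]
        exact ht.2 i hi ν
    have hpz : ∀ i ∈ D ∪ Y, ∀ ν, p i ≠ z ν := by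
      intro i hi ν
      rcases Finset.mem_union.1 hi with hi | hi
      · rw [hpD i hi]; exact haz ν
      · exact hpY'.2 i hi ν
    have h1 := hvan Is hlen hnd (D ∪ Y) Finset.subset_union_left p
      ⟨a, hpD, by rw [hsd]; exact hpY'.1, fun i hi => by
        rw [hsd] at hi
        rw [hpY i hi]
        exact hta i hi, hpz⟩
    have h2 := hlim Is hlen hnd (D ∪ Y) Finset.subset_union_left p a hpD haz (by
      rw [← hD, hsd]; exact hpY')
    -- The limit computed in `hlim` and the assumed limit 0 then coincide, so the constants times
    -- the correlator vanish.
    have hbot := neBot_nhdsWithin_isConfN hpz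
    have h3 := tendsto_nhds_unique h2 h1
    rw [← hD, hsd] at h3
    rw [← corr_congr (fun _ _ => rfl) (fun i hi => hpY i (by simpa using hi))]
    refine (mul_eq_zero.1 h3).resolve_left fun h0 => ?_
    obtain ⟨l, hl, hl0⟩ := List.mem_map.1 (List.prod_eq_zero_iff.1 h0)
    obtain ⟨k, rfl⟩ := List.mem_ofFn.1 hl
    have := hc (Is k) (hlen k)
    rw [hl0, zero_smul, seqLie_comp, hIs] at this
    exact hw0 this

end Main

end WZW

end

theorem mainTheorem7 {r : ℕ} (A : Matrix (Fin r) (Fin r) ℤ) (hA : WZW.IsGCM A)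
    [FiniteDimensional ℂ (WZW.LieAlg A)] [LieAlgebra.IsSimple ℂ (WZW.LieAlg A)]
    {I : Type*} [DecidableEq I] [Countable I] (π : I → Fin r)
    (hπ : ∀ k, (π ⁻¹' {k}).Infinite)
    {n : ℕ} (hn : 2 ≤ n) (lam : Fin n → Fin r → ℕ) :
    ∃ ρ : ∀ ν, WZW.LieAlg A →ₗ⁅ℂ⁆ Module.End ℂ (WZW.V A π (lam ν)),
      (∀ ν, WZW.IsAction A π (lam ν) (ρ ν)) ∧
      ∀ (θ : Fin r → ℤ), WZW.IsHighestRoot A θ →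
      ∀ e ∈ WZW.rootSpace A θ, e ≠ 0 →
      ∀ ℓ : ℕ, 0 < ℓ → (∀ ν, ρ ν e ^ (1 + ℓ) = 0) →
      ∀ U : Set (Fin n → ℂ), (∃ O, IsOpen O ∧ U = O ∩ WZW.confSpace n) →
      ∀ ζ : WZW.hol U ⊗[ℂ] WZW.invariants A π lam ρ,
        ζ ∈ WZW.wzw A π lam ρ U e ℓ ↔
          ∀ Is : Fin (1 + ℓ) → List I,
            (∀ k, (Is k).length = WZW.coxeterNumber A - 1) →
            (List.ofFn Is).flatten.Nodup →
            ∀ X : Finset I, (List.ofFn Is).flatten.toFinset ⊆ X →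
            ∀ z : U, WZW.VanishesOnDiag X (List.ofFn Is).flatten.toFinset (z : Fin n → ℂ)
              (WZW.resIter (List.ofFn Is) (WZW.secCoeff A π lam ρ ζ X z)) := by
  have : NeZero n := ⟨by omega⟩
  choose ρ hact hρ hsep _ using fun ν => WZW.exists_action π (lam ν) hA hπ
  refine ⟨ρ, hact, ?_⟩
  intro θ hθ e he he0 ℓ _ hℓ U hU ζ
  obtain ⟨O, -, rfl⟩ := hU
  have hz : ∀ z : (O ∩ WZW.confSpace n : Set (Fin n → ℂ)), Function.Injective (z : Fin n → ℂ) :=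
    fun z => z.2.2.1
  rw [WZW.mem_wzw_iff]
  have key := fun z : (O ∩ WZW.confSpace n : Set (Fin n → ℂ)) =>
    WZW.siteSum_pow_eq_zero_iff hA hπ hρ hsep hθ he he0 hℓ (hz z) (WZW.evalSec z ζ).2
  constructor
  · exact fun h Is hlen hnd X hX z => (key z).1 (h z) Is hlen hnd X hX
  · exact fun h z => (key z).2 fun Is hlen hnd X hX => h Is hlen hnd X hX z
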